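/- **Theorem (Inference in least squares with SRHT sketching).** *Sketching matrices.* Let $H_0=1$ and $H_{t+1}=\frac1{\sqrt2}\begin{pmatrix}H_t&H_t\\H_t&-H_t\end{pmatrix}$. For a sample size $n$ put $n'=2^{\lceil\log_2 n\rceil}$ (so $n'=n$ when $n$ is a power of two). A subsampled randomized Hadamard (SRHT) sketching matrix with sketch size $m$ is $S_{m,n}=\sqrt{n'/m}\,B\,H_{\log_2 n'}\,D\,\Pi_n$, where $B$ is an $n'\times n'$ diagonal matrix with Bernoulli$(m/n')$ diagonal entries, $D$ is an $n'\times n'$ diagonal matrix with uniform $\pm1$ diagonal entries, all $2n'$ of these entries are independent, and $\Pi_n=\begin{pmatrix}I_n\\0\end{pmatrix}$ is the $n'\times n$ zero-padding matrix. Put $\gamma_n=m/n'$. *Data and estimators.* Let $p\ge1$ be fixed. Consider any sequence of deterministic data sets $(X_n,y_n)$, with $X_n\in\mathbb R^{n\times p}$ and $y_n\in\mathbb R^n$, whose sample sizes $n$ tend to infinity (possibly along a subsequence of the integers), with sketch sizes $m=m_n$. Let $X_n=U_nL_nV_n^\top$ be a thin singular value decomposition, where $U_n^\top U_n=I_p$,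 $V_n$ is orthogonal, and $L_n=\mathrm{diag}(\ell_{n,1},\dots,\ell_{n,p})$ with $\ell_{n,1}\ge\dots\ge\ell_{n,p}>0$. Let $U_{i:}$ denote the $i$-th row of $U_n$. Put $\beta_n=(X_n^\top X_n)^{-1}X_n^\top y_n$ and $\varepsilon_n=y_n-X_n\beta_n$. Write $S=S_{m,n}$, $\tilde X=SX_n$, $\tilde y=Sy_n$, and $$\hat\beta^{(s)}=(\tilde X^\top\tilde X)^{-1}\tilde X^\top\tilde y,\qquad \hat\beta^{(pa)}=(\tilde X^\top\tilde X)^{-1}X_n^\top y_n,\qquad \tilde\varepsilon=\tilde y-\tilde X\hat\beta^{(s)} .$$ *Assumptions.* $n\to\infty$, $m\to\infty$, $m/\log^2 n\to\infty$, $\limsup\gamma_n<1$, and $\limsup \ell_{n,1}/\ell_{n,p}<\infty$. *Conclusions.* Square roots of matrices below are the symmetric positive semidefinite ones, and $\Rightarrow$ is convergence in distribution. 1. Suppose $\varepsilon_n\ne0$ for all $n$, and that either $\max_{i}\|U_{i:}\|\to0$ or $\max_i|\varepsilon_{n,i}|/\|\varepsilon_n\|\to0$. Then $$\Big(\frac{m}{1-\gamma_n}\Big)^{1/2}\|\tilde\varepsilon\|^{-1}(\tilde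 X^\top\tilde X)^{1/2}(\hat\beta^{(s)}-\beta_n)\Rightarrow N(0,I_p).$$ 2. Suppose $X_n\beta_n\ne0$ for all $n$, and that either $\max_{i}\|U_{i:}\|\to0$ or $\max_i|(X_n\beta_n)_i|/\|X_n\beta_n\|\to0$. Then $$\Big(\frac{m}{1-\gamma_n}\Big)^{1/2}\Big(\|\tilde X\hat\beta^{(pa)}\|^2(\tilde X^\top\tilde X)^{-1}+2\hat\beta^{(pa)}\hat\beta^{(pa)\top}\Big)^{-1/2}(\hat\beta^{(pa)}-\beta_n)\Rightarrow N(0,I_p).$$ -/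

import Mathlib

open MeasureTheory ProbabilityTheory Filter Topology Matrix
open scoped ENNReal

namespace SketchedLS

/-! ### Linear algebra -/

/-- The Euclidean norm of a coordinate vector. -/
noncomputable def euclNorm {ι : Type*} [Fintype ι] (v : ι → ℝ) : ℝ :=
  ‖(WithLp.toLp 2 v : EuclideanSpace ℝ ι)‖

/-- The symmetric square root of a real symmetric positive semidefinite matrix: the function
`Real.sqrt` applied to the eigenvalues, in an orthonormal basis of eigenvectors. -/
noncomputable def matSqrt {p : ℕ} (A : Matrix (Fin p) (Fin p) ℝ) : Matrix (Fin p) (Fin p) ℝ :=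
  cfc Real.sqrt A

/-- `X = U diag(ℓ) Vᵀ` is a (thin) singular value decomposition of the `n × p` matrix `X`, of full
column rank: `UᵀU = I`, `V` is orthogonal, and the singular values `ℓ` are nonincreasing and
positive. -/
structure IsThinSVD {n p : ℕ} (X U : Matrix (Fin n) (Fin p) ℝ) (ℓ : Fin p → ℝ)
    (V : Matrix (Fin p) (Fin p) ℝ) : Prop where
  orthU : Uᵀ * U = 1
  orthV : Vᵀ * V = 1
  anti : Antitone ℓ
  pos : ∀ i, 0 < ℓ i
  eq_mul : X = U * Matrix.diagonal ℓ * Vᵀ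

/-! ### Least squares and the two sketched estimators -/

section LeastSquares

variable {N n p : ℕ}

/-- The least squares parameter `(XᵀX)⁻¹ Xᵀ y`. -/
noncomputable def lsCoef (X : Matrix (Fin n) (Fin p) ℝ) (y : Fin n → ℝ) : Fin p → ℝ :=
  (Xᵀ * X)⁻¹ *ᵥ (Xᵀ *ᵥ y)

/-- The fitted values `X β`, for the least squares parameter `β`. -/
noncomputable def lsFitted (X : Matrix (Fin n) (Fin p) ℝ) (y : Fin n → ℝ) : Fin n → ℝ :=
  X *ᵥ lsCoef X y

/-- The residuals `ε = y - X β`, for the least squares parameter `β`. -/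
noncomputable def lsResidual (X : Matrix (Fin n) (Fin p) ℝ) (y : Fin n → ℝ) : Fin n → ℝ :=
  y - lsFitted X y

/-- The sketch-and-solve estimator: least squares on the sketched data `(S X, S y)`. -/
noncomputable def sketchSolve (S : Matrix (Fin N) (Fin n) ℝ) (X : Matrix (Fin n) (Fin p) ℝ) (y : Fin n → ℝ) :
    Fin p → ℝ :=
  ((S * X)ᵀ * (S * X))⁻¹ *ᵥ ((S * X)ᵀ *ᵥ (S *ᵥ y))

/-- The partial sketching estimator `((SX)ᵀ(SX))⁻¹ Xᵀ y`. -/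
noncomputable def partialSketch (S : Matrix (Fin N) (Fin n) ℝ) (X : Matrix (Fin n) (Fin p) ℝ) (y : Fin n → ℝ) :
    Fin p → ℝ :=
  ((S * X)ᵀ * (S * X))⁻¹ *ᵥ (Xᵀ *ᵥ y)

/-- The sketched residuals `S y - (S X) b`, where `b` is the sketch-and-solve estimator. -/
noncomputable def sketchResidual (S : Matrix (Fin N) (Fin n) ℝ) (X : Matrix (Fin n) (Fin p) ℝ)
    (y : Fin n → ℝ) : Fin N → ℝ :=
  S *ᵥ y - (S * X) *ᵥ sketchSolve S X y

/-- The studentized sketch-and-solve estimator, for the scaling constant `c`, namely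
`c ‖ε̃‖⁻¹ ((SX)ᵀ(SX))^{1/2} (b - β)`, where `b` is the estimator and `ε̃` the sketched residuals. -/
noncomputable def studentizedSketchSolve (c : ℝ) (S : Matrix (Fin N) (Fin n) ℝ) (X : Matrix (Fin n) (Fin p) ℝ)
    (y : Fin n → ℝ) : EuclideanSpace ℝ (Fin p) :=
  WithLp.toLp 2 ((c * (euclNorm (sketchResidual S X y))⁻¹) •
    (matSqrt ((S * X)ᵀ * (S * X)) *ᵥ (sketchSolve S X y - lsCoef X y)))

/-- The studentized partial sketching estimator, for the scaling constant `c`, namely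
`c (‖S X b‖² ((SX)ᵀ(SX))⁻¹ + 2 b bᵀ)^{-1/2} (b - β)`, where `b` is the estimator. -/
noncomputable def studentizedPartialSketch (c : ℝ) (S : Matrix (Fin N) (Fin n) ℝ)
    (X : Matrix (Fin n) (Fin p) ℝ) (y : Fin n → ℝ) : EuclideanSpace ℝ (Fin p) :=
  WithLp.toLp 2 (c •
    ((matSqrt (euclNorm ((S * X) *ᵥ partialSketch S X y) ^ 2 • ((S * X)ᵀ * (S * X))⁻¹
        + (2 : ℝ) • Matrix.vecMulVec (partialSketch S X y) (partialSketch S X y)))⁻¹ *ᵥ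
      (partialSketch S X y - lsCoef X y)))

end LeastSquares

/-! ### The subsampled randomized Hadamard transform -/

/-- The normalized Hadamard matrices: `H₀ = 1` and `H_{t+1} = 2^{-1/2} [H_t, H_t; H_t, -H_t]`. -/
noncomputable def hadamardMatrix : (t : ℕ) → Matrix (Fin (2 ^ t)) (Fin (2 ^ t)) ℝ
  | 0 => 1
  | t + 1 =>
    let e : Fin (2 ^ t) ⊕ Fin (2 ^ t) ≃ Fin (2 ^ (t + 1)) :=
      finSumFinEquiv.trans (finCongr (by rw [pow_succ, mul_two]))
    (1 / √2) • Matrix.reindex e e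
      (Matrix.fromBlocks (hadamardMatrix t) (hadamardMatrix t) (hadamardMatrix t) (-hadamardMatrix t))

/-- The exponent `⌈log₂ n⌉`. -/
def padExp (n : ℕ) : ℕ := Nat.clog 2 n

/-- The padded sample size: the smallest power of two that is at least `n`. It is `n` itself
when `n` is a power of two. -/
abbrev padSize (n : ℕ) : ℕ := 2 ^ padExp n

/-- The sampling fraction, i.e. the sketch size divided by the padded sample size. -/
noncomputable def samplingFraction (m n : ℕ) : ℝ := (m : ℝ) / padSize n

/-- The zero-padding matrix `Π`, with the identity on top of a zero block. -/
noncomputable def padMatrix (n : ℕ) : Matrix (Fin (padSize n)) (Fin n) ℝ :=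
  Matrix.of fun i j => if (i : ℕ) = (j : ℕ) then 1 else 0

/-- The matrix `√(N/m) diag(b) H diag(d) Π`, where `N` is the padded sample size. -/
noncomputable def srhtMatrix (m n : ℕ) (b d : Fin (padSize n) → ℝ) : Matrix (Fin (padSize n)) (Fin n) ℝ :=
  √((padSize n : ℝ) / m) •
    (Matrix.diagonal b * hadamardMatrix (padExp n) * Matrix.diagonal d * padMatrix n)

/-- The Bernoulli distribution on `{0, 1}` with success probability `q ∈ [0,1]`, as a measure
on `ℝ`. -/
noncomputable def bernoulliLaw (q : ℝ) : Measure ℝ :=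
  ENNReal.ofReal q • Measure.dirac 1 + ENNReal.ofReal (1 - q) • Measure.dirac 0

/-- The Rademacher distribution, uniform on `{-1, 1}`, as a measure on `ℝ`. -/
noncomputable def rademacherLaw : Measure ℝ :=
  (2⁻¹ : ℝ≥0∞) • Measure.dirac 1 + (2⁻¹ : ℝ≥0∞) • Measure.dirac (-1)

/-- `S` is a subsampled randomized Hadamard sketching matrix for sample size `n` and sketch
size `m`: `S = √(N/m) B H D Π`, where `N` is the padded sample size, `B` is diagonal with
Bernoulli(`m/N`) entries, `D` is diagonal with Rademacher entries, and all the `2N` diagonal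
entries of `B` and `D` are independent. -/
def IsSRHT {Ω : Type*} [MeasurableSpace Ω] (P : Measure Ω) (m n : ℕ)
    (S : Ω → Matrix (Fin (padSize n)) (Fin n) ℝ) : Prop :=
  ∃ B D : Fin (padSize n) → Ω → ℝ,
    iIndepFun (Sum.elim B D) P ∧
    (∀ i, HasLaw (B i) (bernoulliLaw (samplingFraction m n)) P) ∧
    (∀ i, HasLaw (D i) rademacherLaw P) ∧
    ∀ ω, S ω = srhtMatrix m n (fun i => B i ω) (fun i => D i ω)

/-! ### Conditions on the sequence of data sets -/

/-- Bounded condition number: the limit superior of (largest singular value) / (smallest singular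
value) is finite. -/
def BoundedCondNumber {p : ℕ} (hp : 0 < p) (ℓ : ℕ → Fin p → ℝ) : Prop :=
  limsup (fun k => ((ℓ k ⟨0, hp⟩ / ℓ k ⟨p - 1, Nat.sub_lt hp Nat.one_pos⟩ : ℝ) : EReal)) atTop < ⊤

/-- The largest Euclidean norm of a row of `U k` (the square root of the largest leverage score)
tends to zero. -/
def VanishingLeverage {p : ℕ} {n : ℕ → ℕ} (U : ∀ k, Matrix (Fin (n k)) (Fin p) ℝ) : Prop :=
  Tendsto (fun k => ⨆ i, euclNorm (U k i)) atTop (𝓝 0)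

/-- `max_i |v_i| / ‖v‖` tends to zero along the sequence of vectors `v`. -/
def Delocalized {n : ℕ → ℕ} (v : ∀ k, Fin (n k) → ℝ) : Prop :=
  Tendsto (fun k => ⨆ i, |v k i| / euclNorm (v k)) atTop (𝓝 0)

end SketchedLS

open SketchedLS

/-! Write `X = Q A` with `Q = U Vᵀ` and `A = V diag(ℓ) Vᵀ`, and put `E = SᵀS - 1`. The sketch enters
both estimators through bilinear forms `wᵀ E v`. The theorem is a central limit theorem for one such
form, combined with a first-order expansion of the estimators.

Let `a` and `e` be the Walsh transforms of the zero-padded `w` and `v` with randomized signs, and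
`N` the padded size. By Parseval, `wᵀ E v = N⁻¹ ∑ aᵢ eᵢ (bᵢ / γ - 1)`, see
`dotProduct_gramErr_srhtOf`. Given the signs, this is a sum of independent centered terms; after
scaling by `c = √(m / (1 - γ))` its variance is `N⁻¹ ∑ aᵢ² eᵢ²`. A third-order expansion of
characteristic functions (`norm_integral_exp_sum_ctr_sub_le`) gives conditional normality with error
of order `m^(-1/2)`, because the transforms have bounded sixth moments for every vector of bounded
norm.

It remains to see that the conditional variance concentrates. Walsh functions are closed under
products, so it is a polynomial of degree four in the signs. Coinciding indices contribute the
constant `|w|² |v|² + 2 (w·v)² - 2 ∑ (wⱼ vⱼ)²`; the other monomials are squarefree, hence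
orthogonal. If `w` or `v` has all coordinates at most `ρ`, the last sum is `O(ρ²)` and the
fluctuation `O(ρ)` (`integral_abs_condVar_sub_le`). So for a unit vector `v` the vector `c Qᵀ E v`
is nearly normal with covariance `1 + 2 (Qᵀv)(Qᵀv)ᵀ`.

For sketch-and-solve, `v` is the normalized residual, which is orthogonal to `Q`, and the covariance
is the identity. For partial sketching, `v = Q θ` is the normalized fit, and the studentizing matrix
estimates the covariance `1 + 2 θ θᵀ`. Both studentized estimators equal `c R Qᵀ E v` up to `C c`
times the squared sketching error (`exists_sketchSolve_expansion`,
`exists_partialSketch_expansion`). That error has mean of order `1 / m` and `c` has order `√m`, so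
the remainder vanishes. All bounds are explicit and meet in `norm_charFun_sub_le`; hence neither `A`
nor `R` has to converge. -/

namespace SketchedLS

/-! ### Independent coins -/

/-- The law of a coin which shows `true` with probability `q`. -/
noncomputable def coinLaw (q : ℝ) : Measure Bool :=
  ENNReal.ofReal q • Measure.dirac true + ENNReal.ofReal (1 - q) • Measure.dirac false

/-- The law of a family of independent coins. -/
noncomputable def coins (ι : Type*) [Fintype ι] (q : ℝ) : Measure (ι → Bool) :=
  Measure.pi fun _ => coinLaw q

instance isFiniteMeasure_coinLaw (q : ℝ) : IsFiniteMeasure (coinLaw q) := by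
  refine ⟨?_⟩
  simp [coinLaw]

theorem isProbabilityMeasure_coinLaw {q : ℝ} (h0 : 0 ≤ q) (h1 : q ≤ 1) :
    IsProbabilityMeasure (coinLaw q) := by
  refine ⟨?_⟩
  simp only [coinLaw, Measure.add_apply, Measure.smul_apply, measure_univ, smul_eq_mul, mul_one]
  rw [← ENNReal.ofReal_add h0 (by linarith)]
  simp

theorem integral_coinLaw {E : Type*} [NormedAddCommGroup E] [NormedSpace ℝ E] [CompleteSpace E]
    {q : ℝ} (h0 : 0 ≤ q) (h1 : q ≤ 1) (f : Bool → E) :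
    ∫ b, f b ∂coinLaw q = q • f true + (1 - q) • f false := by
  have hi : ∀ (r : ℝ) (b : Bool), Integrable f (ENNReal.ofReal r • Measure.dirac b) := fun r b =>
    Integrable.smul_measure Integrable.of_finite ENNReal.ofReal_ne_top
  rw [coinLaw, integral_add_measure (hi _ _) (hi _ _),
    integral_smul_measure, integral_smul_measure, integral_dirac, integral_dirac,
    ENNReal.toReal_ofReal h0, ENNReal.toReal_ofReal (by linarith)]

section Coins

variable {ι : Type*} [Fintype ι]

instance isFiniteMeasure_coins (q : ℝ) : IsFiniteMeasure (coins ι q) := by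
  unfold coins; infer_instance

theorem isProbabilityMeasure_coins {q : ℝ} (h0 : 0 ≤ q) (h1 : q ≤ 1) :
    IsProbabilityMeasure (coins ι q) := by
  have := isProbabilityMeasure_coinLaw h0 h1
  unfold coins; infer_instance

instance isProbabilityMeasure_coins_half : IsProbabilityMeasure (coins ι 2⁻¹) :=
  isProbabilityMeasure_coins (by norm_num) (by norm_num)

theorem integral_coins_prod {𝕜 : Type*} [RCLike 𝕜] (q : ℝ) (f : ι → Bool → 𝕜) :
    ∫ x, ∏ i, f i (x i) ∂coins ι q = ∏ i, ∫ b, f i b ∂coinLaw q :=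
  integral_fintype_prod_eq_prod f

/-- The sign encoded by a Boolean. -/
def sgn (b : Bool) : ℝ := if b then 1 else -1

@[simp] theorem sgn_mul_self (b : Bool) : sgn b * sgn b = 1 := by cases b <;> simp [sgn]

@[simp] theorem sgn_sq (b : Bool) : sgn b ^ 2 = 1 := by cases b <;> simp [sgn]

variable [DecidableEq ι]

/-- Flip one coordinate. -/
def flipAt (j : ι) (x : ι → Bool) : ι → Bool := fun i => if i = j then !(x i) else x i

/-- Fairness makes the law of a coin invariant under negation. This symmetry drives the moment
computations for signs: an integrand that is odd in a single sign has mean zero. -/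
theorem measurePreserving_flipAt (j : ι) :
    MeasurePreserving (flipAt j) (coins ι 2⁻¹) (coins ι 2⁻¹) := by
  have h : ∀ i : ι, MeasurePreserving (fun b : Bool => if i = j then !b else b)
      (coinLaw 2⁻¹) (coinLaw 2⁻¹) := by
    intro i
    refine ⟨measurable_of_finite _, ?_⟩
    split_ifs
    · rw [coinLaw, Measure.map_add _ _ (measurable_of_finite _), Measure.map_smul,
        Measure.map_smul, Measure.map_dirac, Measure.map_dirac, add_comm]
      norm_num
    · exact Measure.map_id
  exact measurePreserving_pi _ _ h

theorem integral_flipAt (j : ι) (f : (ι → Bool) → ℝ) :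
    ∫ x, f (flipAt j x) ∂coins ι 2⁻¹ = ∫ x, f x ∂coins ι 2⁻¹ := by
  conv_rhs => rw [← (measurePreserving_flipAt j).map_eq]
  rw [integral_map (measurable_of_finite _).aemeasurable
      (measurable_of_finite _).aestronglyMeasurable]

theorem integral_eq_zero_of_flipAt (j : ι) (f : (ι → Bool) → ℝ)
    (h : ∀ x, f (flipAt j x) = - f x) : ∫ x, f x ∂coins ι 2⁻¹ = 0 := by
  have h1 := integral_flipAt j f
  simp_rw [h, integral_neg] at h1
  linarith

theorem sgn_flipAt_self (j : ι) (x : ι → Bool) : sgn (flipAt j x j) = - sgn (x j) := by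
  cases h : x j <;> simp [flipAt, sgn, h]

theorem sgn_flipAt_of_ne {i j : ι} (h : i ≠ j) (x : ι → Bool) :
    sgn (flipAt j x i) = sgn (x i) := by
  simp [flipAt, h]

theorem sum_flipAt_of_notMem {j : ι} {s : Finset ι} (hj : j ∉ s) (a : ι → ℝ) (x : ι → Bool) :
    ∑ i ∈ s, a i * sgn (flipAt j x i) = ∑ i ∈ s, a i * sgn (x i) :=
  Finset.sum_congr rfl fun i hi => by
    rw [sgn_flipAt_of_ne (ne_of_mem_of_not_mem hi hj)]

theorem integral_pow_mul_sgn {j : ι} {s : Finset ι} (hj : j ∉ s) (a : ι → ℝ) (k : ℕ) :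
    ∫ x, (∑ i ∈ s, a i * sgn (x i)) ^ k * sgn (x j) ∂coins ι 2⁻¹ = 0 :=
  integral_eq_zero_of_flipAt j _ fun x => by
    rw [sum_flipAt_of_notMem hj, sgn_flipAt_self, mul_neg]

theorem sgn_cube (b : Bool) : sgn b ^ 3 = sgn b := by cases b <;> simp [sgn]; norm_num
theorem sgn_four (b : Bool) : sgn b ^ 4 = 1 := by cases b <;> simp [sgn]; norm_num
theorem sgn_five (b : Bool) : sgn b ^ 5 = sgn b := by cases b <;> simp [sgn]; norm_num
theorem sgn_six (b : Bool) : sgn b ^ 6 = 1 := by cases b <;> simp [sgn]; norm_num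

theorem integral_rademacher_sq (a : ι → ℝ) (s : Finset ι) :
    ∫ x, (∑ i ∈ s, a i * sgn (x i)) ^ 2 ∂coins ι 2⁻¹ = ∑ i ∈ s, a i ^ 2 := by
  induction s using Finset.induction_on with
  | empty => simp
  | insert j s hj ih =>
    have : ∀ x : ι → Bool, (∑ i ∈ insert j s, a i * sgn (x i)) ^ 2 =
        (∑ i ∈ s, a i * sgn (x i)) ^ 2 +
          (2 * a j * ((∑ i ∈ s, a i * sgn (x i)) ^ 1 * sgn (x j)) + a j ^ 2) := by
      intro x
      rw [Finset.sum_insert hj]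
      linear_combination a j ^ 2 * sgn_sq (x j)
    simp_rw [this]
    rw [integral_add Integrable.of_finite Integrable.of_finite, ih,
      integral_add Integrable.of_finite Integrable.of_finite, integral_const_mul,
      integral_pow_mul_sgn hj, integral_const, probReal_univ, Finset.sum_insert hj]
    simp only [one_smul, mul_zero, zero_add]
    ring

/-- Adding one index at a time, the terms of odd degree in the new sign integrate to zero. The
induction closes because `3 (S + a²)² = 3 S² + 6 a² S + 3 a⁴` dominates what is left. The constants
3 here and 15 for the sixth moment are the Gaussian ones. -/
theorem integral_rademacher_four (a : ι → ℝ) (s : Finset ι) :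
    ∫ x, (∑ i ∈ s, a i * sgn (x i)) ^ 4 ∂coins ι 2⁻¹ ≤ 3 * (∑ i ∈ s, a i ^ 2) ^ 2 := by
  induction s using Finset.induction_on with
  | empty => simp
  | insert j s hj ih =>
    have : ∀ x : ι → Bool, (∑ i ∈ insert j s, a i * sgn (x i)) ^ 4 =
        (∑ i ∈ s, a i * sgn (x i)) ^ 4 + (6 * a j ^ 2 * (∑ i ∈ s, a i * sgn (x i)) ^ 2 +
          (4 * a j * ((∑ i ∈ s, a i * sgn (x i)) ^ 3 * sgn (x j)) +
          (4 * a j ^ 3 * ((∑ i ∈ s, a i * sgn (x i)) ^ 1 * sgn (x j)) + a j ^ 4))) := by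
      intro x
      rw [Finset.sum_insert hj]
      generalize ∑ i ∈ s, a i * sgn (x i) = X
      linear_combination 6 * X ^ 2 * a j ^ 2 * sgn_sq (x j) + 4 * X * a j ^ 3 * sgn_cube (x j) +
        a j ^ 4 * sgn_four (x j)
    simp_rw [this]
    rw [integral_add Integrable.of_finite Integrable.of_finite,
      integral_add Integrable.of_finite Integrable.of_finite,
      integral_add Integrable.of_finite Integrable.of_finite,
      integral_add Integrable.of_finite Integrable.of_finite,
      integral_const_mul, integral_const_mul, integral_const_mul,
      integral_pow_mul_sgn hj, integral_pow_mul_sgn hj, integral_const, probReal_univ, Finset.sum_insert hj,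
      integral_rademacher_sq]
    have h0 : 0 ≤ ∑ i ∈ s, a i ^ 2 := Finset.sum_nonneg fun i _ => sq_nonneg _
    simp only [one_smul, mul_zero, zero_add]
    nlinarith [sq_nonneg (a j ^ 2)]

theorem integral_rademacher_six (a : ι → ℝ) (s : Finset ι) :
    ∫ x, (∑ i ∈ s, a i * sgn (x i)) ^ 6 ∂coins ι 2⁻¹ ≤ 15 * (∑ i ∈ s, a i ^ 2) ^ 3 := by
  induction s using Finset.induction_on with
  | empty => simp
  | insert j s hj ih =>
    have : ∀ x : ι → Bool, (∑ i ∈ insert j s, a i * sgn (x i)) ^ 6 =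
        (∑ i ∈ s, a i * sgn (x i)) ^ 6 + (15 * a j ^ 2 * (∑ i ∈ s, a i * sgn (x i)) ^ 4 +
          (15 * a j ^ 4 * (∑ i ∈ s, a i * sgn (x i)) ^ 2 +
          (6 * a j * ((∑ i ∈ s, a i * sgn (x i)) ^ 5 * sgn (x j)) +
          (20 * a j ^ 3 * ((∑ i ∈ s, a i * sgn (x i)) ^ 3 * sgn (x j)) +
          (6 * a j ^ 5 * ((∑ i ∈ s, a i * sgn (x i)) ^ 1 * sgn (x j)) + a j ^ 6))))) := by
      intro x
      rw [Finset.sum_insert hj]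
      generalize ∑ i ∈ s, a i * sgn (x i) = X
      linear_combination 15 * X ^ 4 * a j ^ 2 * sgn_sq (x j) +
        20 * X ^ 3 * a j ^ 3 * sgn_cube (x j) + 15 * X ^ 2 * a j ^ 4 * sgn_four (x j) +
        6 * X * a j ^ 5 * sgn_five (x j) + a j ^ 6 * sgn_six (x j)
    simp_rw [this]
    rw [integral_add Integrable.of_finite Integrable.of_finite,
      integral_add Integrable.of_finite Integrable.of_finite,
      integral_add Integrable.of_finite Integrable.of_finite,
      integral_add Integrable.of_finite Integrable.of_finite,
      integral_add Integrable.of_finite Integrable.of_finite,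
      integral_add Integrable.of_finite Integrable.of_finite,
      integral_const_mul, integral_const_mul, integral_const_mul, integral_const_mul,
      integral_const_mul,
      integral_pow_mul_sgn hj, integral_pow_mul_sgn hj, integral_pow_mul_sgn hj, integral_const,
      probReal_univ, Finset.sum_insert hj, integral_rademacher_sq]
    have h4 := integral_rademacher_four a s
    have h0 : 0 ≤ ∑ i ∈ s, a i ^ 2 := Finset.sum_nonneg fun i _ => sq_nonneg _
    simp only [one_smul, mul_zero, zero_add]
    generalize ∑ i ∈ s, a i ^ 2 = S at *
    have h5 := mul_le_mul_of_nonneg_left h4 (mul_nonneg (by norm_num : (0:ℝ) ≤ 15) (sq_nonneg (a j)))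
    have h6 : 0 ≤ a j ^ 4 * S := by positivity
    have h7 : 0 ≤ a j ^ 6 := by positivity
    nlinarith

theorem integral_prod_sgn (s : Finset ι) :
    ∫ x, ∏ i ∈ s, sgn (x i) ∂coins ι 2⁻¹ = if s = ∅ then 1 else 0 := by
  split_ifs with h
  · simp [h]
  · obtain ⟨j, hj⟩ := Finset.nonempty_iff_ne_empty.2 h
    refine integral_eq_zero_of_flipAt j _ fun x => ?_
    rw [← Finset.mul_prod_erase s _ hj, ← Finset.mul_prod_erase s _ hj, sgn_flipAt_self, neg_mul]
    congr 2
    exact Finset.prod_congr rfl fun i hi => sgn_flipAt_of_ne (Finset.ne_of_mem_erase hi) x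

/-- The factors over `s ∩ t` occur twice and square to one. Hence monomials over distinct sets are
orthonormal. -/
theorem prod_sgn_mul_prod_sgn (s t : Finset ι) (x : ι → Bool) :
    (∏ i ∈ s, sgn (x i)) * ∏ i ∈ t, sgn (x i) = ∏ i ∈ symmDiff s t, sgn (x i) := by
  have h1 : ∏ i ∈ s, sgn (x i) = (∏ i ∈ s \ t, sgn (x i)) * ∏ i ∈ s ∩ t, sgn (x i) := by
    rw [mul_comm, Finset.prod_inter_mul_prod_sdiff]
  have h2 : ∏ i ∈ t, sgn (x i) = (∏ i ∈ t \ s, sgn (x i)) * ∏ i ∈ s ∩ t, sgn (x i) := by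
    rw [mul_comm, Finset.inter_comm, Finset.prod_inter_mul_prod_sdiff]
  have h3 : (∏ i ∈ s ∩ t, sgn (x i)) * ∏ i ∈ s ∩ t, sgn (x i) = 1 := by
    rw [← Finset.prod_mul_distrib]; simp
  have h4 : ∏ i ∈ symmDiff s t, sgn (x i) = (∏ i ∈ s \ t, sgn (x i)) * ∏ i ∈ t \ s, sgn (x i) := by
    rw [symmDiff_def, Finset.sup_eq_union, Finset.prod_union disjoint_sdiff_sdiff]
  rw [h1, h2, h4]
  linear_combination (∏ i ∈ s \ t, sgn (x i)) * (∏ i ∈ t \ s, sgn (x i)) * h3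

theorem integral_prod_sgn_mul_prod_sgn (s t : Finset ι) :
    ∫ x, (∏ i ∈ s, sgn (x i)) * ∏ i ∈ t, sgn (x i) ∂coins ι 2⁻¹ = if s = t then 1 else 0 := by
  simp_rw [prod_sgn_mul_prod_sgn, integral_prod_sgn]
  simp [← Finset.bot_eq_empty, symmDiff_eq_bot]

/-- Second moment of a Walsh polynomial in which every monomial is listed at most `C` times. -/
theorem integral_walsh_sum_sq_le {τ : Type*} (T : Finset τ) (q : τ → Finset ι)
    (c : τ → ℝ) (C : ℕ) (hC : ∀ t ∈ T, (T.filter fun t' => q t = q t').card ≤ C) :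
    ∫ x, (∑ t ∈ T, c t * ∏ i ∈ q t, sgn (x i)) ^ 2 ∂coins ι 2⁻¹ ≤ C * ∑ t ∈ T, c t ^ 2 := by
  have h1 : ∀ x : ι → Bool, (∑ t ∈ T, c t * ∏ i ∈ q t, sgn (x i)) ^ 2 =
      ∑ t ∈ T, ∑ t' ∈ T, c t * c t' * ((∏ i ∈ q t, sgn (x i)) * ∏ i ∈ q t', sgn (x i)) := by
    intro x
    rw [sq, Finset.sum_mul_sum]
    exact Finset.sum_congr rfl fun t _ => Finset.sum_congr rfl fun t' _ => by ring
  simp_rw [h1]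
  rw [integral_finsetSum _ fun _ _ => Integrable.of_finite]
  simp_rw [integral_finsetSum _ fun _ _ => Integrable.of_finite, integral_const_mul,
    integral_prod_sgn_mul_prod_sgn]
  -- Bounding `c t * c t'` by the mean of the two squares avoids collecting equal monomials: each `c
  -- t ^ 2` is then charged once per index that lists the same monomial.
  have h2 : ∀ t ∈ T, ∀ t' ∈ T, c t * c t' * (if q t = q t' then (1 : ℝ) else 0) ≤
      (if q t = q t' then c t ^ 2 / 2 else 0) + (if q t' = q t then c t' ^ 2 / 2 else 0) := by
    intro t _ t' _
    by_cases h : q t = q t'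
    · simp only [h, if_true]
      nlinarith [sq_nonneg (c t - c t')]
    · simp [h, Ne.symm h]
  have h3 : (∑ t ∈ T, ∑ t' ∈ T, (if q t = q t' then c t ^ 2 / 2 else 0 : ℝ)) ≤
      C * ∑ t ∈ T, (c t ^ 2 / 2 : ℝ) := by
    rw [Finset.mul_sum]
    refine Finset.sum_le_sum fun t ht => ?_
    rw [← Finset.sum_filter, Finset.sum_const, nsmul_eq_mul]
    exact mul_le_mul_of_nonneg_right (by exact_mod_cast hC t ht) (by positivity)
  calc _ ≤ ∑ t ∈ T, ∑ t' ∈ T, ((if q t = q t' then c t ^ 2 / 2 else 0) +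
        (if q t' = q t then c t' ^ 2 / 2 else 0)) :=
        Finset.sum_le_sum fun t ht => Finset.sum_le_sum fun t' ht' => h2 t ht t' ht'
    _ = ∑ t ∈ T, ∑ t' ∈ T, (if q t = q t' then c t ^ 2 / 2 else 0) +
        ∑ t ∈ T, ∑ t' ∈ T, (if q t = q t' then c t ^ 2 / 2 else 0) := by
        simp_rw [Finset.sum_add_distrib]
        congr 1
        exact Finset.sum_comm
    _ ≤ C * ∑ t ∈ T, c t ^ 2 := by
        have : ∑ t ∈ T, c t ^ 2 / 2 = (∑ t ∈ T, c t ^ 2) / 2 := by rw [Finset.sum_div]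
        rw [this] at h3
        linarith

end Coins

/-! ### Walsh systems -/

/-- `χ j i` is the value at `i` of the `j`-th function of an orthogonal system of sign functions
which is closed under products. -/
structure IsWalsh {ι : Type*} [Fintype ι] [DecidableEq ι] (χ : ι → ι → ℝ) : Prop where
  sq : ∀ j i, χ j i ^ 2 = 1
  orth : ∀ j k, ∑ i, χ j i * χ k i = if j = k then (Fintype.card ι : ℝ) else 0
  closed : ∀ j k, ∃ l, ∀ i, χ l i = χ j i * χ k i

namespace IsWalsh

variable {ι : Type*} [Fintype ι] [DecidableEq ι] {χ : ι → ι → ℝ}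

theorem inj (hχ : IsWalsh χ) {j k : ι} (h : ∀ i, χ j i = χ k i) : j = k := by
  by_contra hne
  have h1 := hχ.orth j k
  rw [if_neg hne] at h1
  have h2 : ∑ i, χ j i * χ k i = ∑ i : ι, (1 : ℝ) :=
    Finset.sum_congr rfl fun i _ => by rw [← h, ← pow_two, hχ.sq]
  rw [h2] at h1
  have : Nonempty ι := ⟨j⟩
  simp at h1

theorem exists_triple (hχ : IsWalsh χ) : ∃ r : ι → ι → ι → ι, ∀ j k l i, χ (r j k l) i = χ j i * χ k i * χ l i := by
  have : ∀ j k l, ∃ r, ∀ i, χ r i = χ j i * χ k i * χ l i := by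
    intro j k l
    obtain ⟨a, ha⟩ := hχ.closed j k
    obtain ⟨b, hb⟩ := hχ.closed a l
    exact ⟨b, fun i => by rw [hb, ha]⟩
  choose r hr using this
  exact ⟨r, hr⟩

/-- The index of the product of three functions of the system. -/
noncomputable def triple (hχ : IsWalsh χ) (j k l : ι) : ι := hχ.exists_triple.choose j k l

theorem triple_spec (hχ : IsWalsh χ) (j k l i : ι) : χ (hχ.triple j k l) i = χ j i * χ k i * χ l i :=
  hχ.exists_triple.choose_spec j k l i

theorem triple_left_left (hχ : IsWalsh χ) (j l : ι) : hχ.triple j j l = l :=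
  hχ.inj fun i => by rw [hχ.triple_spec]; linear_combination χ l i * hχ.sq j i

theorem triple_left_right (hχ : IsWalsh χ) (j k : ι) : hχ.triple j k j = k :=
  hχ.inj fun i => by rw [hχ.triple_spec]; linear_combination χ k i * hχ.sq j i

theorem triple_right_right (hχ : IsWalsh χ) (j k : ι) : hχ.triple j k k = j :=
  hχ.inj fun i => by rw [hχ.triple_spec]; linear_combination χ j i * hχ.sq k i

/-- This and the next two cancellation rules show that for distinct `j`, `k`, `l` the product index
is a fourth, different index, so the associated monomial in the signs is squarefree. -/
theorem eq_of_triple_eq_left (hχ : IsWalsh χ) {j k l : ι} (h : hχ.triple j k l = j) : k = l :=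
  hχ.inj fun i => by
    have h1 := hχ.triple_spec j k l i
    rw [h] at h1
    linear_combination (-χ j i * χ l i) * h1 - χ k i * hχ.sq l i * χ j i ^ 2 +
      (χ l i - χ k i) * hχ.sq j i

theorem eq_of_triple_eq_mid (hχ : IsWalsh χ) {j k l : ι} (h : hχ.triple j k l = k) : j = l :=
  hχ.inj fun i => by
    have h1 := hχ.triple_spec j k l i
    rw [h] at h1
    linear_combination (-χ k i * χ l i) * h1 - χ j i * hχ.sq l i * χ k i ^ 2 +
      (χ l i - χ j i) * hχ.sq k i

theorem eq_of_triple_eq_right (hχ : IsWalsh χ) {j k l : ι} (h : hχ.triple j k l = l) : j = k :=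
  hχ.inj fun i => by
    have h1 := hχ.triple_spec j k l i
    rw [h] at h1
    linear_combination (-χ l i * χ k i) * h1 - χ j i * hχ.sq k i * χ l i ^ 2 +
      (χ k i - χ j i) * hχ.sq l i

/-- The product of three functions of the system is again one of them, so summation over `i` against
the fourth leaves a single index by orthogonality. A fourfold sum becomes a threefold one. -/
theorem sum_sq_mul_sq (hχ : IsWalsh χ) (g f : ι → ℝ) :
    ∑ i, (∑ j, χ j i * g j) ^ 2 * (∑ j, χ j i * f j) ^ 2 =
      Fintype.card ι * ∑ j, ∑ k, ∑ l, g j * g k * f l * f (hχ.triple j k l) := by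
  have h1 : ∀ r, ∑ i, χ r i * ∑ m, χ m i * f m = Fintype.card ι * f r := by
    intro r
    simp_rw [Finset.mul_sum]
    rw [Finset.sum_comm]
    simp_rw [← mul_assoc, ← Finset.sum_mul, hχ.orth]
    simp
  have h2 : ∀ i, (∑ j, χ j i * g j) ^ 2 * (∑ j, χ j i * f j) ^ 2 =
      ∑ j, ∑ k, ∑ l, g j * g k * f l * (χ (hχ.triple j k l) i * ∑ m, χ m i * f m) := by
    intro i
    generalize hE : ∑ m, χ m i * f m = E
    have : ∀ j k l, g j * g k * f l * (χ (hχ.triple j k l) i * E) =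
      (χ j i * g j) * ((χ k i * g k) * ((χ l i * f l) * E)) := by
      intro j k l
      rw [hχ.triple_spec]; ring
    simp_rw [this]
    simp only [← Finset.mul_sum, ← Finset.sum_mul, hE]
    ring
  simp_rw [h2]
  rw [Finset.sum_comm, Finset.mul_sum]
  refine Finset.sum_congr rfl fun j _ => ?_
  rw [Finset.sum_comm, Finset.mul_sum]
  refine Finset.sum_congr rfl fun k _ => ?_
  rw [Finset.sum_comm, Finset.mul_sum]
  refine Finset.sum_congr rfl fun l _ => ?_
  rw [← Finset.mul_sum, h1]
  ring

/-- The triples of distinct indices. -/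
def distinctTriples (ι : Type*) [Fintype ι] [DecidableEq ι] : Finset (ι × ι × ι) :=
  Finset.univ.filter fun t => t.1 ≠ t.2.1 ∧ t.2.2 ≠ t.1 ∧ t.2.2 ≠ t.2.1

/-- The coincidences `j = k`, `l = j` and `l = k` are the three pairings of a Gaussian fourth
moment: the first gives the product of the squared norms, each of the others the squared inner
product. The triple coincidence is counted with the first pairing, so it is removed from the other
two. -/
theorem sum_triples (hχ : IsWalsh χ) (g f : ι → ℝ) :
    ∑ j, ∑ k, ∑ l, g j * g k * f l * f (hχ.triple j k l) =
      (∑ j, g j ^ 2) * ∑ j, f j ^ 2 + 2 * ((∑ j, g j * f j) ^ 2 - ∑ j, (g j * f j) ^ 2) +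
      ∑ t ∈ distinctTriples ι,
        g t.1 * g t.2.1 * f t.2.2 * f (hχ.triple t.1 t.2.1 t.2.2) := by
  have h1 : ∀ j k l, g j * g k * f l * f (hχ.triple j k l) =
      (if k = j then g j ^ 2 * f l ^ 2 else 0) +
      ((if l = j then (g j * f j) * (g k * f k) - (if k = j then (g j * f j) ^ 2 else 0) else 0) +
      ((if l = k then (g j * f j) * (g k * f k) - (if k = j then (g j * f j) ^ 2 else 0) else 0) +
      (if j ≠ k ∧ l ≠ j ∧ l ≠ k then g j * g k * f l * f (hχ.triple j k l) else 0))) := by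
    intro j k l
    by_cases hkj : k = j
    · subst hkj
      rw [hχ.triple_left_left]
      by_cases hl : l = k
      · subst hl; simp; ring
      · simp [hl]; ring
    · have hjk : j ≠ k := Ne.symm hkj
      by_cases hlj : l = j
      · subst hlj
        rw [hχ.triple_left_right]
        simp [hkj, hjk]; ring
      · by_cases hlk : l = k
        · subst hlk
          rw [hχ.triple_right_right]
          simp [hkj]; ring
        · simp [hkj, hlj, hlk, hjk]
  rw [Finset.sum_congr rfl fun j _ => Finset.sum_congr rfl fun k _ =>
    Finset.sum_congr rfl fun l _ => h1 j k l]
  simp only [Finset.sum_add_distrib]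
  have e1 : ∑ j, ∑ k, ∑ l, (if k = j then g j ^ 2 * f l ^ 2 else 0) =
      (∑ j, g j ^ 2) * ∑ j, f j ^ 2 := by
    rw [Finset.sum_mul_sum]
    refine Finset.sum_congr rfl fun j _ => ?_
    rw [Finset.sum_comm]
    simp
  have e0 : ∑ j, ∑ k, ((g j * f j) * (g k * f k) - (if k = j then (g j * f j) ^ 2 else 0)) =
      (∑ j, g j * f j) ^ 2 - ∑ j, (g j * f j) ^ 2 := by
    simp_rw [Finset.sum_sub_distrib]
    rw [pow_two, Finset.sum_mul_sum]
    simp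
  have e4 : ∑ j, ∑ k, ∑ l, (if j ≠ k ∧ l ≠ j ∧ l ≠ k then
      g j * g k * f l * f (hχ.triple j k l) else 0) = ∑ t ∈ distinctTriples ι,
        g t.1 * g t.2.1 * f t.2.2 * f (hχ.triple t.1 t.2.1 t.2.2) := by
    rw [distinctTriples, Finset.sum_filter, Fintype.sum_prod_type]
    simp_rw [Fintype.sum_prod_type]
  rw [e1, e4]
  simp_rw [Finset.sum_ite_eq', Finset.mem_univ, if_true]
  rw [e0]
  ring

/-- The mean square fluctuation of `N⁻¹ ∑ᵢ aᵢ² eᵢ²`, where `a` and `e` are Walsh transforms of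
two vectors with randomized signs. -/
theorem integral_fluctuation_sq_le (hχ : IsWalsh χ) (w v : ι → ℝ) :
    ∫ x, ((∑ i, (∑ j, χ j i * w j * sgn (x j)) ^ 2 * (∑ j, χ j i * v j * sgn (x j)) ^ 2) /
        Fintype.card ι -
      ((∑ j, w j ^ 2) * ∑ j, v j ^ 2 + 2 * ((∑ j, w j * v j) ^ 2 - ∑ j, (w j * v j) ^ 2))) ^ 2
      ∂coins ι 2⁻¹ ≤
    64 * ∑ j, ∑ k, ∑ l, (w j * w k * v l * v (hχ.triple j k l)) ^ 2 := by
  rcases isEmpty_or_nonempty ι with hι | hι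
  · simp
  set T := distinctTriples ι
  let q : ι × ι × ι → Finset ι := fun t => {t.1, t.2.1, t.2.2, hχ.triple t.1 t.2.1 t.2.2}
  let c : ι × ι × ι → ℝ := fun t => w t.1 * w t.2.1 * v t.2.2 * v (hχ.triple t.1 t.2.1 t.2.2)
  have h1 : ∀ x : ι → Bool,
      (∑ i, (∑ j, χ j i * w j * sgn (x j)) ^ 2 * (∑ j, χ j i * v j * sgn (x j)) ^ 2) /
        Fintype.card ι -
      ((∑ j, w j ^ 2) * ∑ j, v j ^ 2 + 2 * ((∑ j, w j * v j) ^ 2 - ∑ j, (w j * v j) ^ 2)) =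
      ∑ t ∈ T, c t * ∏ i ∈ q t, sgn (x i) := by
    intro x
    have h2 := hχ.sum_sq_mul_sq (fun j => w j * sgn (x j)) (fun j => v j * sgn (x j))
    have h3 := hχ.sum_triples (fun j => w j * sgn (x j)) (fun j => v j * sgn (x j))
    simp_rw [← mul_assoc] at h2
    rw [h2, mul_div_cancel_left₀ _ (by simp)]
    simp_rw [← mul_assoc] at h3
    rw [h3]
    have e1 : ∀ (u : ι → ℝ) j, (u j * sgn (x j)) ^ 2 = u j ^ 2 := fun u j => by
      rw [mul_pow, sgn_sq, mul_one]
    have e2 : ∀ j, w j * sgn (x j) * v j * sgn (x j) = w j * v j := fun j => by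
      linear_combination w j * v j * sgn_mul_self (x j)
    simp_rw [e1, e2]
    rw [add_sub_cancel_left]
    refine Finset.sum_congr rfl fun t ht => ?_
    obtain ⟨j, k, l⟩ := t
    simp only [T, distinctTriples, Finset.mem_filter, Finset.mem_univ, true_and] at ht
    obtain ⟨hjk, hlj, hlk⟩ := ht
    have e3 : ∏ i ∈ q (j, k, l), sgn (x i) =
        sgn (x j) * (sgn (x k) * (sgn (x l) * sgn (x (hχ.triple j k l)))) := by
      simp only [q]
      rw [Finset.prod_insert, Finset.prod_insert, Finset.prod_insert, Finset.prod_singleton]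
      · simp only [Finset.mem_singleton]
        exact fun h => hjk (hχ.eq_of_triple_eq_right h.symm)
      · simp only [Finset.mem_insert, Finset.mem_singleton, not_or]
        exact ⟨Ne.symm hlk, fun h => hlj (hχ.eq_of_triple_eq_mid h.symm).symm⟩
      · simp only [Finset.mem_insert, Finset.mem_singleton, not_or]
        exact ⟨hjk, Ne.symm hlj, fun h => hlk (hχ.eq_of_triple_eq_left h.symm).symm⟩
    rw [e3]
    simp only [c]
    ring
  simp_rw [h1]
  have hq : ∀ t, (q t).card ≤ 4 := fun t => Finset.card_le_four
  refine (integral_walsh_sum_sq_le T q c 64 fun t _ => ?_).trans ?_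
  -- A triple listing the same monomial as `t` has its three entries in `q t`, a set of at most four
  -- elements; hence the multiplicity is at most `4³ = 64`.
  · have hsub : (T.filter fun t' => q t = q t') ⊆ q t ×ˢ q t ×ˢ q t := by
      intro t' ht'
      rw [Finset.mem_filter] at ht'
      rw [ht'.2]
      simp [q]
    refine (Finset.card_le_card hsub).trans ?_
    rw [Finset.card_product, Finset.card_product]
    calc _ ≤ 4 * (4 * 4) := Nat.mul_le_mul (hq t) (Nat.mul_le_mul (hq t) (hq t))
      _ = 64 := by norm_num
  · push_cast
    refine mul_le_mul_of_nonneg_left ?_ (by norm_num)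
    have : ∑ j, ∑ k, ∑ l, (w j * w k * v l * v (hχ.triple j k l)) ^ 2 =
        ∑ t : ι × ι × ι, c t ^ 2 := by
      simp_rw [Fintype.sum_prod_type, c]
    rw [this]
    exact Finset.sum_le_sum_of_subset_of_nonneg (Finset.subset_univ _) fun _ _ _ => sq_nonneg _

/-- If `|v|` is at most `ρ` in every coordinate, the fluctuation is of order `ρ`. -/
theorem sum_triples_sq_le (hχ : IsWalsh χ) (w v : ι → ℝ) {ρ : ℝ} (hv : ∀ j, |v j| ≤ ρ) :
    ∑ j, ∑ k, ∑ l, (w j * w k * v l * v (hχ.triple j k l)) ^ 2 ≤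
      (∑ j, w j ^ 2) ^ 2 * (∑ j, v j ^ 2) * ρ ^ 2 := by
  -- Only the factor at the product index, which has no sum of its own, is bounded by `ρ`; the
  -- remaining triple sum factors into norms.
  have h : ∀ j k l, (w j * w k * v l * v (hχ.triple j k l)) ^ 2 ≤
      w j ^ 2 * (w k ^ 2 * (v l ^ 2 * ρ ^ 2)) := by
    intro j k l
    have : v (hχ.triple j k l) ^ 2 ≤ ρ ^ 2 := sq_le_sq' (neg_le_of_abs_le (hv _)) (le_of_abs_le (hv _))
    calc _ = w j ^ 2 * (w k ^ 2 * (v l ^ 2 * v (hχ.triple j k l) ^ 2)) := by ring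
      _ ≤ _ := by gcongr
  calc _ ≤ ∑ j, ∑ k, ∑ l, w j ^ 2 * (w k ^ 2 * (v l ^ 2 * ρ ^ 2)) :=
        Finset.sum_le_sum fun j _ => Finset.sum_le_sum fun k _ => Finset.sum_le_sum fun l _ => h j k l
    _ = _ := by
      simp only [← Finset.mul_sum, ← Finset.sum_mul]
      ring

end IsWalsh

/-! ### The Hadamard matrices -/

/-- The rescaled columns at level `t + 1` are `(χ, χ)` and `(χ, -χ)`, with `χ` from level `t`.
Products stay of this form, the sign of the lower block being multiplicative, and orthogonality
splits over the two blocks. -/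
theorem isWalsh_hadamard (t : ℕ) :
    IsWalsh fun j i : Fin (2 ^ t) => √(2 ^ t) * hadamardMatrix t i j := by
  induction t with
  | zero =>
    refine ⟨fun j i => ?_, fun j k => ?_, fun j k => ⟨j, fun i => ?_⟩⟩ <;>
      (have hs : Subsingleton (Fin (2 ^ 0)) := by rw [pow_zero]; infer_instance)
    · rw [Subsingleton.elim i j]; simp [hadamardMatrix]
    · rw [Subsingleton.elim k j, Fintype.sum_subsingleton _ j]; simp [hadamardMatrix]
    · rw [Subsingleton.elim i j, Subsingleton.elim k j]; simp [hadamardMatrix]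
  | succ t ih =>
    let e : Fin (2 ^ t) ⊕ Fin (2 ^ t) ≃ Fin (2 ^ (t + 1)) :=
      finSumFinEquiv.trans (finCongr (by rw [pow_succ, mul_two]))
    have hH : hadamardMatrix (t + 1) = (1 / √2) • Matrix.reindex e e
      (Matrix.fromBlocks (hadamardMatrix t) (hadamardMatrix t) (hadamardMatrix t)
        (-hadamardMatrix t)) := rfl
    set χ : Fin (2 ^ t) → Fin (2 ^ t) → ℝ := fun j i => √(2 ^ t) * hadamardMatrix t i j with hχ
    have h2 : (√(2 ^ (t + 1)) : ℝ) * (1 / √2) = √(2 ^ t) := by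
      rw [pow_succ, Real.sqrt_mul (by positivity)]
      field_simp
    have hE : ∀ a b, √(2 ^ (t + 1)) * hadamardMatrix (t + 1) (e a) (e b) =
        Matrix.fromBlocks (Matrix.of fun i j => χ j i) (Matrix.of fun i j => χ j i)
          (Matrix.of fun i j => χ j i) (Matrix.of fun i j => - χ j i) a b := by
      intro a b
      rw [hH, Matrix.smul_apply, Matrix.reindex_apply, Matrix.submatrix_apply,
        Equiv.symm_apply_apply, Equiv.symm_apply_apply, smul_eq_mul, ← mul_assoc, h2]
      rcases a with a | a <;> rcases b with b | b <;> simp [hχ]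
    refine ⟨fun j i => ?_, fun j k => ?_, fun j k => ?_⟩
    · obtain ⟨a, rfl⟩ := e.surjective i
      obtain ⟨b, rfl⟩ := e.surjective j
      simp only [hE]
      rcases a with a | a <;> rcases b with b | b <;> simp [ih.sq]
    · obtain ⟨a, rfl⟩ := e.surjective k
      obtain ⟨b, rfl⟩ := e.surjective j
      rw [← e.sum_comp]
      simp only [hE, Fintype.sum_sum_type]
      rcases a with a | a <;> rcases b with b | b <;> simp [ih.orth, pow_succ] <;>
        split_ifs <;> ring
    · obtain ⟨a, rfl⟩ := e.surjective k
      obtain ⟨b, rfl⟩ := e.surjective j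
      rcases a with a | a <;> rcases b with b | b <;> obtain ⟨l, hl⟩ := ih.closed b a
      · refine ⟨e (Sum.inl l), fun i => ?_⟩
        obtain ⟨i, rfl⟩ := e.surjective i
        simp only [hE]
        rcases i with i | i <;> simp [hl]
      · refine ⟨e (Sum.inr l), fun i => ?_⟩
        obtain ⟨i, rfl⟩ := e.surjective i
        simp only [hE]
        rcases i with i | i <;> simp [hl]
      · refine ⟨e (Sum.inr l), fun i => ?_⟩
        obtain ⟨i, rfl⟩ := e.surjective i
        simp only [hE]
        rcases i with i | i <;> simp [hl]
      · refine ⟨e (Sum.inl l), fun i => ?_⟩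
        obtain ⟨i, rfl⟩ := e.surjective i
        simp only [hE]
        rcases i with i | i <;> simp [hl]

/-! ### A central limit theorem for Bernoulli sampling -/

/-- Taylor's bound covers `|y| ≤ 1`. For larger `|y|` every term is at most a multiple of `|y| ^ 3`,
so the estimate needs no smallness condition. -/
theorem norm_exp_mul_I_sub_le (y : ℝ) :
    ‖Complex.exp (y * Complex.I) - (1 + y * Complex.I - y ^ 2 / 2)‖ ≤ 4 * |y| ^ 3 := by
  by_cases hy : |y| ≤ 1
  · have hn : ‖(y : ℂ) * Complex.I‖ = |y| := by simp
    have h := Complex.exp_bound (x := y * Complex.I) (by rw [hn]; exact hy) (n := 3) (by norm_num)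
    have h2 : ∑ m ∈ Finset.range 3, ((y : ℂ) * Complex.I) ^ m / (m.factorial : ℂ) =
        1 + y * Complex.I - y ^ 2 / 2 := by
      simp [Finset.sum_range_succ, mul_pow, Nat.factorial]
      ring
    rw [h2, hn] at h
    refine h.trans ?_
    rw [mul_comm]
    gcongr
    norm_num [Nat.factorial]
  · have hy' : 1 ≤ |y| := le_of_not_ge hy
    have h1 : ‖Complex.exp (y * Complex.I)‖ = 1 := Complex.norm_exp_ofReal_mul_I y
    have h2 : ‖(1 + y * Complex.I - y ^ 2 / 2 : ℂ)‖ ≤ 1 + |y| + |y| ^ 2 / 2 := by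
      refine (norm_sub_le _ _).trans (add_le_add ((norm_add_le _ _).trans ?_) ?_)
      · simp
      · simp
    have h3 : |y| ≤ |y| ^ 3 := le_self_pow₀ hy' (by norm_num)
    have h4 : |y| ^ 2 ≤ |y| ^ 3 := pow_le_pow_right₀ hy' (by norm_num)
    have h5 : 1 ≤ |y| ^ 3 := one_le_pow₀ hy'
    refine (norm_sub_le _ _).trans ?_
    rw [h1]
    linarith

theorem abs_exp_neg_sub_exp_neg_le {a b : ℝ} (ha : 0 ≤ a) (hb : 0 ≤ b) :
    |Real.exp (-a) - Real.exp (-b)| ≤ |a - b| := by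
  have key : ∀ a b : ℝ, 0 ≤ a → a ≤ b → |Real.exp (-a) - Real.exp (-b)| ≤ |a - b| := by
    intro a b ha hab
    have h1 : Real.exp (-b) ≤ Real.exp (-a) := Real.exp_le_exp.2 (by linarith)
    rw [abs_of_nonneg (by linarith), abs_of_nonpos (by linarith)]
    have h2 : Real.exp (-b) = Real.exp (-a) * Real.exp (-(b - a)) := by
      rw [← Real.exp_add]; congr 1; ring
    have h3 := Real.add_one_le_exp (-(b - a))
    have h4 : Real.exp (-a) ≤ 1 := Real.exp_le_one_iff.2 (by linarith)
    have h5 := Real.exp_pos (-a)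
    rw [h2]
    nlinarith
  rcases le_total a b with h | h
  · exact key a b ha h
  · rw [abs_sub_comm, abs_sub_comm a b]
    exact key b a hb h

/-- The factors are exchanged one at a time, all others having norm at most one. Applied to
characteristic functions, this is Lindeberg's replacement of summands by Gaussians. -/
theorem norm_prod_sub_prod_le {ι : Type*} (s : Finset ι) (z w : ι → ℂ)
    (hz : ∀ i, ‖z i‖ ≤ 1) (hw : ∀ i, ‖w i‖ ≤ 1) :
    ‖∏ i ∈ s, z i - ∏ i ∈ s, w i‖ ≤ ∑ i ∈ s, ‖z i - w i‖ := by
  classical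
  induction s using Finset.induction_on with
  | empty => simp
  | insert j s hj ih =>
    rw [Finset.prod_insert hj, Finset.prod_insert hj, Finset.sum_insert hj]
    have h1 : z j * ∏ i ∈ s, z i - w j * ∏ i ∈ s, w i =
        (z j - w j) * ∏ i ∈ s, z i + w j * (∏ i ∈ s, z i - ∏ i ∈ s, w i) := by ring
    have h2 : ‖∏ i ∈ s, z i‖ ≤ 1 := by
      rw [norm_prod]
      exact Finset.prod_le_one (fun i _ => norm_nonneg _) fun i _ => hz i
    rw [h1]
    refine (norm_add_le _ _).trans (add_le_add ?_ ?_)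
    · rw [norm_mul]
      exact mul_le_of_le_one_right (norm_nonneg _) h2
    · rw [norm_mul]
      exact (mul_le_of_le_one_left (norm_nonneg _) (hw j)).trans ih

/-- The centered and scaled Bernoulli variable `b / γ - 1`. -/
noncomputable def ctr (γ : ℝ) (b : Bool) : ℝ := (if b then 1 else 0) / γ - 1

section Bernoulli

variable {γ : ℝ}

theorem integral_ctr (h0 : 0 < γ) (h1 : γ ≤ 1) : ∫ b, ctr γ b ∂coinLaw γ = 0 := by
  rw [integral_coinLaw h0.le h1]
  simp [ctr]
  field_simp
  ring

theorem integral_ctr_sq (h0 : 0 < γ) (h1 : γ ≤ 1) :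
    ∫ b, ctr γ b ^ 2 ∂coinLaw γ = (1 - γ) / γ := by
  rw [integral_coinLaw h0.le h1]
  simp [ctr]
  field_simp
  ring

/-- The power `γ⁻²` is the right one: `N` weights of order `c / N` contribute `N γ⁻² (c / N)³ = c³ /
(γ N)²`, which is of order `m^(-1/2)` for `m = γ N` and `c` of order `√m`, even when `γ` tends to
zero. -/
theorem integral_abs_ctr_cube_le (h0 : 0 < γ) (h1 : γ ≤ 1) :
    ∫ b, |ctr γ b| ^ 3 ∂coinLaw γ ≤ 1 / γ ^ 2 := by
  rw [integral_coinLaw h0.le h1]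
  have h2 : |ctr γ true| = (1 - γ) / γ := by
    rw [ctr, if_pos rfl, abs_of_nonneg]
    · field_simp
    · rw [sub_nonneg, le_div_iff₀ h0]; linarith
  have h3 : |ctr γ false| = 1 := by simp [ctr]
  rw [h2, h3]
  simp only [smul_eq_mul]
  rw [div_pow, le_div_iff₀ (by positivity)]
  have h4 : (γ * ((1 - γ) ^ 3 / γ ^ 3) + (1 - γ) * 1 ^ 3) * γ ^ 2 = (1 - γ) ^ 3 + (1 - γ) * γ ^ 2 := by
    field_simp
  rw [h4]
  nlinarith [mul_nonneg h0.le (sub_nonneg.2 h1), mul_nonneg (mul_nonneg h0.le h0.le) (sub_nonneg.2 h1)]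

theorem norm_integral_exp_ctr_sub_le (h0 : 0 < γ) (h1 : γ ≤ 1) (s : ℝ) :
    ‖∫ b, Complex.exp ((s * ctr γ b : ℝ) * Complex.I) ∂coinLaw γ -
      (Real.exp (-(s ^ 2 * ((1 - γ) / γ) / 2)) : ℝ)‖ ≤ 5 / γ ^ 2 * |s| ^ 3 := by
  have := isProbabilityMeasure_coinLaw h0.le h1
  set u := s ^ 2 * ((1 - γ) / γ) / 2 with hu
  have hu0 : 0 ≤ u := by
    have : 0 ≤ (1 - γ) / γ := div_nonneg (by linarith) h0.le
    positivity
  have e1 : ∫ b, (1 + (s * ctr γ b : ℝ) * Complex.I - ((s * ctr γ b : ℝ) : ℂ) ^ 2 / 2) ∂coinLaw γ =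
      ((1 - u : ℝ) : ℂ) := by
    rw [integral_coinLaw h0.le h1]
    have h2 := integral_ctr h0 h1
    have h3 := integral_ctr_sq h0 h1
    rw [integral_coinLaw h0.le h1] at h2 h3
    simp only [smul_eq_mul] at h2 h3
    have h2' : (γ : ℂ) * ctr γ true + (1 - γ) * ctr γ false = 0 := by exact_mod_cast h2
    have h3' : (γ : ℂ) * ctr γ true ^ 2 + (1 - γ) * ctr γ false ^ 2 = ((1 - γ) / γ : ℝ) := by
      rw [← h3]; push_cast; ring
    rw [hu]
    push_cast at h3' ⊢
    simp only [Complex.real_smul]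
    push_cast
    linear_combination s * Complex.I * h2' - s ^ 2 / 2 * h3'
  have e2 : ‖∫ b, Complex.exp ((s * ctr γ b : ℝ) * Complex.I) ∂coinLaw γ - ((1 - u : ℝ) : ℂ)‖ ≤
      4 / γ ^ 2 * |s| ^ 3 := by
    rw [← e1, ← integral_sub Integrable.of_finite Integrable.of_finite]
    refine (norm_integral_le_integral_norm _).trans ?_
    calc _ ≤ ∫ b, 4 * |s| ^ 3 * |ctr γ b| ^ 3 ∂coinLaw γ := by
          refine integral_mono Integrable.of_finite Integrable.of_finite fun b => ?_
          refine (norm_exp_mul_I_sub_le _).trans (le_of_eq ?_)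
          rw [abs_mul]; ring
      _ = 4 * |s| ^ 3 * ∫ b, |ctr γ b| ^ 3 ∂coinLaw γ := integral_const_mul _ _
      _ ≤ 4 * |s| ^ 3 * (1 / γ ^ 2) := by gcongr; exact integral_abs_ctr_cube_le h0 h1
      _ = _ := by ring
  have hus : u ≤ s ^ 2 / (2 * γ) := by
    rw [hu, le_div_iff₀ (by positivity)]
    have : s ^ 2 * ((1 - γ) / γ) / 2 * (2 * γ) = s ^ 2 * (1 - γ) := by field_simp
    rw [this]
    nlinarith [mul_nonneg (sq_nonneg s) h0.le]
  -- If `|s| ≥ γ`, the bound `u ≤ s² / (2γ)` is already below `|s|³ / γ²`. Otherwise `u ≤ |s| / 2`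
  -- is small, and the quadratic remainder `u²` of the exponential suffices.
  have e3 : |1 - u - Real.exp (-u)| ≤ 1 / γ ^ 2 * |s| ^ 3 := by
    by_cases hs : γ ≤ |s|
    · have h2 : Real.exp (-u) ≤ 1 := Real.exp_le_one_iff.2 (by linarith)
      have h3 := Real.add_one_le_exp (-u)
      rw [abs_of_nonpos (by linarith)]
      have h4 : s ^ 2 / (2 * γ) ≤ 1 / γ ^ 2 * |s| ^ 3 := by
        rw [div_mul_eq_mul_div, one_mul, div_le_div_iff₀ (by positivity) (by positivity), ← sq_abs s]
        have : 0 ≤ |s| ^ 2 * γ := by positivity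
        nlinarith
      linarith
    · have hs' : |s| < γ := lt_of_not_ge hs
      have h4 : u ≤ |s| ^ 2 / (2 * γ) := by rw [sq_abs]; exact hus
      have h5 : |s| ^ 2 ≤ |s| * γ := by rw [pow_two]; gcongr
      have h6 : u ≤ |s| / 2 := h4.trans (by
        rw [div_le_div_iff₀ (by positivity) (by positivity)]; linarith)
      have h7 := Real.abs_exp_sub_one_sub_id_le (x := -u) (by
        rw [abs_neg, abs_of_nonneg hu0]; linarith)
      have h8 : 1 - u - Real.exp (-u) = -(Real.exp (-u) - 1 - -u) := by ring
      rw [h8, abs_neg]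
      refine h7.trans ?_
      rw [neg_sq]
      calc u ^ 2 = u * u := by ring
        _ ≤ |s| ^ 2 / (2 * γ) * (|s| / 2) := by gcongr
        _ ≤ 1 / γ ^ 2 * |s| ^ 3 := by
          have : |s| ^ 2 / (2 * γ) * (|s| / 2) = (γ / 4) * (1 / γ ^ 2 * |s| ^ 3) := by
            field_simp; ring
          rw [this]
          exact mul_le_of_le_one_left (by positivity) (by linarith)
  calc _ ≤ ‖∫ b, Complex.exp ((s * ctr γ b : ℝ) * Complex.I) ∂coinLaw γ - ((1 - u : ℝ) : ℂ)‖ +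
        ‖((1 - u : ℝ) : ℂ) - (Real.exp (-u) : ℝ)‖ := norm_sub_le_norm_sub_add_norm_sub _ _ _
    _ ≤ 4 / γ ^ 2 * |s| ^ 3 + 1 / γ ^ 2 * |s| ^ 3 := by
        refine add_le_add e2 ?_
        rw [← Complex.ofReal_sub, Complex.norm_real]
        exact e3
    _ = _ := by ring

variable {ι : Type*} [Fintype ι]

/-- Quantitative central limit theorem for a weighted sum of centered Bernoulli variables. -/
theorem norm_integral_exp_sum_ctr_sub_le (h0 : 0 < γ) (h1 : γ ≤ 1) (s : ι → ℝ) :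
    ‖∫ b, Complex.exp ((∑ i, s i * ctr γ (b i) : ℝ) * Complex.I) ∂coins ι γ -
      (Real.exp (-((1 - γ) / γ * (∑ i, s i ^ 2) / 2)) : ℝ)‖ ≤ 5 / γ ^ 2 * ∑ i, |s i| ^ 3 := by
  have := isProbabilityMeasure_coinLaw h0.le h1
  have e1 : ∀ b : ι → Bool, Complex.exp ((∑ i, s i * ctr γ (b i) : ℝ) * Complex.I) =
      ∏ i, Complex.exp ((s i * ctr γ (b i) : ℝ) * Complex.I) := by
    intro b
    rw [← Complex.exp_sum, Complex.ofReal_sum, Finset.sum_mul]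
  have e2 : ((Real.exp (-((1 - γ) / γ * (∑ i, s i ^ 2) / 2)) : ℝ) : ℂ) =
      ∏ i, ((Real.exp (-(s i ^ 2 * ((1 - γ) / γ) / 2)) : ℝ) : ℂ) := by
    rw [← Complex.ofReal_prod, ← Real.exp_sum, Finset.sum_neg_distrib, ← Finset.sum_div,
      ← Finset.sum_mul, mul_comm]
  simp_rw [e1]
  rw [e2, integral_coins_prod γ fun i b => Complex.exp ((s i * ctr γ b : ℝ) * Complex.I)]
  refine (norm_prod_sub_prod_le _ _ _ (fun i => ?_) fun i => ?_).trans ?_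
  · refine (norm_integral_le_integral_norm _).trans ?_
    simp_rw [Complex.norm_exp_ofReal_mul_I]
    simp
  · rw [Complex.norm_real, Real.norm_eq_abs, Real.abs_exp, Real.exp_le_one_iff, neg_nonpos]
    have : 0 ≤ (1 - γ) / γ := div_nonneg (by linarith) h0.le
    positivity
  · rw [Finset.mul_sum]
    exact Finset.sum_le_sum fun i _ => norm_integral_exp_ctr_sub_le h0 h1 (s i)

theorem integral_coins_eval {q : ℝ} (h0 : 0 ≤ q) (h1 : q ≤ 1) (i : ι) (f : Bool → ℝ) :
    ∫ x, f (x i) ∂coins ι q = ∫ b, f b ∂coinLaw q := by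
  have := isProbabilityMeasure_coinLaw h0 h1
  have h : MeasurePreserving (fun x : ι → Bool => x i) (coins ι q) (coinLaw q) :=
    measurePreserving_eval _ i
  rw [← h.map_eq, integral_map h.measurable.aemeasurable
    (measurable_of_finite _).aestronglyMeasurable]

theorem integral_sum_ctr_sq (h0 : 0 < γ) (h1 : γ ≤ 1) (s : ι → ℝ) :
    ∫ b, (∑ i, s i * ctr γ (b i)) ^ 2 ∂coins ι γ = (1 - γ) / γ * ∑ i, s i ^ 2 := by
  classical
  have := isProbabilityMeasure_coinLaw h0.le h1
  have hind : iIndepFun (fun i (b : ι → Bool) => ctr γ (b i)) (coins ι γ) :=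
    iIndepFun_pi (X := fun _ b => ctr γ b) fun i => (measurable_of_finite _).aemeasurable
  have h2 : ∀ i j, ∫ b, ctr γ (b i) * ctr γ (b j) ∂coins ι γ = if i = j then (1 - γ) / γ else 0 := by
    intro i j
    split_ifs with h
    · subst h
      simp_rw [← pow_two]
      rw [integral_coins_eval h0.le h1 i fun b => ctr γ b ^ 2, integral_ctr_sq h0 h1]
    · rw [(hind.indepFun h).integral_fun_mul_eq_mul_integral
        (measurable_of_finite _).aestronglyMeasurable (measurable_of_finite _).aestronglyMeasurable,
        integral_coins_eval h0.le h1 i (ctr γ), integral_ctr h0 h1, zero_mul]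
  have h3 : ∀ b : ι → Bool, (∑ i, s i * ctr γ (b i)) ^ 2 =
      ∑ i, ∑ j, s i * s j * (ctr γ (b i) * ctr γ (b j)) := by
    intro b
    rw [sq, Finset.sum_mul_sum]
    exact Finset.sum_congr rfl fun t _ => Finset.sum_congr rfl fun t' _ => by ring
  simp_rw [h3]
  rw [integral_finsetSum _ fun _ _ => Integrable.of_finite]
  simp_rw [integral_finsetSum _ fun _ _ => Integrable.of_finite, integral_const_mul, h2]
  simp only [mul_ite, mul_zero, Finset.sum_ite_eq, Finset.mem_univ, if_true]
  rw [Finset.mul_sum]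
  exact Finset.sum_congr rfl fun i _ => by ring

end Bernoulli

/-! ### The bilinear sketching error -/

section SketchError

variable {ι : Type*} [Fintype ι]

/-- The Walsh transform of the vector `w`, with signs randomized by `x`. -/
noncomputable def walshT (χ : ι → ι → ℝ) (w : ι → ℝ) (x : ι → Bool) (i : ι) : ℝ :=
  ∑ j, χ j i * w j * sgn (x j)

/-- The error `wᵀ (SᵀS - 1) v` made by the sketch with sampling indicators `b` and signs `x`. -/
noncomputable def sketchErr (χ : ι → ι → ℝ) (γ : ℝ) (w v : ι → ℝ) (b x : ι → Bool) : ℝ :=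
  ∑ i, walshT χ w x i * walshT χ v x i / Fintype.card ι * ctr γ (b i)

variable [DecidableEq ι] {χ : ι → ι → ℝ}

/-- For fixed `i` the transform is a Rademacher sum whose squared weights are `w j ^ 2`, since `χ j
i` is a sign. The random signs flatten every vector, so no delocalization of `w` is needed here. -/
theorem integral_walshT_four_le (hχ : IsWalsh χ) {w : ι → ℝ} {K : ℝ} (hw : ∑ j, w j ^ 2 ≤ K ^ 2)
    (i : ι) : ∫ x, walshT χ w x i ^ 4 ∂coins ι 2⁻¹ ≤ 3 * K ^ 4 := by
  refine (integral_rademacher_four (fun j => χ j i * w j) Finset.univ).trans ?_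
  have h : ∑ j, (χ j i * w j) ^ 2 = ∑ j, w j ^ 2 :=
    Finset.sum_congr rfl fun j _ => by rw [mul_pow, hχ.sq, one_mul]
  have h0 : 0 ≤ ∑ j, w j ^ 2 := Finset.sum_nonneg fun _ _ => sq_nonneg _
  rw [h]
  calc 3 * (∑ j, w j ^ 2) ^ 2 ≤ 3 * (K ^ 2) ^ 2 := by gcongr
    _ = _ := by ring

theorem integral_walshT_six_le (hχ : IsWalsh χ) {w : ι → ℝ} {K : ℝ} (hw : ∑ j, w j ^ 2 ≤ K ^ 2)
    (i : ι) : ∫ x, walshT χ w x i ^ 6 ∂coins ι 2⁻¹ ≤ 15 * K ^ 6 := by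
  refine (integral_rademacher_six (fun j => χ j i * w j) Finset.univ).trans ?_
  have h : ∑ j, (χ j i * w j) ^ 2 = ∑ j, w j ^ 2 :=
    Finset.sum_congr rfl fun j _ => by rw [mul_pow, hχ.sq, one_mul]
  have h0 : 0 ≤ ∑ j, w j ^ 2 := Finset.sum_nonneg fun _ _ => sq_nonneg _
  rw [h]
  calc 15 * (∑ j, w j ^ 2) ^ 3 ≤ 15 * (K ^ 2) ^ 3 := by gcongr
    _ = _ := by ring

/-- The sketching error has mean square of order `1 / m`, where `m` is the sketch size. -/
theorem integral_sketchErr_sq_le (hχ : IsWalsh χ) {γ : ℝ} (h0 : 0 < γ) (h1 : γ ≤ 1)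
    {w v : ι → ℝ} {K : ℝ} (hw : ∑ j, w j ^ 2 ≤ K ^ 2) (hv : ∑ j, v j ^ 2 ≤ K ^ 2) :
    ∫ x, ∫ b, sketchErr χ γ w v b x ^ 2 ∂coins ι γ ∂coins ι 2⁻¹ ≤
      3 * K ^ 4 / (γ * Fintype.card ι) := by
  rcases isEmpty_or_nonempty ι with hι | hι
  · simp [sketchErr]
  have hN : (0 : ℝ) < Fintype.card ι := by exact_mod_cast Fintype.card_pos
  simp_rw [sketchErr, integral_sum_ctr_sq h0 h1]
  rw [integral_const_mul, integral_finsetSum _ fun _ _ => Integrable.of_finite]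
  have h2 : ∀ i, ∫ x, (walshT χ w x i * walshT χ v x i / Fintype.card ι) ^ 2 ∂coins ι 2⁻¹ ≤
      3 * K ^ 4 / Fintype.card ι ^ 2 := by
    intro i
    calc _ ≤ ∫ x, (walshT χ w x i ^ 4 + walshT χ v x i ^ 4) * (1 / (2 * Fintype.card ι ^ 2))
          ∂coins ι 2⁻¹ := by
          refine integral_mono Integrable.of_finite Integrable.of_finite fun x => ?_
          have : (walshT χ w x i * walshT χ v x i / Fintype.card ι) ^ 2 =
            (2 * (walshT χ w x i ^ 2 * walshT χ v x i ^ 2)) * (1 / (2 * Fintype.card ι ^ 2)) := by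
            field_simp
          simp only [this]
          gcongr
          nlinarith [sq_nonneg (walshT χ w x i ^ 2 - walshT χ v x i ^ 2)]
      _ = (∫ x, walshT χ w x i ^ 4 ∂coins ι 2⁻¹ + ∫ x, walshT χ v x i ^ 4 ∂coins ι 2⁻¹) *
          (1 / (2 * Fintype.card ι ^ 2)) := by
          rw [integral_mul_const, integral_add Integrable.of_finite Integrable.of_finite]
      _ ≤ (3 * K ^ 4 + 3 * K ^ 4) * (1 / (2 * Fintype.card ι ^ 2)) := by
          gcongr
          · exact integral_walshT_four_le hχ hw i
          · exact integral_walshT_four_le hχ hv i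
      _ = _ := by field_simp; ring
  calc _ ≤ (1 - γ) / γ * ∑ i : ι, 3 * K ^ 4 / Fintype.card ι ^ 2 := by
        exact mul_le_mul_of_nonneg_left (Finset.sum_le_sum fun i _ => h2 i)
          (div_nonneg (by linarith) h0.le)
    _ = (1 - γ) * (3 * K ^ 4 / (γ * Fintype.card ι)) := by
        rw [Finset.sum_const, Finset.card_univ, nsmul_eq_mul]
        field_simp
    _ ≤ _ := mul_le_of_le_one_left (by positivity) (by linarith)

/-- Given the signs `x`, this is the variance of the normalized sketching error. -/
noncomputable def condVar (χ : ι → ι → ℝ) (w v : ι → ℝ) (x : ι → Bool) : ℝ :=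
  (∑ i, walshT χ w x i ^ 2 * walshT χ v x i ^ 2) / Fintype.card ι

theorem condVar_nonneg (χ : ι → ι → ℝ) (w v : ι → ℝ) (x : ι → Bool) : 0 ≤ condVar χ w v x := by
  unfold condVar; positivity

/-- The mean of `condVar` differs from the target by `2 ∑ (wⱼ vⱼ)²`, at most `2 K² ρ²` when one of
the vectors is delocalized, and its standard deviation is at most `√(64 K⁶ ρ²) = 8 K³ ρ`. By
symmetry the delocalized vector may be taken to be `v`. -/
theorem integral_abs_condVar_sub_le (hχ : IsWalsh χ) {w v : ι → ℝ} {K ρ : ℝ} (hK : 0 < K)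
    (hρ : 0 < ρ) (hw : ∑ j, w j ^ 2 ≤ K ^ 2) (hv : ∑ j, v j ^ 2 ≤ K ^ 2)
    (hmax : (∀ j, |w j| ≤ ρ) ∨ ∀ j, |v j| ≤ ρ) :
    ∫ x, |condVar χ w v x - ((∑ j, w j ^ 2) * ∑ j, v j ^ 2 + 2 * (∑ j, w j * v j) ^ 2)|
      ∂coins ι 2⁻¹ ≤ 8 * K ^ 3 * ρ + 2 * K ^ 2 * ρ ^ 2 := by
  wlog hvρ : ∀ j, |v j| ≤ ρ generalizing w v
  · have h := this hv hw hmax.symm (hmax.resolve_right hvρ)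
    have e : ∀ x, condVar χ w v x = condVar χ v w x := fun x => by
      unfold condVar; simp_rw [mul_comm]
    simp_rw [e, fun j => mul_comm (w j) (v j)]
    rw [mul_comm (∑ j, w j ^ 2)]
    exact h
  set μ := (∑ j, w j ^ 2) * ∑ j, v j ^ 2 + 2 * ((∑ j, w j * v j) ^ 2 - ∑ j, (w j * v j) ^ 2) with hμ
  have hw0 : 0 ≤ ∑ j, w j ^ 2 := Finset.sum_nonneg fun _ _ => sq_nonneg _
  have hv0 : 0 ≤ ∑ j, v j ^ 2 := Finset.sum_nonneg fun _ _ => sq_nonneg _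
  have h1 : ∫ x, (condVar χ w v x - μ) ^ 2 ∂coins ι 2⁻¹ ≤ 64 * K ^ 6 * ρ ^ 2 := by
    refine (hχ.integral_fluctuation_sq_le w v).trans ?_
    have h2 := hχ.sum_triples_sq_le w v hvρ
    calc _ ≤ 64 * ((∑ j, w j ^ 2) ^ 2 * (∑ j, v j ^ 2) * ρ ^ 2) := by gcongr
      _ ≤ 64 * ((K ^ 2) ^ 2 * (K ^ 2) * ρ ^ 2) := by gcongr
      _ = _ := by ring
  have h3 : ∑ j, (w j * v j) ^ 2 ≤ K ^ 2 * ρ ^ 2 := by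
    calc _ ≤ ∑ j, w j ^ 2 * ρ ^ 2 := by
          refine Finset.sum_le_sum fun j _ => ?_
          rw [mul_pow]
          exact mul_le_mul_of_nonneg_left
            (sq_le_sq' (neg_le_of_abs_le (hvρ j)) (le_of_abs_le (hvρ j))) (sq_nonneg _)
      _ = (∑ j, w j ^ 2) * ρ ^ 2 := by rw [Finset.sum_mul]
      _ ≤ _ := by gcongr
  have h4 : 0 ≤ ∑ j, (w j * v j) ^ 2 := Finset.sum_nonneg fun _ _ => sq_nonneg _
  -- `L` is the bound on the standard deviation. With this choice `|z| ≤ z² / (2L) + L / 2`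
  -- integrates to exactly `L`, as the Cauchy–Schwarz inequality would give.
  set L := 8 * K ^ 3 * ρ with hL
  have hL0 : 0 < L := by positivity
  calc _ ≤ ∫ x, ((condVar χ w v x - μ) ^ 2 * (1 / (2 * L)) + (L / 2 + 2 * K ^ 2 * ρ ^ 2))
        ∂coins ι 2⁻¹ := by
        refine integral_mono Integrable.of_finite Integrable.of_finite fun x => ?_
        have e : condVar χ w v x - ((∑ j, w j ^ 2) * ∑ j, v j ^ 2 + 2 * (∑ j, w j * v j) ^ 2) =
          (condVar χ w v x - μ) - 2 * ∑ j, (w j * v j) ^ 2 := by rw [hμ]; ring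
        have h5 : |condVar χ w v x - μ| ≤ (condVar χ w v x - μ) ^ 2 * (1 / (2 * L)) + L / 2 := by
          rw [← sq_abs, mul_one_div, div_add' _ _ _ (by positivity), le_div_iff₀ (by positivity)]
          nlinarith [sq_nonneg (|condVar χ w v x - μ| - L)]
        simp only [e]
        refine (abs_sub _ _).trans ?_
        rw [abs_of_nonneg (by positivity : 0 ≤ 2 * ∑ j, (w j * v j) ^ 2)]
        linarith
    _ = (∫ x, (condVar χ w v x - μ) ^ 2 ∂coins ι 2⁻¹) * (1 / (2 * L)) +
        (L / 2 + 2 * K ^ 2 * ρ ^ 2) := by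
        rw [integral_add Integrable.of_finite Integrable.of_finite, integral_mul_const,
          integral_const, probReal_univ, one_smul]
    _ ≤ (64 * K ^ 6 * ρ ^ 2) * (1 / (2 * L)) + (L / 2 + 2 * K ^ 2 * ρ ^ 2) := by gcongr
    _ = _ := by rw [hL]; field_simp; ring

/-- Quantitative central limit theorem for the sketching error, where `γ N` is the sketch size. -/
theorem norm_integral_exp_sketchErr_sub_le (hχ : IsWalsh χ) {γ : ℝ} (h0 : 0 < γ) (h1 : γ < 1)
    {w v : ι → ℝ} {K ρ : ℝ} (hK : 0 < K) (hρ : 0 < ρ) (hw : ∑ j, w j ^ 2 ≤ K ^ 2)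
    (hv : ∑ j, v j ^ 2 ≤ K ^ 2) (hmax : (∀ j, |w j| ≤ ρ) ∨ ∀ j, |v j| ≤ ρ) {c : ℝ} (hc0 : 0 ≤ c)
    (hc : c ^ 2 = γ * Fintype.card ι / (1 - γ)) :
    ‖∫ x, ∫ b, Complex.exp ((c * sketchErr χ γ w v b x : ℝ) * Complex.I) ∂coins ι γ ∂coins ι 2⁻¹ -
      (Real.exp (-(((∑ j, w j ^ 2) * ∑ j, v j ^ 2 + 2 * (∑ j, w j * v j) ^ 2) / 2)) : ℝ)‖ ≤
    75 * K ^ 6 * c ^ 3 / (γ * Fintype.card ι) ^ 2 + (8 * K ^ 3 * ρ + 2 * K ^ 2 * ρ ^ 2) := by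
  have hγ := h1.le
  set τ := (∑ j, w j ^ 2) * ∑ j, v j ^ 2 + 2 * (∑ j, w j * v j) ^ 2 with hτ
  have hτ0 : 0 ≤ τ := by
    have hw0 : 0 ≤ ∑ j, w j ^ 2 := Finset.sum_nonneg fun _ _ => sq_nonneg _
    have hv0 : 0 ≤ ∑ j, v j ^ 2 := Finset.sum_nonneg fun _ _ => sq_nonneg _
    positivity
  have hsub : (∫ x, ∫ b, Complex.exp ((c * sketchErr χ γ w v b x : ℝ) * Complex.I)
      ∂coins ι γ ∂coins ι 2⁻¹) - ((Real.exp (-(τ / 2)) : ℝ) : ℂ) =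
      ∫ x, (∫ b, Complex.exp ((c * sketchErr χ γ w v b x : ℝ) * Complex.I) ∂coins ι γ -
        ((Real.exp (-(τ / 2)) : ℝ) : ℂ)) ∂coins ι 2⁻¹ := by
    rw [integral_sub Integrable.of_finite Integrable.of_finite, integral_const, probReal_univ,
      one_smul]
  rw [hsub]
  -- With the signs `x` fixed, the scaled error is a weighted Bernoulli sum, and the choice of `c`
  -- makes its variance exactly `condVar`. The first term is the central limit error, with products
  -- of cubes bounded by sixth powers; the second replaces `condVar` by `τ`, as `exp (-·)` is
  -- 1-Lipschitz on the half line.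
  have hpt : ∀ x, ‖∫ b, Complex.exp ((c * sketchErr χ γ w v b x : ℝ) * Complex.I) ∂coins ι γ -
        ((Real.exp (-(τ / 2)) : ℝ) : ℂ)‖ ≤
      5 / γ ^ 2 * (c / Fintype.card ι) ^ 3 *
        (∑ i, (walshT χ w x i ^ 6 + walshT χ v x i ^ 6) * (1 / 2)) + |condVar χ w v x - τ| := by
    intro x
    let s : ι → ℝ := fun i => c * (walshT χ w x i * walshT χ v x i / Fintype.card ι)
    have hs : ∀ b, c * sketchErr χ γ w v b x = ∑ i, s i * ctr γ (b i) := by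
      intro b
      rw [sketchErr, Finset.mul_sum]
      exact Finset.sum_congr rfl fun i _ => by simp only [s]; ring
    have hs2 : (1 - γ) / γ * (∑ i, s i ^ 2) = condVar χ w v x := by
      rcases isEmpty_or_nonempty ι with hι | hι
      · simp [condVar]
      have hN : (0 : ℝ) < Fintype.card ι := by exact_mod_cast Fintype.card_pos
      have : ∀ i, s i ^ 2 = c ^ 2 / Fintype.card ι ^ 2 * (walshT χ w x i ^ 2 * walshT χ v x i ^ 2) := by
        intro i; simp only [s]; field_simp
      simp_rw [this]
      rw [← Finset.mul_sum, hc, condVar]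
      have : 1 - γ ≠ 0 := by linarith
      field_simp
    have hclt := norm_integral_exp_sum_ctr_sub_le h0 hγ s
    rw [hs2] at hclt
    simp_rw [hs]
    refine (norm_sub_le_norm_sub_add_norm_sub _
      ((Real.exp (-(condVar χ w v x / 2)) : ℝ) : ℂ) _).trans (add_le_add (hclt.trans ?_) ?_)
    · rw [mul_assoc]
      refine mul_le_mul_of_nonneg_left ?_ (by positivity)
      rw [Finset.mul_sum]
      refine Finset.sum_le_sum fun i _ => ?_
      have e : |s i| ^ 3 = (c / Fintype.card ι) ^ 3 * (|walshT χ w x i| ^ 3 * |walshT χ v x i| ^ 3) := by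
        simp only [s]
        rw [abs_mul, abs_div, abs_mul, abs_of_nonneg hc0, Nat.abs_cast]
        ring
      rw [e]
      refine mul_le_mul_of_nonneg_left ?_ (by positivity)
      have e6 : ∀ y : ℝ, y ^ 6 = (|y| ^ 3) ^ 2 := fun y => by
        rw [← pow_mul, ← Even.pow_abs (by decide)]
      rw [e6, e6]
      nlinarith [sq_nonneg (|walshT χ w x i| ^ 3 - |walshT χ v x i| ^ 3)]
    · rw [← Complex.ofReal_sub, Complex.norm_real, Real.norm_eq_abs]
      refine (abs_exp_neg_sub_exp_neg_le (by linarith [condVar_nonneg χ w v x])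
        (by linarith)).trans ?_
      rw [← sub_div, abs_div, abs_two]
      linarith [abs_nonneg (condVar χ w v x - τ)]
  refine (norm_integral_le_integral_norm _).trans ?_
  refine (integral_mono Integrable.of_finite Integrable.of_finite hpt).trans ?_
  rw [integral_add Integrable.of_finite Integrable.of_finite, integral_const_mul,
    integral_finsetSum _ fun _ _ => Integrable.of_finite]
  refine add_le_add ?_ (integral_abs_condVar_sub_le hχ hK hρ hw hv hmax)
  rcases isEmpty_or_nonempty ι with hι | hι
  · simp
  have hN : (0 : ℝ) < Fintype.card ι := by exact_mod_cast Fintype.card_pos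
  calc _ ≤ 5 / γ ^ 2 * (c / Fintype.card ι) ^ 3 * ∑ i : ι, 15 * K ^ 6 := by
        refine mul_le_mul_of_nonneg_left (Finset.sum_le_sum fun i _ => ?_) (by positivity)
        rw [integral_mul_const, integral_add Integrable.of_finite Integrable.of_finite]
        linarith [integral_walshT_six_le hχ hw i, integral_walshT_six_le hχ hv i]
    _ = _ := by
        rw [Finset.sum_const, Finset.card_univ, nsmul_eq_mul]
        field_simp
        ring

end SketchError

/-! ### Square roots of matrices -/

section MatSqrt

open scoped MatrixOrder

variable {p : ℕ} {A : Matrix (Fin p) (Fin p) ℝ}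

theorem matSqrt_posSemidef (A : Matrix (Fin p) (Fin p) ℝ) : (matSqrt A).PosSemidef := by
  rw [← Matrix.nonneg_iff_posSemidef]
  exact cfc_nonneg fun x _ => Real.sqrt_nonneg x

theorem matSqrt_mul_self (hA : A.PosSemidef) : matSqrt A * matSqrt A = A := by
  have hs : IsSelfAdjoint A := hA.isHermitian
  unfold matSqrt
  rw [← cfc_mul Real.sqrt Real.sqrt A]
  conv_rhs => rw [← cfc_id ℝ A]
  refine cfc_congr fun x hx => ?_
  have : 0 ≤ x := spectrum_nonneg_of_nonneg (Matrix.nonneg_iff_posSemidef.2 hA) hx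
  simp [Real.mul_self_sqrt this]

/-- The hypothesis places the spectrum of `A` above `a ^ 2`, where the square root is at least `a`;
the functional calculus turns this back into an order bound. -/
theorem matSqrt_sub_posSemidef (hA : A.PosSemidef) {a : ℝ}
    (h : (A - a ^ 2 • (1 : Matrix (Fin p) (Fin p) ℝ)).PosSemidef) :
    (matSqrt A - a • (1 : Matrix (Fin p) (Fin p) ℝ)).PosSemidef := by
  have hs : IsSelfAdjoint A := hA.isHermitian
  rw [← Matrix.nonneg_iff_posSemidef, sub_nonneg, ← Algebra.algebraMap_eq_smul_one] at h ⊢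
  rw [algebraMap_le_iff_le_spectrum] at h
  refine algebraMap_le_cfc _ _ _ fun x hx => ?_
  exact Real.le_sqrt_of_sq_le (h x hx)

end MatSqrt

/-! ### Perturbation bounds in the Frobenius norm -/

section Frobenius

open scoped Matrix.Norms.Frobenius

variable {p : ℕ}

theorem frobenius_sq {m n : ℕ} (X : Matrix (Fin m) (Fin n) ℝ) : ‖X‖ ^ 2 = ∑ i, ∑ j, X i j ^ 2 := by
  rw [Matrix.frobenius_norm_def, ← Real.sqrt_eq_rpow, Real.sq_sqrt (by positivity)]
  simp

theorem trace_transpose_mul_self {m n : ℕ} (X : Matrix (Fin m) (Fin n) ℝ) :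
    (Xᵀ * X).trace = ‖X‖ ^ 2 := by
  rw [frobenius_sq, Matrix.trace, Finset.sum_comm]
  simp [Matrix.mul_apply, pow_two]

theorem trace_transpose_mul_le {m n : ℕ} (X Y : Matrix (Fin m) (Fin n) ℝ) :
    (Xᵀ * Y).trace ≤ ‖X‖ * ‖Y‖ := by
  have h : (Xᵀ * Y).trace = ∑ q : Fin m × Fin n, X q.1 q.2 * Y q.1 q.2 := by
    rw [Matrix.trace, Fintype.sum_prod_type, Finset.sum_comm]
    simp [Matrix.mul_apply]
  rw [h]
  refine Real.le_sqrt_of_sq_le (Finset.sum_mul_sq_le_sq_mul_sq _ _ _) |>.trans (le_of_eq ?_)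
  rw [Real.sqrt_eq_iff_mul_self_eq (by positivity) (by positivity)]
  have e : ∀ Z : Matrix (Fin m) (Fin n) ℝ, ∑ q : Fin m × Fin n, Z q.1 q.2 ^ 2 = ‖Z‖ ^ 2 := fun Z => by
    rw [frobenius_sq, Fintype.sum_prod_type]
  rw [e, e]
  ring

theorem frobenius_one : ‖(1 : Matrix (Fin p) (Fin p) ℝ)‖ = √p := by
  rw [← Real.sqrt_sq (norm_nonneg _), ← trace_transpose_mul_self]
  simp

theorem euclNorm_sq {ι : Type*} [Fintype ι] (x : ι → ℝ) : euclNorm x ^ 2 = ∑ i, x i ^ 2 := by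
  rw [euclNorm, EuclideanSpace.norm_sq_eq]
  simp

theorem euclNorm_nonneg {ι : Type*} [Fintype ι] (x : ι → ℝ) : 0 ≤ euclNorm x := norm_nonneg _

theorem dotProduct_self_eq {ι : Type*} [Fintype ι] (x : ι → ℝ) : x ⬝ᵥ x = euclNorm x ^ 2 := by
  rw [euclNorm_sq]; simp [dotProduct, pow_two]

theorem abs_dotProduct_le {ι : Type*} [Fintype ι] (x y : ι → ℝ) :
    |x ⬝ᵥ y| ≤ euclNorm x * euclNorm y := by
  rw [← abs_of_nonneg (mul_nonneg (euclNorm_nonneg x) (euclNorm_nonneg y)), ← sq_le_sq, mul_pow,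
    euclNorm_sq, euclNorm_sq]
  exact Finset.sum_mul_sq_le_sq_mul_sq _ _ _

theorem euclNorm_mulVec_le {m n : ℕ} (M : Matrix (Fin m) (Fin n) ℝ) (x : Fin n → ℝ) :
    euclNorm (M *ᵥ x) ≤ ‖M‖ * euclNorm x := by
  refine (sq_le_sq₀ (euclNorm_nonneg _) (mul_nonneg (norm_nonneg _) (euclNorm_nonneg x))).1 ?_
  rw [mul_pow, frobenius_sq, euclNorm_sq, euclNorm_sq, Finset.sum_mul]
  exact Finset.sum_le_sum fun i _ => Finset.sum_mul_sq_le_sq_mul_sq Finset.univ (M i) x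

theorem frobenius_vecMulVec (x y : Fin p → ℝ) : ‖vecMulVec x y‖ = euclNorm x * euclNorm y := by
  rw [← Real.sqrt_sq (norm_nonneg _), frobenius_sq, Real.sqrt_eq_iff_mul_self_eq (by positivity)
    (mul_nonneg (euclNorm_nonneg x) (euclNorm_nonneg y))]
  have : (euclNorm x * euclNorm y) * (euclNorm x * euclNorm y) = euclNorm x ^ 2 * euclNorm y ^ 2 := by
    ring
  rw [this, euclNorm_sq, euclNorm_sq, Finset.sum_mul_sum]
  simp [vecMulVec_apply, mul_pow]

/-- Lipschitz bound for the matrix square root. -/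
theorem norm_sqrt_sub_sqrt_le {N N₀ : Matrix (Fin p) (Fin p) ℝ} {a : ℝ} (hN : N.PosSemidef)
    (hN₀ : (N₀ - a • (1 : Matrix (Fin p) (Fin p) ℝ)).PosSemidef) :
    a * ‖N - N₀‖ ≤ ‖N * N - N₀ * N₀‖ := by
  have hs : Nᵀ = N := hN.isHermitian
  have hs0 : N₀ᵀ = N₀ := by
    have h : (N₀ - a • (1 : Matrix (Fin p) (Fin p) ℝ))ᵀ = _ := hN₀.isHermitian
    simpa using h
  set X := N - N₀ with hX
  have hXt : Xᵀ = X := by rw [hX, transpose_sub, hs, hs0]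
  -- This is a Sylvester equation for `X`. Paired with `X` under the trace, the term with `N` is
  -- nonnegative and the one with `N₀` is at least `a ‖X‖²`, so only one of the two roots needs a
  -- lower bound.
  have h1 : N * N - N₀ * N₀ = N * X + X * N₀ := by rw [hX]; noncomm_ring
  have h2 : 0 ≤ (Xᵀ * N * X).trace := (hN.conjTranspose_mul_mul_same X).trace_nonneg
  have h3 : 0 ≤ (Xᵀ * (N₀ - a • (1 : Matrix (Fin p) (Fin p) ℝ)) * X).trace :=
    (hN₀.conjTranspose_mul_mul_same X).trace_nonneg
  have h4 : (Xᵀ * (N * N - N₀ * N₀)).trace =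
      (Xᵀ * N * X).trace + (Xᵀ * (N₀ - a • (1 : Matrix (Fin p) (Fin p) ℝ)) * X).trace +
        a * (Xᵀ * X).trace := by
    have e1 : (X * (X * N₀)).trace = (X * N₀ * X).trace := by rw [trace_mul_comm]
    rw [h1, hXt, mul_add, trace_add, e1]
    simp only [mul_sub, sub_mul, trace_sub, Matrix.mul_smul, Matrix.smul_mul, trace_smul, mul_one,
      smul_eq_mul, mul_assoc]
    ring
  have h5 := trace_transpose_mul_le X (N * N - N₀ * N₀)
  rw [h4, trace_transpose_mul_self] at h5
  rcases (norm_nonneg X).eq_or_lt with h0 | h0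
  · rw [← h0]; simp
  · have : ‖X‖ * (a * ‖X‖) ≤ ‖X‖ * ‖N * N - N₀ * N₀‖ := by nlinarith
    exact le_of_mul_le_mul_left this h0

theorem isUnit_of_norm_sub_one_lt {Y : Matrix (Fin p) (Fin p) ℝ} (h : ‖Y - 1‖ < 1) : IsUnit Y := by
  have := isUnit_one_sub_of_norm_lt_one (x := 1 - Y) (by rwa [norm_sub_rev])
  simpa using this

theorem norm_inv_sub_one_le {Y : Matrix (Fin p) (Fin p) ℝ} (h : ‖Y - 1‖ ≤ 1 / 2) :
    ‖Y⁻¹ - 1‖ ≤ 2 * ‖Y - 1‖ := by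
  have hu : IsUnit Y.det := (isUnit_iff_isUnit_det Y).1 (isUnit_of_norm_sub_one_lt (by linarith))
  -- The identity bounds `‖Y⁻¹ - 1‖` by `‖Y - 1‖` plus at most half of itself, and that half is
  -- absorbed.
  have e : Y⁻¹ - 1 = -((Y⁻¹ - 1) * (Y - 1)) - (Y - 1) := by
    have : (Y⁻¹ - 1) * (Y - 1) = Y⁻¹ * Y - Y⁻¹ - Y + 1 := by noncomm_ring
    rw [this, nonsing_inv_mul _ hu]
    abel
  have h2 : ‖Y⁻¹ - 1‖ ≤ ‖Y⁻¹ - 1‖ * ‖Y - 1‖ + ‖Y - 1‖ := by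
    conv_lhs => rw [e]
    refine (norm_sub_le _ _).trans (add_le_add ?_ le_rfl)
    rw [norm_neg]
    exact norm_mul_le _ _
  nlinarith [norm_nonneg (Y⁻¹ - 1)]

end Frobenius

section Perturbation

open scoped Matrix.Norms.Frobenius

variable {p : ℕ}

/-- `A` is symmetric positive definite with smallest eigenvalue at least `a`, and has condition
number at most of order `κ`. -/
structure WellCond (A : Matrix (Fin p) (Fin p) ℝ) (a κ : ℝ) : Prop where
  pos : 0 < a
  pos' : 0 < κ
  symm : Aᵀ = A
  lower : (A - a • (1 : Matrix (Fin p) (Fin p) ℝ)).PosSemidef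
  norm_le : ‖A‖ ≤ κ * a
  inv_le : ‖A⁻¹‖ ≤ κ / a

theorem posDef_of_sub_posSemidef {A : Matrix (Fin p) (Fin p) ℝ} {a : ℝ} (ha : 0 < a)
    (h : (A - a • (1 : Matrix (Fin p) (Fin p) ℝ)).PosSemidef) : A.PosDef := by
  have := PosDef.posSemidef_add h ((PosDef.one (n := Fin p) (R := ℝ)).smul ha)
  simpa using this

theorem posSemidef_conj {M B : Matrix (Fin p) (Fin p) ℝ} (hM : M.PosSemidef) (hB : Bᵀ = B) :
    (B * M * B).PosSemidef := by
  have := hM.conjTranspose_mul_mul_same B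
  rwa [conjTranspose_eq_transpose_of_trivial, hB] at this

theorem inv_smul_of_pos {A : Matrix (Fin p) (Fin p) ℝ} {t : ℝ} (ht : 0 < t)
    (hA : IsUnit A.det) : (t • A)⁻¹ = t⁻¹ • A⁻¹ := by
  refine inv_eq_left_inv ?_
  rw [Matrix.smul_mul, Matrix.mul_smul, smul_smul, inv_mul_cancel₀ ht.ne', one_smul,
    nonsing_inv_mul _ hA]

namespace WellCond

variable {A : Matrix (Fin p) (Fin p) ℝ} {a κ : ℝ}

theorem posDef (hA : WellCond A a κ) : A.PosDef := posDef_of_sub_posSemidef hA.pos hA.lower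

theorem isUnit_det (hA : WellCond A a κ) : IsUnit A.det := hA.posDef.det_pos.ne'.isUnit

theorem inv_symm (hA : WellCond A a κ) : A⁻¹ᵀ = A⁻¹ := by rw [transpose_nonsing_inv, hA.symm]

/-- The constant `κ` is scale invariant. The design may thus be divided by the norm of the fitted
values, which is not controlled along the sequence, at no cost in the constants. -/
theorem smul (hA : WellCond A a κ) {t : ℝ} (ht : 0 < t) : WellCond (t • A) (t * a) κ where
  pos := mul_pos ht hA.pos
  pos' := hA.pos'
  symm := by rw [transpose_smul, hA.symm]
  lower := by
    have := hA.lower.smul ht.le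
    rwa [smul_sub, smul_smul] at this
  norm_le := by
    rw [norm_smul, Real.norm_eq_abs, abs_of_pos ht]
    calc t * ‖A‖ ≤ t * (κ * a) := mul_le_mul_of_nonneg_left hA.norm_le ht.le
      _ = _ := by ring
  inv_le := by
    rw [inv_smul_of_pos ht hA.isUnit_det, norm_smul, Real.norm_eq_abs,
      abs_of_pos (inv_pos.2 ht)]
    calc t⁻¹ * ‖A⁻¹‖ ≤ t⁻¹ * (κ / a) := mul_le_mul_of_nonneg_left hA.inv_le (inv_pos.2 ht).le
      _ = _ := by field_simp

/-- The square root of `A W A` is close to `A` if `W` is close to the identity. -/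
theorem norm_sqrt_mul_inv_sub_one_le (hA : WellCond A a κ) {W : Matrix (Fin p) (Fin p) ℝ}
    (hW : W.PosSemidef) : ‖matSqrt (A * W * A) * A⁻¹ - 1‖ ≤ κ ^ 3 * ‖W - 1‖ := by
  have ha := hA.pos
  have hκ := hA.pos'
  have hM : (A * W * A).PosSemidef := posSemidef_conj hW hA.symm
  have h1 := norm_sqrt_sub_sqrt_le (matSqrt_posSemidef (A * W * A)) hA.lower
  rw [matSqrt_mul_self hM] at h1
  have e1 : A * W * A - A * A = A * (W - 1) * A := by noncomm_ring
  have e2 : matSqrt (A * W * A) * A⁻¹ - 1 = (matSqrt (A * W * A) - A) * A⁻¹ := by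
    rw [sub_mul, mul_nonsing_inv _ hA.isUnit_det]
  have h2 : ‖A * (W - 1) * A‖ ≤ (κ * a) * ‖W - 1‖ * (κ * a) := by
    refine (norm_mul_le _ _).trans ?_
    have h3 := norm_mul_le A (W - 1)
    have h4 := hA.norm_le
    calc _ ≤ (‖A‖ * ‖W - 1‖) * ‖A‖ := by gcongr
      _ ≤ _ := by gcongr
  rw [e1] at h1
  have h5 : ‖matSqrt (A * W * A) - A‖ ≤ κ ^ 2 * a * ‖W - 1‖ := by
    have := h1.trans h2
    refine le_of_mul_le_mul_left (this.trans (le_of_eq ?_)) ha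
    ring
  rw [e2]
  calc _ ≤ ‖matSqrt (A * W * A) - A‖ * ‖A⁻¹‖ := norm_mul_le _ _
    _ ≤ (κ ^ 2 * a * ‖W - 1‖) * (κ / a) := by gcongr; exact hA.inv_le
    _ = _ := by field_simp

/-- `A⁻²` is bounded below. -/
theorem inv_mul_inv_sub_posSemidef (hA : WellCond A a κ) :
    (A⁻¹ * A⁻¹ - (1 / (κ * a)) ^ 2 • (1 : Matrix (Fin p) (Fin p) ℝ)).PosSemidef := by
  have ha := hA.pos
  have hκ := hA.pos'
  refine PosSemidef.of_dotProduct_mulVec_nonneg ?_ fun x => ?_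
  · rw [IsHermitian, conjTranspose_eq_transpose_of_trivial,
      transpose_sub, transpose_mul, hA.inv_symm, transpose_smul, transpose_one]
  · rw [star_trivial, sub_mulVec, dotProduct_sub, sub_nonneg, smul_mulVec, one_mulVec,
      dotProduct_smul, dotProduct_self_eq, ← mulVec_mulVec, dotProduct_mulVec,
      ← mulVec_transpose, hA.inv_symm, dotProduct_self_eq]
    have h1 : euclNorm x ≤ κ * a * euclNorm (A⁻¹ *ᵥ x) := by
      have h2 : A *ᵥ (A⁻¹ *ᵥ x) = x := by
        rw [mulVec_mulVec, mul_nonsing_inv _ hA.isUnit_det, one_mulVec]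
      calc euclNorm x = euclNorm (A *ᵥ (A⁻¹ *ᵥ x)) := by rw [h2]
        _ ≤ ‖A‖ * euclNorm (A⁻¹ *ᵥ x) := euclNorm_mulVec_le _ _
        _ ≤ _ := mul_le_mul_of_nonneg_right hA.norm_le (euclNorm_nonneg _)
    have h3 : euclNorm x ^ 2 ≤ (κ * a * euclNorm (A⁻¹ *ᵥ x)) ^ 2 :=
      pow_le_pow_left₀ (euclNorm_nonneg _) h1 2
    rw [smul_eq_mul, div_pow, one_pow, div_mul_eq_mul_div, one_mul, div_le_iff₀ (by positivity)]
    calc _ ≤ _ := h3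
      _ = _ := by ring

end WellCond

/-- The matrix `(A⁻¹ G A⁻¹)^{-1/2} A⁻¹`, which whitens vectors with covariance matrix `G`. -/
noncomputable def whitener (A G : Matrix (Fin p) (Fin p) ℝ) : Matrix (Fin p) (Fin p) ℝ :=
  (matSqrt (A⁻¹ * G * A⁻¹))⁻¹ * A⁻¹

namespace WellCond

variable {A : Matrix (Fin p) (Fin p) ℝ} {a κ : ℝ} {G G₀ : Matrix (Fin p) (Fin p) ℝ}

theorem posSemidef_of_sub_one (hG₀ : (G₀ - 1).PosSemidef) : G₀.PosSemidef := by
  have := hG₀.add PosSemidef.one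
  simpa using this

/-- Since `G₀ ≥ 1`, conjugation gives `A⁻¹ G₀ A⁻¹ ≥ A⁻²`, and `A⁻²` is bounded below through the
norm of `A`. -/
theorem conj_sub_posSemidef (hA : WellCond A a κ) (hG₀ : (G₀ - 1).PosSemidef) :
    (A⁻¹ * G₀ * A⁻¹ - (1 / (κ * a)) ^ 2 • (1 : Matrix (Fin p) (Fin p) ℝ)).PosSemidef := by
  have h1 := posSemidef_conj hG₀ hA.inv_symm
  have h2 := h1.add hA.inv_mul_inv_sub_posSemidef
  convert h2 using 1
  noncomm_ring

theorem sqrt_conj_sub_posSemidef (hA : WellCond A a κ) (hG₀ : (G₀ - 1).PosSemidef) :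
    (matSqrt (A⁻¹ * G₀ * A⁻¹) - (1 / (κ * a)) • (1 : Matrix (Fin p) (Fin p) ℝ)).PosSemidef :=
  matSqrt_sub_posSemidef (posSemidef_conj (posSemidef_of_sub_one hG₀) hA.inv_symm)
    (hA.conj_sub_posSemidef hG₀)

theorem isUnit_det_sqrt_conj (hA : WellCond A a κ) (hG₀ : (G₀ - 1).PosSemidef) :
    IsUnit (matSqrt (A⁻¹ * G₀ * A⁻¹)).det :=
  (posDef_of_sub_posSemidef (by have := hA.pos; have := hA.pos'; positivity)
    (hA.sqrt_conj_sub_posSemidef hG₀)).det_pos.ne'.isUnit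

/-- The whitener depends on `A` and need not converge or be symmetric. The normal limit uses only
this identity, which fixes the covariance of the whitened vector. -/
theorem whitener_mul_mul (hA : WellCond A a κ) (hG₀ : (G₀ - 1).PosSemidef) :
    whitener A G₀ * G₀ * (whitener A G₀)ᵀ = 1 := by
  have hK := posSemidef_conj (posSemidef_of_sub_one hG₀) hA.inv_symm
  have hu := hA.isUnit_det_sqrt_conj hG₀
  have hsq := matSqrt_mul_self hK
  have hs : (matSqrt (A⁻¹ * G₀ * A⁻¹))ᵀ = matSqrt (A⁻¹ * G₀ * A⁻¹) :=
    (matSqrt_posSemidef _).isHermitian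
  unfold whitener
  set N := matSqrt (A⁻¹ * G₀ * A⁻¹)
  rw [transpose_mul, hA.inv_symm, transpose_nonsing_inv, hs]
  calc _ = N⁻¹ * (A⁻¹ * G₀ * A⁻¹) * N⁻¹ := by simp only [mul_assoc]
    _ = N⁻¹ * N * (N * N⁻¹) := by rw [← hsq]; simp only [mul_assoc]
    _ = 1 := by rw [nonsing_inv_mul _ hu, mul_nonsing_inv _ hu, one_mul]

/-- From `R G₀ Rᵀ = 1` and `G₀ ≥ 1` it follows that `R Rᵀ ≤ 1`, and the trace bounds `‖R‖²` by `p`,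
whatever `A` is. -/
theorem norm_whitener_le (hA : WellCond A a κ) (hG₀ : (G₀ - 1).PosSemidef) :
    ‖whitener A G₀‖ ≤ √p := by
  have h1 := hA.whitener_mul_mul hG₀
  have h2 : 0 ≤ (whitener A G₀ * (G₀ - 1) * (whitener A G₀)ᵀ).trace :=
    (hG₀.mul_mul_conjTranspose_same (whitener A G₀)).trace_nonneg
  rw [mul_sub, sub_mul, h1, mul_one, trace_sub, trace_one, Fintype.card_fin, trace_mul_comm,
    trace_transpose_mul_self] at h2
  exact Real.le_sqrt_of_sq_le (by linarith)

/-- Lipschitz bound for the whitening matrix. -/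
theorem norm_whitener_sub_le (hA : WellCond A a κ) (hG : G.PosSemidef)
    (hG₀ : (G₀ - 1).PosSemidef) (hsmall : √p * κ ^ 4 * ‖G - G₀‖ ≤ 1 / 2) :
    ‖whitener A G - whitener A G₀‖ ≤ 2 * p * κ ^ 4 * ‖G - G₀‖ := by
  have ha := hA.pos
  have hκ := hA.pos'
  have hu := hA.isUnit_det_sqrt_conj hG₀
  have hR := hA.norm_whitener_le hG₀
  have hlow := hA.sqrt_conj_sub_posSemidef hG₀
  have h1 := norm_sqrt_sub_sqrt_le (matSqrt_posSemidef (A⁻¹ * G * A⁻¹)) hlow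
  rw [matSqrt_mul_self (posSemidef_conj hG hA.inv_symm),
    matSqrt_mul_self (posSemidef_conj (posSemidef_of_sub_one hG₀) hA.inv_symm)] at h1
  set R := whitener A G₀ with hRdef
  set N := matSqrt (A⁻¹ * G * A⁻¹) with hN
  set N₀ := matSqrt (A⁻¹ * G₀ * A⁻¹) with hN₀
  have hRe : R = N₀⁻¹ * A⁻¹ := rfl
  have hGe : whitener A G = N⁻¹ * A⁻¹ := rfl
  have e1 : A⁻¹ * G * A⁻¹ - A⁻¹ * G₀ * A⁻¹ = A⁻¹ * (G - G₀) * A⁻¹ := by noncomm_ring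
  have h2 : ‖N - N₀‖ ≤ κ ^ 3 / a * ‖G - G₀‖ := by
    have h3 : ‖A⁻¹ * (G - G₀) * A⁻¹‖ ≤ (κ / a) * ‖G - G₀‖ * (κ / a) := by
      refine (norm_mul_le _ _).trans ?_
      have h3 := norm_mul_le A⁻¹ (G - G₀)
      have h4 := hA.inv_le
      calc _ ≤ (‖A⁻¹‖ * ‖G - G₀‖) * ‖A⁻¹‖ := by gcongr
        _ ≤ _ := by gcongr
    rw [e1] at h1
    refine le_of_mul_le_mul_left ((h1.trans h3).trans (le_of_eq ?_))
      (by positivity : 0 < 1 / (κ * a))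
    field_simp
  have hN₀inv : N₀⁻¹ = R * A := by
    rw [hRe, mul_assoc, nonsing_inv_mul _ hA.isUnit_det, mul_one]
  -- The two roots are compared multiplicatively: since `N₀⁻¹ = R A`, the powers of `a` cancel and
  -- the bound on `Y - 1` involves only `κ` and `p`.
  set Y := N₀⁻¹ * N with hY
  have hY1 : ‖Y - 1‖ ≤ √p * κ ^ 4 * ‖G - G₀‖ := by
    have e2 : Y - 1 = R * A * (N - N₀) := by
      rw [← hN₀inv, mul_sub, nonsing_inv_mul _ hu]
    rw [e2]
    calc _ ≤ ‖R‖ * ‖A‖ * ‖N - N₀‖ := (norm_mul_le _ _).trans (by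
          gcongr; exact norm_mul_le _ _)
      _ ≤ √p * (κ * a) * (κ ^ 3 / a * ‖G - G₀‖) := by gcongr; exact hA.norm_le
      _ = _ := by field_simp
  have hYinv := norm_inv_sub_one_le (hY1.trans hsmall)
  have hNY : N = N₀ * Y := by rw [hY, ← mul_assoc, mul_nonsing_inv _ hu, one_mul]
  have e3 : whitener A G - R = (Y⁻¹ - 1) * R := by
    rw [hGe, hNY, Matrix.mul_inv_rev, hRe]
    noncomm_ring
  rw [e3]
  calc _ ≤ ‖Y⁻¹ - 1‖ * ‖R‖ := norm_mul_le _ _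
    _ ≤ (2 * (√p * κ ^ 4 * ‖G - G₀‖)) * √p := by gcongr; linarith
    _ = 2 * (√p * √p) * κ ^ 4 * ‖G - G₀‖ := by ring
    _ = _ := by rw [Real.mul_self_sqrt (by positivity)]

end WellCond

end Perturbation

/-! ### Linearization of the studentized estimators -/

section Expansion

open scoped Matrix.Norms.Frobenius

variable {p n N : ℕ}

/-- The error of the sketched Gram operator. -/
def gramErr (S : Matrix (Fin N) (Fin n) ℝ) : Matrix (Fin n) (Fin n) ℝ := Sᵀ * S - 1

/-- The linear term in the estimators: the error of the sketch between `U` and `v`. -/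
def crossErr (S : Matrix (Fin N) (Fin n) ℝ) (U : Matrix (Fin n) (Fin p) ℝ) (v : Fin n → ℝ) :
    Fin p → ℝ := Uᵀ *ᵥ (gramErr S *ᵥ v)

/-- The total squared error of the sketch on the columns of `U` and on `v`. -/
noncomputable def errSq (S : Matrix (Fin N) (Fin n) ℝ) (U : Matrix (Fin n) (Fin p) ℝ)
    (v : Fin n → ℝ) : ℝ :=
  ‖Uᵀ * gramErr S * U‖ ^ 2 + euclNorm (crossErr S U v) ^ 2 + (v ⬝ᵥ (gramErr S *ᵥ v)) ^ 2

theorem errSq_nonneg (S : Matrix (Fin N) (Fin n) ℝ) (U : Matrix (Fin n) (Fin p) ℝ)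
    (v : Fin n → ℝ) : 0 ≤ errSq S U v := by unfold errSq; positivity

variable {U : Matrix (Fin n) (Fin p) ℝ} {A : Matrix (Fin p) (Fin p) ℝ} {a κ : ℝ}

theorem euclNorm_smul {ι : Type*} [Fintype ι] (r : ℝ) (x : ι → ℝ) :
    euclNorm (r • x) = |r| * euclNorm x := by
  rw [euclNorm, WithLp.toLp_smul, norm_smul, Real.norm_eq_abs, euclNorm]

theorem euclNorm_pos {ι : Type*} [Fintype ι] {x : ι → ℝ} (hx : x ≠ 0) : 0 < euclNorm x := by
  rw [euclNorm, norm_pos_iff]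
  simpa using hx

theorem euclNorm_mulVec_of_orthonormal (hU : Uᵀ * U = 1) (θ : Fin p → ℝ) :
    euclNorm (U *ᵥ θ) = euclNorm θ := by
  rw [← sq_eq_sq₀ (euclNorm_nonneg _) (euclNorm_nonneg _), ← dotProduct_self_eq,
    ← dotProduct_self_eq, dotProduct_mulVec, ← mulVec_transpose, mulVec_mulVec, hU, one_mulVec]

theorem gram_eq (hU : Uᵀ * U = 1) (hA : Aᵀ = A) : (U * A)ᵀ * (U * A) = A * A := by
  rw [transpose_mul, hA, Matrix.mul_assoc, ← Matrix.mul_assoc Uᵀ, hU, Matrix.one_mul]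

theorem lsCoef_eq (hU : Uᵀ * U = 1) (hA : WellCond A a κ) (y : Fin n → ℝ) :
    lsCoef (U * A) y = A⁻¹ *ᵥ (Uᵀ *ᵥ y) := by
  rw [lsCoef, gram_eq hU hA.symm, transpose_mul, hA.symm, Matrix.mul_inv_rev, ← mulVec_mulVec,
    ← mulVec_mulVec, mulVec_mulVec _ A⁻¹ A, nonsing_inv_mul _ hA.isUnit_det, one_mulVec]

theorem lsFitted_eq (hU : Uᵀ * U = 1) (hA : WellCond A a κ) (y : Fin n → ℝ) :
    lsFitted (U * A) y = U *ᵥ (Uᵀ *ᵥ y) := by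
  rw [lsFitted, lsCoef_eq hU hA, ← mulVec_mulVec, mulVec_mulVec _ A A⁻¹,
    mul_nonsing_inv _ hA.isUnit_det, one_mulVec]

theorem transpose_mulVec_lsResidual (hU : Uᵀ * U = 1) (hA : WellCond A a κ) (y : Fin n → ℝ) :
    Uᵀ *ᵥ lsResidual (U * A) y = 0 := by
  rw [lsResidual, lsFitted_eq hU hA, mulVec_sub, mulVec_mulVec _ Uᵀ U, hU, one_mulVec, sub_self]

theorem sketched_gram_eq (hA : Aᵀ = A) (S : Matrix (Fin N) (Fin n) ℝ) :
    (S * (U * A))ᵀ * (S * (U * A)) = A * (Uᵀ * (Sᵀ * S) * U) * A := by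
  simp only [transpose_mul, hA, Matrix.mul_assoc]

theorem one_add_gramErr (S : Matrix (Fin N) (Fin n) ℝ) : Sᵀ * S = 1 + gramErr S := by
  simp [gramErr]

theorem sketched_inner_eq (hU : Uᵀ * U = 1) (S : Matrix (Fin N) (Fin n) ℝ) :
    Uᵀ * (Sᵀ * S) * U - 1 = Uᵀ * gramErr S * U := by
  rw [gramErr, Matrix.mul_sub, Matrix.sub_mul, Matrix.mul_one, hU]

theorem sketched_inner_posSemidef (S : Matrix (Fin N) (Fin n) ℝ) :
    (Uᵀ * (Sᵀ * S) * U).PosSemidef := by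
  have := posSemidef_conjTranspose_mul_self (S * U)
  rwa [conjTranspose_eq_transpose_of_trivial, transpose_mul, Matrix.mul_assoc,
    ← Matrix.mul_assoc Sᵀ, ← Matrix.mul_assoc] at this

theorem abs_inv_sqrt_sub_one_le {u : ℝ} (hu : |u - 1| ≤ 1 / 2) : |(√u)⁻¹ - 1| ≤ 2 * |u - 1| := by
  have h1 : 1 / 2 ≤ u := by linarith [neg_abs_le (u - 1)]
  have h2 : 1 / 2 ≤ √u := Real.le_sqrt_of_sq_le (by norm_num; linarith)
  have h3 : √u * √u = u := Real.mul_self_sqrt (by linarith)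
  have e : (√u)⁻¹ - 1 = -((u - 1) / (√u * (1 + √u))) := by
    field_simp
    linear_combination -h3
  rw [e, abs_neg, abs_div, abs_of_pos (by positivity : 0 < √u * (1 + √u)),
    div_le_iff₀ (by positivity)]
  nlinarith [abs_nonneg (u - 1)]

/-- The inverse of the sketched Gram matrix `W` of the orthonormal columns. -/
structure InvBounds (W J : Matrix (Fin p) (Fin p) ℝ) (r : ℝ) : Prop where
  inv_mul : J * W = 1
  mul_inv : W * J = 1
  sub_one : ‖J - 1‖ ≤ 2 * r
  norm_le : ‖J‖ ≤ √p + 1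

theorem invBounds {W : Matrix (Fin p) (Fin p) ℝ} {r : ℝ} (h : ‖W - 1‖ ≤ r) (hr : r ≤ 1 / 2) :
    InvBounds W W⁻¹ r := by
  have hu : IsUnit W.det := (isUnit_iff_isUnit_det W).1 (isUnit_of_norm_sub_one_lt (by linarith))
  have h1 : ‖W⁻¹ - 1‖ ≤ 2 * r := (norm_inv_sub_one_le (h.trans hr)).trans (by linarith)
  refine ⟨nonsing_inv_mul _ hu, mul_nonsing_inv _ hu, h1, ?_⟩
  have h2 := norm_add_le (W⁻¹ - 1) 1
  rw [sub_add_cancel, frobenius_one] at h2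
  linarith

/-- Sketched least squares reproduces the fitted part of `y` exactly, so only the residual
contributes. As `Uᵀ ε = 0`, its contribution `Uᵀ Sᵀ S ε` equals `crossErr` and is of first order in
the sketching error. -/
theorem sketchSolve_sub_lsCoef (hU : Uᵀ * U = 1) (hA : WellCond A a κ)
    (S : Matrix (Fin N) (Fin n) ℝ)
    (hW' : (Uᵀ * (Sᵀ * S) * U)⁻¹ * (Uᵀ * (Sᵀ * S) * U) = 1) (y : Fin n → ℝ) :
    sketchSolve S (U * A) y - lsCoef (U * A) y =
      A⁻¹ *ᵥ ((Uᵀ * (Sᵀ * S) * U)⁻¹ *ᵥ crossErr S U (lsResidual (U * A) y)) := by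
  set W := Uᵀ * (Sᵀ * S) * U with hWdef
  have hy : y = lsFitted (U * A) y + lsResidual (U * A) y := by rw [lsResidual]; abel
  have hg : crossErr S U (lsResidual (U * A) y) = (Uᵀ * (Sᵀ * S)) *ᵥ lsResidual (U * A) y := by
    rw [one_add_gramErr, crossErr, Matrix.mul_add, Matrix.mul_one, add_mulVec,
      transpose_mulVec_lsResidual hU hA, zero_add, mulVec_mulVec]
  have h1 : (S * (U * A))ᵀ *ᵥ (S *ᵥ y) =
      (A * W * A) *ᵥ lsCoef (U * A) y + A *ᵥ crossErr S U (lsResidual (U * A) y) := by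
    rw [hg]
    conv_lhs => rw [hy]
    rw [lsFitted, mulVec_add, mulVec_add]
    congr 1
    · simp only [mulVec_mulVec, transpose_mul, hA.symm, hWdef, Matrix.mul_assoc]
    · simp only [mulVec_mulVec, transpose_mul, hA.symm, Matrix.mul_assoc]
  have hinv : (A * W * A)⁻¹ = A⁻¹ * W⁻¹ * A⁻¹ := by
    rw [Matrix.mul_inv_rev, Matrix.mul_inv_rev, Matrix.mul_assoc]
  have hAA := nonsing_inv_mul _ hA.isUnit_det
  rw [sketchSolve, sketched_gram_eq hA.symm, ← hWdef, h1, hinv, mulVec_add]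
  have e1 : A⁻¹ * W⁻¹ * A⁻¹ * (A * W * A) = 1 := by
    calc _ = A⁻¹ * (W⁻¹ * ((A⁻¹ * A) * W)) * A := by simp only [Matrix.mul_assoc]
      _ = 1 := by rw [hAA, Matrix.one_mul, hW', Matrix.mul_one, hAA]
  have e2 : A⁻¹ * W⁻¹ * A⁻¹ * A = A⁻¹ * W⁻¹ := by
    rw [Matrix.mul_assoc, hAA, Matrix.mul_one]
  rw [mulVec_mulVec, mulVec_mulVec, e1, e2, one_mulVec, add_sub_cancel_left, mulVec_mulVec]

/-- Pythagoras: the sketched residual is `S ε` minus its projection onto the range of `S U`, and the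
last term is the squared norm of that projection. -/
theorem euclNorm_sketchResidual_sq (hU : Uᵀ * U = 1) (hA : WellCond A a κ)
    (S : Matrix (Fin N) (Fin n) ℝ) (hW : Uᵀ * (Sᵀ * S) * U * (Uᵀ * (Sᵀ * S) * U)⁻¹ = 1)
    (hW' : (Uᵀ * (Sᵀ * S) * U)⁻¹ * (Uᵀ * (Sᵀ * S) * U) = 1) (y : Fin n → ℝ) :
    euclNorm (sketchResidual S (U * A) y) ^ 2 =
      euclNorm (lsResidual (U * A) y) ^ 2 +
        lsResidual (U * A) y ⬝ᵥ (gramErr S *ᵥ lsResidual (U * A) y) -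
        crossErr S U (lsResidual (U * A) y) ⬝ᵥ
          ((Uᵀ * (Sᵀ * S) * U)⁻¹ *ᵥ crossErr S U (lsResidual (U * A) y)) := by
  have hb := sketchSolve_sub_lsCoef hU hA S hW' y
  have hg : crossErr S U (lsResidual (U * A) y) = Uᵀ *ᵥ (Sᵀ *ᵥ (S *ᵥ lsResidual (U * A) y)) := by
    rw [mulVec_mulVec _ Sᵀ, one_add_gramErr, crossErr, add_mulVec, one_mulVec, mulVec_add,
      transpose_mulVec_lsResidual hU hA, zero_add]
  set W := Uᵀ * (Sᵀ * S) * U with hWdef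
  set ε := lsResidual (U * A) y with hε
  set g := crossErr S U ε
  set h := W⁻¹ *ᵥ g with hh
  have hWh : Uᵀ *ᵥ (Sᵀ *ᵥ (S *ᵥ (U *ᵥ h))) = g := by
    have : W *ᵥ h = g := by rw [hh, mulVec_mulVec, hW, one_mulVec]
    rw [← this, hWdef]
    simp only [mulVec_mulVec, Matrix.mul_assoc]
  have h1 : sketchResidual S (U * A) y = S *ᵥ ε - S *ᵥ (U *ᵥ h) := by
    have e : sketchSolve S (U * A) y = lsCoef (U * A) y + A⁻¹ *ᵥ h := by rw [← hb]; abel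
    rw [sketchResidual, e, mulVec_add, hε, lsResidual, lsFitted, mulVec_sub]
    have e2 : (S * (U * A)) *ᵥ (A⁻¹ *ᵥ h) = S *ᵥ (U *ᵥ h) := by
      rw [← mulVec_mulVec, ← mulVec_mulVec, mulVec_mulVec _ A, mul_nonsing_inv _ hA.isUnit_det,
        one_mulVec]
    rw [e2, ← mulVec_mulVec]
    abel
  have adj : ∀ (x : Fin n → ℝ) (k : Fin p → ℝ), (S *ᵥ x) ⬝ᵥ (S *ᵥ (U *ᵥ k)) =
      (Uᵀ *ᵥ (Sᵀ *ᵥ (S *ᵥ x))) ⬝ᵥ k := by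
    intro x k
    rw [dotProduct_mulVec, ← mulVec_transpose, dotProduct_mulVec, ← mulVec_transpose]
  have h2 : (S *ᵥ ε) ⬝ᵥ (S *ᵥ ε) = euclNorm ε ^ 2 + ε ⬝ᵥ (gramErr S *ᵥ ε) := by
    rw [dotProduct_comm, dotProduct_mulVec, ← mulVec_transpose, mulVec_mulVec, one_add_gramErr,
      add_mulVec, one_mulVec, add_dotProduct, dotProduct_self_eq, dotProduct_comm (gramErr S *ᵥ ε)]
  rw [← dotProduct_self_eq, h1, sub_dotProduct, dotProduct_sub, dotProduct_sub, h2, adj, adj,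
    ← hg, dotProduct_comm (S *ᵥ (U *ᵥ h)), adj, hWh, ← hg]
  ring

/-- The studentized sketch-and-solve estimator is linear in the sketching error up to a quadratic
remainder. -/
theorem exists_sketchSolve_expansion (p : ℕ) {κ : ℝ} (hκ : 0 < κ) :
    ∃ C δ : ℝ, 0 ≤ C ∧ 0 < δ ∧ ∀ {n N : ℕ} {U : Matrix (Fin n) (Fin p) ℝ}
      {A : Matrix (Fin p) (Fin p) ℝ} {a : ℝ} (S : Matrix (Fin N) (Fin n) ℝ) (y v : Fin n → ℝ)
      {c : ℝ}, Uᵀ * U = 1 → WellCond A a κ → lsResidual (U * A) y ≠ 0 →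
      v = (euclNorm (lsResidual (U * A) y))⁻¹ • lsResidual (U * A) y → 0 ≤ c →
      errSq S U v ≤ δ ^ 2 →
      euclNorm ((studentizedSketchSolve c S (U * A) y).ofLp - c • crossErr S U v) ≤
        C * c * errSq S U v := by
  set P := √(p : ℝ) with hP
  have hP0 : 0 ≤ P := Real.sqrt_nonneg _
  set C₁ := κ ^ 3 * (P + 1) + 2 with hC₁
  have hC₁0 : 0 ≤ C₁ := by positivity
  -- The first constant adds the error of the scalar normalization, times the bound `P + C₁` on
  -- `‖M‖`, to the error `C₁` of the matrix factor `M`. The second ensures `(P + 2) Δ ≤ 1 / 2`, the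
  -- range in which the inverse of `W` and the inverse square root of `u` obey Lipschitz bounds with
  -- constant 2.
  refine ⟨2 * (P + 2) * (P + C₁) + C₁, 1 / (2 * (P + 2)), by positivity, by positivity, ?_⟩
  intro n N U A a S y v c hU hA hε hv hc herr
  set ε := lsResidual (U * A) y with hεdef
  set e := euclNorm ε with he
  have he0 : 0 < e := euclNorm_pos hε
  set Δ := √(errSq S U v) with hΔ
  have hΔ0 : 0 ≤ Δ := Real.sqrt_nonneg _
  have hΔ2 : Δ ^ 2 = errSq S U v := Real.sq_sqrt (errSq_nonneg _ _ _)
  have hΔδ : Δ ≤ 1 / (2 * (P + 2)) := by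
    rw [hΔ]; exact (Real.sqrt_le_left (by positivity)).2 herr
  have hΔP : (P + 2) * Δ ≤ 1 / 2 := by
    rw [le_div_iff₀ (by positivity)] at hΔδ; linarith
  have hΔ1 : Δ ≤ 1 / 2 := by nlinarith
  have hD : ‖Uᵀ * (Sᵀ * S) * U - 1‖ ≤ Δ := by
    rw [sketched_inner_eq hU]
    refine Real.le_sqrt_of_sq_le ?_
    unfold errSq
    nlinarith [sq_nonneg (euclNorm (crossErr S U v)), sq_nonneg (v ⬝ᵥ (gramErr S *ᵥ v))]
  have hζ : euclNorm (crossErr S U v) ≤ Δ := by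
    refine Real.le_sqrt_of_sq_le ?_
    unfold errSq
    nlinarith [sq_nonneg ‖Uᵀ * gramErr S * U‖, sq_nonneg (v ⬝ᵥ (gramErr S *ᵥ v))]
  have hq : |v ⬝ᵥ (gramErr S *ᵥ v)| ≤ Δ := by
    refine Real.le_sqrt_of_sq_le ?_
    rw [sq_abs]
    unfold errSq
    nlinarith [sq_nonneg ‖Uᵀ * gramErr S * U‖, sq_nonneg (euclNorm (crossErr S U v))]
  have hJ := invBounds hD hΔ1
  have hsolve := sketchSolve_sub_lsCoef hU hA S hJ.inv_mul y
  have hres := euclNorm_sketchResidual_sq hU hA S hJ.mul_inv hJ.inv_mul y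
  have hsq := hA.norm_sqrt_mul_inv_sub_one_le (sketched_inner_posSemidef (U := U) S)
  have hεv : ε = e • v := by rw [hv, smul_smul, mul_inv_cancel₀ he0.ne', one_smul]
  have hgζ : crossErr S U ε = e • crossErr S U v := by
    conv_lhs => rw [hεv]
    simp only [crossErr, mulVec_smul]
  rw [← hεdef] at hsolve hres
  set W := Uᵀ * (Sᵀ * S) * U with hW
  set J := W⁻¹ with hJdef
  set ζ := crossErr S U v with hζdef
  set q := v ⬝ᵥ (gramErr S *ᵥ v) with hqdef
  -- This is the squared norm of the sketched residual relative to that of the true residual.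
  set u := 1 + q - ζ ⬝ᵥ (J *ᵥ ζ) with hu
  have hquad : |ζ ⬝ᵥ (J *ᵥ ζ)| ≤ (P + 1) * Δ := by
    calc _ ≤ euclNorm ζ * euclNorm (J *ᵥ ζ) := abs_dotProduct_le _ _
      _ ≤ Δ * ((P + 1) * Δ) := by
          gcongr
          · exact euclNorm_nonneg _
          · exact (euclNorm_mulVec_le _ _).trans
              (mul_le_mul hJ.norm_le hζ (euclNorm_nonneg _) (by positivity))
      _ ≤ 1 * ((P + 1) * Δ) := by gcongr; linarith
      _ = _ := one_mul _
  have hu1 : |u - 1| ≤ (P + 2) * Δ := by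
    have : u - 1 = q - ζ ⬝ᵥ (J *ᵥ ζ) := by rw [hu]; ring
    rw [this]
    refine (abs_sub _ _).trans ?_
    linarith
  have hres' : euclNorm (sketchResidual S (U * A) y) = e * √u := by
    have h1 : euclNorm (sketchResidual S (U * A) y) ^ 2 = e ^ 2 * u := by
      rw [hres, hgζ]
      conv_lhs => rw [hεv]
      simp only [mulVec_smul, smul_dotProduct, dotProduct_smul, smul_eq_mul, ← hqdef]
      rw [euclNorm_smul, abs_of_pos he0]
      have : euclNorm v = 1 := by
        rw [hv, euclNorm_smul, abs_of_pos (inv_pos.2 he0), inv_mul_cancel₀ he0.ne']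
      rw [this, hu]
      ring
    rw [← Real.sqrt_sq (euclNorm_nonneg (sketchResidual S (U * A) y)), h1,
      Real.sqrt_mul (sq_nonneg _), Real.sqrt_sq he0.le]
  have hr := (abs_inv_sqrt_sub_one_le (hu1.trans hΔP)).trans
    (mul_le_mul_of_nonneg_left hu1 (by norm_num))
  -- The studentized estimator is `c (√u)⁻¹ M ζ`. Since the root of `A W A` is close to `A` and `J`
  -- is close to the identity, `M` is close to the identity, and no rotation survives in the linear
  -- term.
  set M := matSqrt (A * W * A) * A⁻¹ * J with hM
  have hM1 : ‖M - 1‖ ≤ C₁ * Δ := by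
    have e1 : M - 1 = (matSqrt (A * W * A) * A⁻¹ - 1) * J + (J - 1) := by rw [hM]; noncomm_ring
    rw [e1]
    calc _ ≤ ‖(matSqrt (A * W * A) * A⁻¹ - 1)‖ * ‖J‖ + ‖J - 1‖ :=
          (norm_add_le _ _).trans (add_le_add (norm_mul_le _ _) le_rfl)
      _ ≤ (κ ^ 3 * Δ) * (P + 1) + 2 * Δ := by
          refine add_le_add (mul_le_mul (hsq.trans (by gcongr)) hJ.norm_le (norm_nonneg _)
            (by positivity)) hJ.sub_one
      _ = _ := by rw [hC₁]; ring
  have hMn : ‖M‖ ≤ P + C₁ := by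
    have h2 := norm_add_le (M - 1) 1
    rw [sub_add_cancel, frobenius_one] at h2
    nlinarith
  have key : (studentizedSketchSolve c S (U * A) y).ofLp - c • ζ =
      c • (((√u)⁻¹ • M - 1) *ᵥ ζ) := by
    rw [studentizedSketchSolve, sketched_gram_eq hA.symm, hsolve, hres', hgζ]
    rw [sub_mulVec, one_mulVec, smul_sub]
    congr 1
    rw [mulVec_smul, mulVec_smul, mulVec_smul, smul_smul, smul_mulVec, smul_smul, hM, mulVec_mulVec,
      mulVec_mulVec, mul_inv]
    congr 1
    field_simp
    rfl
  rw [key, euclNorm_smul, abs_of_nonneg hc]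
  have hfin : ‖(√u)⁻¹ • M - 1‖ ≤ (2 * (P + 2) * (P + C₁) + C₁) * Δ := by
    have e1 : (√u)⁻¹ • M - 1 = ((√u)⁻¹ - 1) • M + (M - 1) := by rw [sub_smul, one_smul]; abel
    rw [e1]
    calc _ ≤ |(√u)⁻¹ - 1| * ‖M‖ + ‖M - 1‖ := by
          refine (norm_add_le _ _).trans (add_le_add ?_ le_rfl)
          rw [norm_smul, Real.norm_eq_abs]
      _ ≤ (2 * ((P + 2) * Δ)) * (P + C₁) + C₁ * Δ := by gcongr
      _ = _ := by ring
  calc _ ≤ c * (((2 * (P + 2) * (P + C₁) + C₁) * Δ) * Δ) := by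
        refine mul_le_mul_of_nonneg_left ((euclNorm_mulVec_le _ _).trans ?_) hc
        exact mul_le_mul hfin hζ (euclNorm_nonneg _) (by positivity)
    _ = _ := by rw [← hΔ2]; ring

end Expansion

/-! ### Linearization of the partial sketching estimator -/

section PartialExpansion

open scoped Matrix.Norms.Frobenius

variable {p n N : ℕ} {U : Matrix (Fin n) (Fin p) ℝ} {A : Matrix (Fin p) (Fin p) ℝ} {a κ : ℝ}

theorem one_add_vecMulVec_sub_one_posSemidef (θ : Fin p → ℝ) :
    ((1 + (2 : ℝ) • vecMulVec θ θ) - 1 : Matrix (Fin p) (Fin p) ℝ).PosSemidef := by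
  rw [add_sub_cancel_left]
  exact (posSemidef_vecMulVec_self_star θ).smul zero_le_two

theorem partialSketch_eq (hA : WellCond A a κ) (S : Matrix (Fin N) (Fin n) ℝ)
    (y : Fin n → ℝ) :
    partialSketch S (U * A) y = A⁻¹ *ᵥ ((Uᵀ * (Sᵀ * S) * U)⁻¹ *ᵥ (Uᵀ *ᵥ y)) := by
  rw [partialSketch, sketched_gram_eq hA.symm, Matrix.mul_inv_rev, Matrix.mul_inv_rev,
    transpose_mul, hA.symm]
  simp only [mulVec_mulVec, ← Matrix.mul_assoc]
  rw [Matrix.mul_assoc _ A⁻¹ A, nonsing_inv_mul _ hA.isUnit_det, Matrix.mul_one]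

/-- The covariance matrix which enters the studentization of the partial sketching estimator. -/
noncomputable def partialCov (J : Matrix (Fin p) (Fin p) ℝ) (θ : Fin p → ℝ) :
    Matrix (Fin p) (Fin p) ℝ :=
  (θ ⬝ᵥ (J *ᵥ θ)) • J + (2 : ℝ) • vecMulVec (J *ᵥ θ) (J *ᵥ θ)

theorem partialCov_posSemidef {J : Matrix (Fin p) (Fin p) ℝ} (hJ : J.PosSemidef) (θ : Fin p → ℝ) :
    (partialCov J θ).PosSemidef :=
  (hJ.smul (hJ.dotProduct_mulVec_nonneg θ)).add
    ((posSemidef_vecMulVec_self_star (J *ᵥ θ)).smul zero_le_two)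

/-- At `J = 1` the two matrices agree, because `θ` is a unit vector. Replacing `J` by the identity
one factor at a time costs `2 (√p + 2) r` in the first term and `4 (√p + 2) r` in the rank-one term.
-/
theorem norm_partialCov_sub_le {W J : Matrix (Fin p) (Fin p) ℝ} {r : ℝ} (hJ : InvBounds W J r)
    {θ : Fin p → ℝ} (hθ : euclNorm θ = 1) :
    ‖partialCov J θ - (1 + (2 : ℝ) • vecMulVec θ θ)‖ ≤ 6 * (√p + 2) * r := by
  set P := √(p : ℝ) with hP
  have hP0 : 0 ≤ P := Real.sqrt_nonneg _
  have hr0 : 0 ≤ r := by linarith [hJ.sub_one, norm_nonneg (J - 1)]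
  have hjθ : euclNorm ((J - 1) *ᵥ θ) ≤ 2 * r := by
    refine (euclNorm_mulVec_le _ _).trans ?_
    rw [hθ, mul_one]; exact hJ.sub_one
  have hJθ : euclNorm (J *ᵥ θ) ≤ P + 1 := by
    refine (euclNorm_mulVec_le _ _).trans ?_
    rw [hθ, mul_one]; exact hJ.norm_le
  have hs : |θ ⬝ᵥ (J *ᵥ θ) - 1| ≤ 2 * r := by
    have : θ ⬝ᵥ (J *ᵥ θ) - 1 = θ ⬝ᵥ ((J - 1) *ᵥ θ) := by
      rw [sub_mulVec, one_mulVec, dotProduct_sub, dotProduct_self_eq, hθ, one_pow]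
    rw [this]
    refine (abs_dotProduct_le _ _).trans ?_
    rw [hθ, one_mul]; exact hjθ
  have e : partialCov J θ - (1 + (2 : ℝ) • vecMulVec θ θ) =
      ((θ ⬝ᵥ (J *ᵥ θ) - 1) • J + (J - 1)) +
        (2 : ℝ) • (vecMulVec ((J - 1) *ᵥ θ) (J *ᵥ θ) + vecMulVec θ ((J - 1) *ᵥ θ)) := by
    have h1 : vecMulVec ((J - 1) *ᵥ θ) (J *ᵥ θ) + vecMulVec θ ((J - 1) *ᵥ θ) =
        vecMulVec (J *ᵥ θ) (J *ᵥ θ) - vecMulVec θ θ := by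
      rw [sub_mulVec, one_mulVec, sub_vecMulVec, vecMulVec_sub]
      abel
    rw [h1, partialCov, sub_smul, one_smul, smul_sub]
    abel
  rw [e]
  calc _ ≤ (|θ ⬝ᵥ (J *ᵥ θ) - 1| * ‖J‖ + ‖J - 1‖) +
        2 * (euclNorm ((J - 1) *ᵥ θ) * euclNorm (J *ᵥ θ) + euclNorm θ * euclNorm ((J - 1) *ᵥ θ)) := by
        refine (norm_add_le _ _).trans (add_le_add ((norm_add_le _ _).trans (add_le_add ?_ le_rfl)) ?_)
        · rw [norm_smul, Real.norm_eq_abs]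
        · rw [norm_smul, Real.norm_eq_abs, abs_two, ← frobenius_vecMulVec, ← frobenius_vecMulVec]
          exact mul_le_mul_of_nonneg_left (norm_add_le _ _) zero_le_two
    _ ≤ (2 * r * (P + 1) + 2 * r) + 2 * (2 * r * (P + 1) + 1 * (2 * r)) := by
        have h1 := hJ.norm_le
        have h2 := hJ.sub_one
        rw [hθ]
        gcongr
        exact euclNorm_nonneg _
    _ = _ := by ring

/-- The studentized partial sketching estimator is linear in the sketching error up to a quadratic
remainder. -/
theorem exists_partialSketch_expansion (p : ℕ) {κ : ℝ} (hκ : 0 < κ) :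
    ∃ C δ : ℝ, 0 ≤ C ∧ 0 < δ ∧ ∀ {n N : ℕ} {U : Matrix (Fin n) (Fin p) ℝ}
      {A : Matrix (Fin p) (Fin p) ℝ} {a : ℝ} (S : Matrix (Fin N) (Fin n) ℝ) (y : Fin n → ℝ)
      (θ : Fin p → ℝ) {c t : ℝ}, Uᵀ * U = 1 → WellCond A a κ → 0 < t → Uᵀ *ᵥ y = t • θ →
      euclNorm θ = 1 → 0 ≤ c → errSq S U (U *ᵥ θ) ≤ δ ^ 2 →
      euclNorm ((studentizedPartialSketch c S (U * A) y).ofLp -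
        c • (-(whitener (t⁻¹ • A) (1 + (2 : ℝ) • vecMulVec θ θ) *ᵥ crossErr S U (U *ᵥ θ)))) ≤
        C * c * errSq S U (U *ᵥ θ) := by
  set P := √(p : ℝ) with hP
  have hP0 : 0 ≤ P := Real.sqrt_nonneg _
  set C₂ := 6 * (P + 2) with hC₂
  have hC₂0 : 0 ≤ C₂ := by positivity
  -- The first constant collects the errors of the whitener and of `J`. In the second, `P κ⁴ C₂ Δ ≤
  -- 1 / 2` is the smallness condition of `norm_whitener_sub_le`, and the added 1 gives `Δ ≤ 1 / 2`
  -- for inverting `W`.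
  refine ⟨2 * p * κ ^ 4 * C₂ * (P + 1) + P * 2, 1 / (2 * (P * κ ^ 4 * C₂ + 1)), by positivity,
    by positivity, ?_⟩
  intro n N U A a S y θ c t hU hA₀ ht hy hθ hc herr
  set v := U *ᵥ θ with hv
  set Δ := √(errSq S U v) with hΔ
  have hΔ0 : 0 ≤ Δ := Real.sqrt_nonneg _
  have hΔ2 : Δ ^ 2 = errSq S U v := Real.sq_sqrt (errSq_nonneg _ _ _)
  have hΔδ : Δ ≤ 1 / (2 * (P * κ ^ 4 * C₂ + 1)) := by
    rw [hΔ]; exact (Real.sqrt_le_left (by positivity)).2 herr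
  have hΔP : (P * κ ^ 4 * C₂ + 1) * Δ ≤ 1 / 2 := by
    rw [le_div_iff₀ (by positivity)] at hΔδ; linarith
  have hPC : 0 ≤ P * κ ^ 4 * C₂ := by positivity
  have hΔ1 : Δ ≤ 1 / 2 := by nlinarith
  have hD : ‖Uᵀ * (Sᵀ * S) * U - 1‖ ≤ Δ := by
    rw [sketched_inner_eq hU]
    refine Real.le_sqrt_of_sq_le ?_
    unfold errSq
    nlinarith [sq_nonneg (euclNorm (crossErr S U v)), sq_nonneg (v ⬝ᵥ (gramErr S *ᵥ v))]
  have hζ : euclNorm (crossErr S U v) ≤ Δ := by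
    refine Real.le_sqrt_of_sq_le ?_
    unfold errSq
    nlinarith [sq_nonneg ‖Uᵀ * gramErr S * U‖, sq_nonneg (v ⬝ᵥ (gramErr S *ᵥ v))]
  have hJ := invBounds hD hΔ1
  have hWpsd : (Uᵀ * (Sᵀ * S) * U).PosSemidef := sketched_inner_posSemidef S
  have hb := partialSketch_eq (U := U) hA₀ S y
  have hζD : crossErr S U v = (Uᵀ * (Sᵀ * S) * U - 1) *ᵥ θ := by
    rw [sketched_inner_eq hU, crossErr, hv]
    simp only [mulVec_mulVec, Matrix.mul_assoc]
  have hSX : ∀ b : Fin p → ℝ, euclNorm ((S * (U * A)) *ᵥ (A⁻¹ *ᵥ b)) ^ 2 =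
      b ⬝ᵥ ((Uᵀ * (Sᵀ * S) * U) *ᵥ b) := by
    intro b
    have e1 : (S * (U * A)) *ᵥ (A⁻¹ *ᵥ b) = S *ᵥ (U *ᵥ b) := by
      rw [← mulVec_mulVec, ← mulVec_mulVec, mulVec_mulVec _ A, mul_nonsing_inv _ hA₀.isUnit_det,
        one_mulVec]
    rw [← dotProduct_self_eq, e1, dotProduct_mulVec, ← mulVec_transpose, dotProduct_mulVec,
      ← mulVec_transpose, dotProduct_comm]
    simp only [mulVec_mulVec, Matrix.mul_assoc]
  have hJpsd : ((Uᵀ * (Sᵀ * S) * U)⁻¹).PosSemidef := hWpsd.inv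
  have hMinv : ((S * (U * A))ᵀ * (S * (U * A)))⁻¹ = A⁻¹ * (Uᵀ * (Sᵀ * S) * U)⁻¹ * A⁻¹ := by
    rw [sketched_gram_eq hA₀.symm, Matrix.mul_inv_rev, Matrix.mul_inv_rev]
    exact (Matrix.mul_assoc _ _ _).symm
  set W := Uᵀ * (Sᵀ * S) * U with hW
  set J := W⁻¹ with hJdef
  set ζ := crossErr S U v with hζdef
  have hA := hA₀.smul (inv_pos.2 ht)
  set B := t⁻¹ • A with hB
  have hBinv : B⁻¹ = t • A⁻¹ := by
    rw [hB, inv_smul_of_pos (inv_pos.2 ht) hA₀.isUnit_det, inv_inv]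
  have hb' : partialSketch S (U * A) y = B⁻¹ *ᵥ (J *ᵥ θ) := by
    rw [hb, hy, hBinv, mulVec_smul, mulVec_smul, smul_mulVec]
  -- As `ζ = (W - 1) θ`, the resolvent identity `J - 1 = -J (W - 1)` expresses the estimation error
  -- exactly through `ζ`. This is the origin of the minus sign before the whitener.
  have hdiff : partialSketch S (U * A) y - lsCoef (U * A) y = -(B⁻¹ *ᵥ (J *ᵥ ζ)) := by
    have h1 : lsCoef (U * A) y = B⁻¹ *ᵥ θ := by
      rw [lsCoef_eq hU hA₀, hy, hBinv, mulVec_smul, smul_mulVec]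
    have h2 : J *ᵥ ζ = θ - J *ᵥ θ := by
      rw [hζD, mulVec_mulVec, Matrix.mul_sub, hJ.inv_mul, Matrix.mul_one, sub_mulVec, one_mulVec]
    rw [hb', h1, h2, mulVec_sub]
    abel
  have hK : euclNorm ((S * (U * A)) *ᵥ partialSketch S (U * A) y) ^ 2 •
      ((S * (U * A))ᵀ * (S * (U * A)))⁻¹ +
      (2 : ℝ) • vecMulVec (partialSketch S (U * A) y) (partialSketch S (U * A) y) =
      B⁻¹ * partialCov J θ * B⁻¹ := by
    have h1 : euclNorm ((S * (U * A)) *ᵥ partialSketch S (U * A) y) ^ 2 =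
        t ^ 2 * (θ ⬝ᵥ (J *ᵥ θ)) := by
      have h2 : partialSketch S (U * A) y = t • (A⁻¹ *ᵥ (J *ᵥ θ)) := by
        rw [hb', hBinv, smul_mulVec]
      rw [h2, mulVec_smul, euclNorm_smul, mul_pow, sq_abs, hSX, mulVec_mulVec, hJ.mul_inv,
        one_mulVec, dotProduct_comm]
    have h3 : vecMulVec (B⁻¹ *ᵥ (J *ᵥ θ)) (B⁻¹ *ᵥ (J *ᵥ θ)) =
        B⁻¹ * vecMulVec (J *ᵥ θ) (J *ᵥ θ) * B⁻¹ := by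
      rw [mul_vecMulVec, vecMulVec_mul, ← mulVec_transpose, hA.inv_symm]
    rw [h1, hMinv, hb', h3, partialCov, Matrix.mul_add, Matrix.add_mul, Matrix.mul_smul,
      Matrix.smul_mul, Matrix.mul_smul, Matrix.smul_mul]
    congr 1
    rw [hBinv]
    simp only [Matrix.smul_mul, Matrix.mul_smul, smul_smul]
    congr 1
    ring
  set G₀ : Matrix (Fin p) (Fin p) ℝ := 1 + (2 : ℝ) • vecMulVec θ θ with hG₀
  have hG₀psd : (G₀ - 1).PosSemidef := one_add_vecMulVec_sub_one_posSemidef θ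
  have hGG := norm_partialCov_sub_le hJ hθ
  rw [← hG₀, ← hP, ← hC₂] at hGG
  have hwh := hA.norm_whitener_sub_le (partialCov_posSemidef hJpsd θ) hG₀psd (by
    calc _ ≤ P * κ ^ 4 * (C₂ * Δ) := by gcongr
      _ = P * κ ^ 4 * C₂ * Δ := by ring
      _ ≤ 1 / 2 := by linarith)
  have hR := hA.norm_whitener_le hG₀psd
  set R := whitener B G₀ with hRdef
  set G := partialCov J θ with hG
  have key : (studentizedPartialSketch c S (U * A) y).ofLp - c • (-(R *ᵥ ζ)) =
      -(c • ((whitener B G * J - R) *ᵥ ζ)) := by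
    rw [studentizedPartialSketch, hK, hdiff, sub_mulVec, smul_sub, ← mulVec_mulVec, whitener,
      ← mulVec_mulVec]
    simp only [mulVec_neg, smul_neg]
    abel
  have hfin : ‖whitener B G * J - R‖ ≤ (2 * p * κ ^ 4 * C₂ * (P + 1) + P * 2) * Δ := by
    have e1 : whitener B G * J - R = (whitener B G - R) * J + R * (J - 1) := by noncomm_ring
    rw [e1]
    calc _ ≤ ‖whitener B G - R‖ * ‖J‖ + ‖R‖ * ‖J - 1‖ :=
          (norm_add_le _ _).trans (add_le_add (norm_mul_le _ _) (norm_mul_le _ _))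
      _ ≤ (2 * p * κ ^ 4 * (C₂ * Δ)) * (P + 1) + P * (2 * Δ) := by
          refine add_le_add (mul_le_mul (hwh.trans ?_) hJ.norm_le (norm_nonneg _) (by positivity))
            (mul_le_mul hR hJ.sub_one (norm_nonneg _) hP0)
          gcongr
      _ = _ := by ring
  have hneg : ∀ x : Fin p → ℝ, euclNorm (-x) = euclNorm x := fun x => by
    rw [← neg_one_smul ℝ x, euclNorm_smul]; simp
  rw [key, hneg, euclNorm_smul, abs_of_nonneg hc]
  calc _ ≤ c * (((2 * p * κ ^ 4 * C₂ * (P + 1) + P * 2) * Δ) * Δ) := by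
        refine mul_le_mul_of_nonneg_left ((euclNorm_mulVec_le _ _).trans ?_) hc
        exact mul_le_mul hfin hζ (euclNorm_nonneg _) (by positivity)
    _ = _ := by rw [← hΔ2]; ring

end PartialExpansion

/-! ### The SRHT sketch as a function of independent coins -/

section Pad

variable {n : ℕ}

theorem le_padSize (n : ℕ) : n ≤ padSize n := Nat.le_pow_clog (by norm_num) n

theorem padMatrix_mulVec_castLE (w : Fin n → ℝ) (j : Fin n) :
    (padMatrix n *ᵥ w) (Fin.castLE (le_padSize n) j) = w j := by
  simp [padMatrix, mulVec, dotProduct, Fin.val_inj]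

theorem padMatrix_mulVec_of_le (w : Fin n → ℝ) (j : Fin (padSize n)) (h : n ≤ j) :
    (padMatrix n *ᵥ w) j = 0 := by
  simp only [padMatrix, mulVec, dotProduct, of_apply]
  refine Finset.sum_eq_zero fun i _ => ?_
  rw [if_neg (by have := i.2; omega), zero_mul]

theorem abs_padMatrix_mulVec_le {w : Fin n → ℝ} {ρ : ℝ} (hρ : 0 ≤ ρ) (hw : ∀ j, |w j| ≤ ρ)
    (j : Fin (padSize n)) : |(padMatrix n *ᵥ w) j| ≤ ρ := by
  rcases lt_or_ge (j : ℕ) n with h | h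
  · have := padMatrix_mulVec_castLE w ⟨j, h⟩
    have e : Fin.castLE (le_padSize n) ⟨j, h⟩ = j := rfl
    rw [e] at this
    rw [this]; exact hw _
  · rw [padMatrix_mulVec_of_le w j h, abs_zero]; exact hρ

theorem padMatrix_transpose_mul (n : ℕ) : (padMatrix n)ᵀ * padMatrix n = 1 := by
  ext i j
  rw [mul_apply, Finset.sum_eq_single (Fin.castLE (le_padSize n) i)]
  · simp [padMatrix, one_apply, Fin.ext_iff]
  · intro k _ hk
    have : (k : ℕ) ≠ i := fun h => hk (Fin.ext h)
    simp [padMatrix, this]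
  · simp

theorem padMatrix_dotProduct (w v : Fin n → ℝ) :
    (padMatrix n *ᵥ w) ⬝ᵥ (padMatrix n *ᵥ v) = w ⬝ᵥ v := by
  rw [dotProduct_mulVec, ← mulVec_transpose, mulVec_mulVec, padMatrix_transpose_mul, one_mulVec]

theorem sum_padMatrix_mulVec_sq (w : Fin n → ℝ) :
    ∑ j, (padMatrix n *ᵥ w) j ^ 2 = euclNorm w ^ 2 := by
  rw [← euclNorm_sq, ← dotProduct_self_eq, padMatrix_dotProduct, dotProduct_self_eq]

end Pad

/-- The sign system of the Hadamard matrix for sample size `n`. -/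
noncomputable def hadSigns (n : ℕ) (j i : Fin (padSize n)) : ℝ :=
  √(2 ^ padExp n) * hadamardMatrix (padExp n) i j

theorem isWalsh_hadSigns (n : ℕ) : IsWalsh (hadSigns n) := isWalsh_hadamard (padExp n)

/-- The indicator encoded by a Boolean. -/
def ind (b : Bool) : ℝ := if b then 1 else 0

/-- The SRHT matrix with sampling indicators `b` and signs `x`. -/
noncomputable def srhtOf (m n : ℕ) (b x : Fin (padSize n) → Bool) :
    Matrix (Fin (padSize n)) (Fin n) ℝ :=
  srhtMatrix m n (fun i => ind (b i)) (fun i => sgn (x i))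

theorem srhtOf_mulVec (m n : ℕ) (b x : Fin (padSize n) → Bool) (w : Fin n → ℝ)
    (i : Fin (padSize n)) :
    (srhtOf m n b x *ᵥ w) i = √((padSize n : ℝ) / m) * (ind (b i) *
      ((√(2 ^ padExp n))⁻¹ * walshT (hadSigns n) (padMatrix n *ᵥ w) x i)) := by
  have h0 : (√(2 ^ padExp n) : ℝ) ≠ 0 := by positivity
  rw [srhtOf, srhtMatrix, smul_mulVec, Pi.smul_apply, smul_eq_mul, ← mulVec_mulVec,
    ← mulVec_mulVec, ← mulVec_mulVec, mulVec_diagonal]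
  congr 2
  rw [walshT, Finset.mul_sum, mulVec, dotProduct]
  refine Finset.sum_congr rfl fun j _ => ?_
  rw [mulVec_diagonal, hadSigns]
  field_simp

/-- Parseval's identity, valid for each realization of the signs: without sampling the transform is
exact, so the sketching error involves only the centered sampling indicators. -/
theorem sum_walshT_mul {ι : Type*} [Fintype ι] [DecidableEq ι] {χ : ι → ι → ℝ} (hχ : IsWalsh χ)
    (w v : ι → ℝ) (x : ι → Bool) :
    ∑ i, walshT χ w x i * walshT χ v x i = Fintype.card ι * ∑ j, w j * v j := by
  have h1 : ∀ i, walshT χ w x i * walshT χ v x i =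
      ∑ j, ∑ k, (w j * sgn (x j) * (v k * sgn (x k))) * (χ j i * χ k i) := by
    intro i
    rw [walshT, walshT, Finset.sum_mul_sum]
    exact Finset.sum_congr rfl fun j _ => Finset.sum_congr rfl fun k _ => by ring
  simp_rw [h1]
  rw [Finset.sum_comm, Finset.mul_sum]
  refine Finset.sum_congr rfl fun j _ => ?_
  rw [Finset.sum_comm]
  simp_rw [← Finset.mul_sum, hχ.orth]
  simp only [mul_ite, mul_zero, Finset.sum_ite_eq, Finset.mem_univ, if_true]
  linear_combination Fintype.card ι * w j * v j * sgn_mul_self (x j)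

/-- The sketching error is a bilinear form in the coins. -/
theorem dotProduct_gramErr_srhtOf {m n : ℕ} (hm : 0 < m) (b x : Fin (padSize n) → Bool)
    (w v : Fin n → ℝ) :
    w ⬝ᵥ (gramErr (srhtOf m n b x) *ᵥ v) =
      sketchErr (hadSigns n) (samplingFraction m n) (padMatrix n *ᵥ w) (padMatrix n *ᵥ v) b x := by
  have hm' : (0 : ℝ) < m := by exact_mod_cast hm
  rw [gramErr, sub_mulVec, one_mulVec, dotProduct_sub, ← mulVec_mulVec, dotProduct_mulVec,
    vecMul_transpose, ← padMatrix_dotProduct w v]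
  have hP := sum_walshT_mul (isWalsh_hadSigns n) (padMatrix n *ᵥ w) (padMatrix n *ᵥ v) x
  have hN : (0 : ℝ) < (2 : ℝ) ^ padExp n := by positivity
  have hcard : (Fintype.card (Fin (padSize n)) : ℝ) = 2 ^ padExp n := by simp [padSize]
  rw [sketchErr]
  rw [hcard] at hP ⊢
  have e2 : (padMatrix n *ᵥ w) ⬝ᵥ (padMatrix n *ᵥ v) =
      ∑ i, walshT (hadSigns n) (padMatrix n *ᵥ w) x i * walshT (hadSigns n) (padMatrix n *ᵥ v) x i /
        2 ^ padExp n := by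
    rw [← Finset.sum_div, hP, mul_div_cancel_left₀ _ hN.ne', dotProduct]
  rw [e2, dotProduct, ← Finset.sum_sub_distrib]
  refine Finset.sum_congr rfl fun i _ => ?_
  rw [srhtOf_mulVec, srhtOf_mulVec, ctr, samplingFraction]
  have h1 : √((padSize n : ℝ) / m) * √((padSize n : ℝ) / m) = 2 ^ padExp n / m := by
    rw [Real.mul_self_sqrt (by positivity)]; simp [padSize]
  have h2 : (√(2 ^ padExp n))⁻¹ * (√(2 ^ padExp n))⁻¹ = ((2 : ℝ) ^ padExp n)⁻¹ := by
    rw [← mul_inv, Real.mul_self_sqrt hN.le]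
  have h3 : ind (b i) * ind (b i) = if b i then 1 else 0 := by
    cases b i <;> simp [ind]
  have hpad : (padSize n : ℝ) = 2 ^ padExp n := by simp [padSize]
  generalize walshT (hadSigns n) (padMatrix n *ᵥ w) x i = α
  generalize walshT (hadSigns n) (padMatrix n *ᵥ v) x i = β
  calc _ = (√((padSize n : ℝ) / m) * √((padSize n : ℝ) / m)) * (ind (b i) * ind (b i)) *
        ((√(2 ^ padExp n))⁻¹ * (√(2 ^ padExp n))⁻¹) * (α * β) - α * β / 2 ^ padExp n := by ring
    _ = _ := by
      rw [h1, h2, h3, hpad]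
      field_simp

/-! ### The law of the SRHT matrix -/

section Law

variable {Ω : Type*} [MeasurableSpace Ω] {P : Measure Ω} [IsProbabilityMeasure P] {m n : ℕ}
  {S : Ω → Matrix (Fin (padSize n)) (Fin n) ℝ}

theorem measurable_decide_eq_one : Measurable fun r : ℝ => decide (r = 1) := by
  refine measurable_to_bool ?_
  convert! measurableSet_singleton (1 : ℝ)
  ext; simp

theorem bernoulliLaw_map (q : ℝ) :
    (bernoulliLaw q).map (fun r : ℝ => decide (r = 1)) = coinLaw q := by
  rw [bernoulliLaw, Measure.map_add _ _ measurable_decide_eq_one, Measure.map_smul,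
    Measure.map_smul, Measure.map_dirac' measurable_decide_eq_one,
    Measure.map_dirac' measurable_decide_eq_one, coinLaw]
  simp

theorem rademacherLaw_map :
    rademacherLaw.map (fun r : ℝ => decide (r = 1)) = coinLaw 2⁻¹ := by
  rw [rademacherLaw, Measure.map_add _ _ measurable_decide_eq_one, Measure.map_smul,
    Measure.map_smul, Measure.map_dirac' measurable_decide_eq_one,
    Measure.map_dirac' measurable_decide_eq_one, coinLaw,
    show (1 : ℝ) - 2⁻¹ = 2⁻¹ by norm_num, ENNReal.ofReal_inv_of_pos two_pos]
  norm_num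

theorem ae_eq_ind {B : Ω → ℝ} {q : ℝ} (h : HasLaw B (bernoulliLaw q) P) :
    ∀ᵐ ω ∂P, B ω = ind (decide (B ω = 1)) := by
  have h1 : ∀ᵐ r ∂(P.map B), r = ind (decide (r = 1)) := by
    rw [h.map_eq, bernoulliLaw, ae_add_measure_iff]
    constructor <;> refine Measure.ae_smul_measure ?_ _ <;> rw [ae_dirac_eq] <;> simp [ind]
  exact ae_of_ae_map h.aemeasurable h1

theorem ae_eq_sgn {D : Ω → ℝ} (h : HasLaw D rademacherLaw P) :
    ∀ᵐ ω ∂P, D ω = sgn (decide (D ω = 1)) := by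
  have h1 : ∀ᵐ r ∂(P.map D), r = sgn (decide (r = 1)) := by
    rw [h.map_eq, rademacherLaw, ae_add_measure_iff]
    constructor <;> refine Measure.ae_smul_measure ?_ _ <;> rw [ae_dirac_eq] <;> norm_num [sgn]
  exact ae_of_ae_map h.aemeasurable h1

/-- An SRHT matrix is almost surely the SRHT matrix of independent coins. -/
theorem IsSRHT.exists_coins (hS : IsSRHT P m n S) :
    ∃ φ : Ω → (Fin (padSize n) → Bool) × (Fin (padSize n) → Bool), AEMeasurable φ P ∧
      P.map φ = (coins (Fin (padSize n)) (samplingFraction m n)).prod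
        (coins (Fin (padSize n)) 2⁻¹) ∧
      ∀ᵐ ω ∂P, S ω = srhtOf m n (φ ω).1 (φ ω).2 := by
  obtain ⟨B, D, hind, hB, hD, hSeq⟩ := hS
  -- The entries of `B` and `D` take their two values only almost surely. Testing for the value 1,
  -- which is in both supports, yields genuine coins everywhere.
  let g : ℝ → Bool := fun r => decide (r = 1)
  have hg : Measurable g := measurable_decide_eq_one
  let Z : Fin (padSize n) ⊕ Fin (padSize n) → Ω → Bool := fun i ω => g (Sum.elim B D i ω)
  have hae : ∀ i, AEMeasurable (Sum.elim B D i) P := by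
    rintro (i | i)
    · exact (hB i).aemeasurable
    · exact (hD i).aemeasurable
  have hZae : ∀ i, AEMeasurable (Z i) P := fun i => hg.comp_aemeasurable (hae i)
  have hZind : iIndepFun Z P := hind.comp (fun _ => g) fun _ => hg
  have hmap := (iIndepFun_iff_map_fun_eq_pi_map hZae).1 hZind
  let μ : Fin (padSize n) ⊕ Fin (padSize n) → Measure Bool :=
    Sum.elim (fun _ => coinLaw (samplingFraction m n)) fun _ => coinLaw 2⁻¹
  have hμ : (fun i => P.map (Z i)) = μ := by
    funext i
    have h1 : P.map (Z i) = (P.map (Sum.elim B D i)).map g :=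
      (AEMeasurable.map_map_of_aemeasurable hg.aemeasurable (hae i)).symm
    rw [h1]
    rcases i with i | i
    · simp only [Sum.elim_inl, μ]
      rw [(hB i).map_eq]; exact bernoulliLaw_map _
    · simp only [Sum.elim_inr, μ]
      rw [(hD i).map_eq]; exact rademacherLaw_map
  rw [hμ] at hmap
  have : ∀ i, SigmaFinite (μ i) := by
    rintro (i | i) <;> simp only [μ, Sum.elim_inl, Sum.elim_inr] <;> infer_instance
  have hpres := measurePreserving_sumPiEquivProdPi μ
  have hZm : AEMeasurable (fun ω i => Z i ω) P := aemeasurable_pi_lambda _ hZae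
  refine ⟨fun ω => (fun i => g (B i ω), fun i => g (D i ω)), ?_, ?_, ?_⟩
  · exact (aemeasurable_pi_lambda _ fun i => hZae (Sum.inl i)).prodMk
      (aemeasurable_pi_lambda _ fun i => hZae (Sum.inr i))
  · have h2 := hpres.map_eq
    rw [← hmap, AEMeasurable.map_map_of_aemeasurable hpres.measurable.aemeasurable hZm] at h2
    exact h2
  · have h1 : ∀ᵐ ω ∂P, ∀ i, B i ω = ind (g (B i ω)) := ae_all_iff.2 fun i => ae_eq_ind (hB i)
    have h2 : ∀ᵐ ω ∂P, ∀ i, D i ω = sgn (g (D i ω)) := ae_all_iff.2 fun i => ae_eq_sgn (hD i)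
    filter_upwards [h1, h2] with ω hω1 hω2
    rw [hSeq, srhtOf]
    congr 1
    · funext i; exact hω1 i
    · funext i; exact hω2 i

/-- Up to a null set the matrix is a function on a finite space of coins, so an arbitrary `F` is
admissible; inverses and roots of matrices need no measurability argument. -/
theorem IsSRHT.aemeasurable {E : Type*} [MeasurableSpace E] (hS : IsSRHT P m n S)
    (F : Matrix (Fin (padSize n)) (Fin n) ℝ → E) : AEMeasurable (fun ω => F (S ω)) P := by
  obtain ⟨φ, hφ, -, hSφ⟩ := hS.exists_coins
  have h : AEMeasurable (fun ω => F (srhtOf m n (φ ω).1 (φ ω).2)) P :=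
    (measurable_of_finite fun c : (Fin (padSize n) → Bool) × (Fin (padSize n) → Bool) =>
      F (srhtOf m n c.1 c.2)).comp_aemeasurable hφ
  refine h.congr ?_
  filter_upwards [hSφ] with ω hω
  rw [hω]

/-- The signs are integrated last, so the inner integral is the conditional expectation given the
signs, to which the central limit theorem applies. -/
theorem IsSRHT.integral_eq {E : Type*} [NormedAddCommGroup E] [NormedSpace ℝ E]
    [MeasurableSpace E] [BorelSpace E] [SecondCountableTopology E]
    (hS : IsSRHT P m n S) (F : Matrix (Fin (padSize n)) (Fin n) ℝ → E) :
    ∫ ω, F (S ω) ∂P = ∫ x, ∫ b, F (srhtOf m n b x) ∂coins (Fin (padSize n)) (samplingFraction m n)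
      ∂coins (Fin (padSize n)) 2⁻¹ := by
  obtain ⟨φ, hφ, hmap, hSφ⟩ := hS.exists_coins
  have h1 : ∫ ω, F (S ω) ∂P = ∫ ω, F (srhtOf m n (φ ω).1 (φ ω).2) ∂P :=
    integral_congr_ae (by filter_upwards [hSφ] with ω hω; rw [hω])
  have hF : Measurable fun c : (Fin (padSize n) → Bool) × (Fin (padSize n) → Bool) =>
      F (srhtOf m n c.1 c.2) := measurable_of_finite _
  rw [h1, ← integral_map (f := fun c => F (srhtOf m n c.1 c.2)) hφ hF.aestronglyMeasurable, hmap]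
  exact integral_prod_symm _ Integrable.of_finite

end Law

/-! ### Asymptotic normality -/

section CharFun

open scoped Matrix.Norms.Frobenius

variable {p n m : ℕ}

theorem norm_exp_mul_I_sub_exp_mul_I_le (a b : ℝ) :
    ‖Complex.exp (a * Complex.I) - Complex.exp (b * Complex.I)‖ ≤ |a - b| := by
  have h1 : Complex.exp (a * Complex.I) - Complex.exp (b * Complex.I) =
      Complex.exp (b * Complex.I) * (Complex.exp (Complex.I * ((a - b : ℝ) : ℂ)) - 1) := by
    rw [mul_sub, ← Complex.exp_add, mul_one]
    congr 2
    push_cast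
    ring
  rw [h1, norm_mul, Complex.norm_exp_ofReal_mul_I, one_mul]
  exact Real.norm_exp_I_mul_ofReal_sub_one_le

theorem norm_exp_mul_I_sub_exp_mul_I_le_two (a b : ℝ) :
    ‖Complex.exp (a * Complex.I) - Complex.exp (b * Complex.I)‖ ≤ 2 := by
  refine (norm_sub_le _ _).trans ?_
  rw [Complex.norm_exp_ofReal_mul_I, Complex.norm_exp_ofReal_mul_I]
  norm_num

theorem integral_dotProduct_gramErr_sq_le (hm : 0 < m) (hγ : samplingFraction m n ≤ 1)
    {w v : Fin n → ℝ} (hw : euclNorm w = 1) (hv : euclNorm v = 1) :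
    ∫ x, ∫ b, (w ⬝ᵥ (gramErr (srhtOf m n b x) *ᵥ v)) ^ 2
      ∂coins (Fin (padSize n)) (samplingFraction m n) ∂coins (Fin (padSize n)) 2⁻¹ ≤ 3 / m := by
  have hm' : (0 : ℝ) < m := by exact_mod_cast hm
  have hN : (0 : ℝ) < padSize n := by simp [padSize]
  simp_rw [dotProduct_gramErr_srhtOf hm]
  have h := integral_sketchErr_sq_le (isWalsh_hadSigns n) (γ := samplingFraction m n)
    (w := padMatrix n *ᵥ w) (v := padMatrix n *ᵥ v) (K := 1)
    (div_pos hm' hN) hγ (by rw [sum_padMatrix_mulVec_sq, hw])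
    (by rw [sum_padMatrix_mulVec_sq, hv])
  refine h.trans (le_of_eq ?_)
  rw [Fintype.card_fin, samplingFraction, div_mul_cancel₀ _ hN.ne']
  norm_num

theorem euclNorm_col (U : Matrix (Fin n) (Fin p) ℝ) (hU : Uᵀ * U = 1) (a : Fin p) :
    euclNorm (fun i => U i a) = 1 := by
  have h : (Uᵀ * U) a a = 1 := by rw [hU, one_apply_eq]
  rw [← Real.sqrt_sq (euclNorm_nonneg _), euclNorm_sq, Real.sqrt_eq_one, ← h, mul_apply]
  exact Finset.sum_congr rfl fun i _ => by rw [transpose_apply, pow_two]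

theorem errSq_eq {N : ℕ} (S : Matrix (Fin N) (Fin n) ℝ) (U : Matrix (Fin n) (Fin p) ℝ)
    (v : Fin n → ℝ) :
    errSq S U v = ∑ a, ∑ b, ((fun i => U i a) ⬝ᵥ (gramErr S *ᵥ fun i => U i b)) ^ 2 +
      ∑ a, ((fun i => U i a) ⬝ᵥ (gramErr S *ᵥ v)) ^ 2 + (v ⬝ᵥ (gramErr S *ᵥ v)) ^ 2 := by
  rw [errSq, frobenius_sq, euclNorm_sq]
  congr 2
  refine Finset.sum_congr rfl fun a _ => Finset.sum_congr rfl fun b _ => ?_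
  rw [Matrix.mul_assoc, mul_apply, dotProduct]
  rfl

/-- The total error consists of `p² + p + 1` squared bilinear errors between unit vectors, each of
mean at most `3 / m`. -/
theorem integral_errSq_le (hm : 0 < m) (hγ : samplingFraction m n ≤ 1)
    {U : Matrix (Fin n) (Fin p) ℝ} (hU : Uᵀ * U = 1) {v : Fin n → ℝ} (hv : euclNorm v = 1) :
    ∫ x, ∫ b, errSq (srhtOf m n b x) U v
      ∂coins (Fin (padSize n)) (samplingFraction m n) ∂coins (Fin (padSize n)) 2⁻¹ ≤
      3 * (p * p + p + 1) / m := by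
  simp_rw [errSq_eq]
  have key : ∀ f g : (Fin (padSize n) → Bool) → (Fin (padSize n) → Bool) → ℝ,
      ∫ x, ∫ b, (f x b + g x b) ∂coins (Fin (padSize n)) (samplingFraction m n)
        ∂coins (Fin (padSize n)) 2⁻¹ =
      ∫ x, ∫ b, f x b ∂coins (Fin (padSize n)) (samplingFraction m n)
        ∂coins (Fin (padSize n)) 2⁻¹ +
      ∫ x, ∫ b, g x b ∂coins (Fin (padSize n)) (samplingFraction m n)
        ∂coins (Fin (padSize n)) 2⁻¹ := by
    intro f g
    rw [← integral_add Integrable.of_finite Integrable.of_finite]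
    exact integral_congr_ae (.of_forall fun x =>
      integral_add Integrable.of_finite Integrable.of_finite)
  have keys : ∀ f : Fin p → (Fin (padSize n) → Bool) → (Fin (padSize n) → Bool) → ℝ,
      ∫ x, ∫ b, (∑ a, f a x b) ∂coins (Fin (padSize n)) (samplingFraction m n)
        ∂coins (Fin (padSize n)) 2⁻¹ =
      ∑ a, ∫ x, ∫ b, f a x b ∂coins (Fin (padSize n)) (samplingFraction m n)
        ∂coins (Fin (padSize n)) 2⁻¹ := by
    intro f
    rw [← integral_finsetSum _ fun _ _ => Integrable.of_finite]
    exact integral_congr_ae (.of_forall fun x =>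
      integral_finsetSum _ fun _ _ => Integrable.of_finite)
  rw [key, key, keys, keys]
  simp_rw [keys]
  calc _ ≤ ∑ a : Fin p, ∑ b : Fin p, (3 / m : ℝ) + ∑ a : Fin p, (3 / m : ℝ) + 3 / m := by
        refine add_le_add (add_le_add ?_ ?_) (integral_dotProduct_gramErr_sq_le hm hγ hv hv)
        · exact Finset.sum_le_sum fun a _ => Finset.sum_le_sum fun b _ =>
            integral_dotProduct_gramErr_sq_le hm hγ (euclNorm_col U hU a) (euclNorm_col U hU b)
        · exact Finset.sum_le_sum fun a _ =>
            integral_dotProduct_gramErr_sq_le hm hγ (euclNorm_col U hU a) hv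
    _ = _ := by
        simp only [Finset.sum_const, Finset.card_univ, Fintype.card_fin, nsmul_eq_mul]
        ring

/-- A statistic which is linear in the sketching error, up to a quadratic remainder, and whose
linear part is standardized, has a characteristic function close to that of the standard normal
distribution. -/
theorem norm_charFun_sub_le {Ω : Type*} [MeasurableSpace Ω] {P : Measure Ω}
    [IsProbabilityMeasure P] {S : Ω → Matrix (Fin (padSize n)) (Fin n) ℝ} (hS : IsSRHT P m n S)
    (hm : 0 < m) (hγ : samplingFraction m n < 1)
    {U : Matrix (Fin n) (Fin p) ℝ} (hU : Uᵀ * U = 1) {v : Fin n → ℝ} (hv : euclNorm v = 1)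
    {R : Matrix (Fin p) (Fin p) ℝ} (hRn : ‖R‖ ≤ √p)
    (hR : R * (1 + (2 : ℝ) • vecMulVec (Uᵀ *ᵥ v) (Uᵀ *ᵥ v)) * Rᵀ = 1)
    {ρ : ℝ} (hρ : 0 < ρ) (hmax : (∀ i, euclNorm (U i) ≤ ρ) ∨ ∀ i, |v i| ≤ ρ)
    {c : ℝ} (hc : c = √(m / (1 - samplingFraction m n))) {C δ : ℝ} (hC : 0 ≤ C) (hδ : 0 < δ)
    {T : Matrix (Fin (padSize n)) (Fin n) ℝ → EuclideanSpace ℝ (Fin p)}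
    (hT : ∀ S, errSq S U v ≤ δ ^ 2 →
      euclNorm ((T S).ofLp - c • (R *ᵥ crossErr S U v)) ≤ C * c * errSq S U v)
    (t : EuclideanSpace ℝ (Fin p)) :
    ‖charFun (P.map fun ω => T (S ω)) t - Complex.exp (-‖t‖ ^ 2 / 2)‖ ≤
      (‖t‖ * C * c + 2 / δ ^ 2) * (3 * (p * p + p + 1) / m) +
      (75 * (1 + √p * ‖t‖) ^ 6 * c ^ 3 / m ^ 2 + (8 * (1 + √p * ‖t‖) ^ 3 * (ρ * (1 + √p * ‖t‖)) +
        2 * (1 + √p * ‖t‖) ^ 2 * (ρ * (1 + √p * ‖t‖)) ^ 2)) := by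
  have hm' : (0 : ℝ) < m := by exact_mod_cast hm
  have hN : (0 : ℝ) < padSize n := by simp [padSize]
  have hγ0 : 0 < samplingFraction m n := div_pos hm' hN
  have hc0 : 0 ≤ c := by rw [hc]; exact Real.sqrt_nonneg _
  have hγN : samplingFraction m n * padSize n = m := by
    rw [samplingFraction, div_mul_cancel₀ _ hN.ne']
  set K := 1 + √p * ‖t‖ with hK
  have hK1 : 1 ≤ K := by rw [hK]; linarith [mul_nonneg (Real.sqrt_nonneg (p : ℝ)) (norm_nonneg t)]
  -- In the direction `t`, the linear part is `c` times the single bilinear error between `w = U Rᵀ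
  -- t` and `v`, as in the Cramér–Wold device.
  set s : Fin p → ℝ := Rᵀ *ᵥ t.ofLp with hs
  have htn : euclNorm t.ofLp = ‖t‖ := rfl
  have hsn : euclNorm s ≤ √p * ‖t‖ := by
    refine (euclNorm_mulVec_le _ _).trans ?_
    rw [frobenius_norm_transpose, htn]
    exact mul_le_mul_of_nonneg_right hRn (norm_nonneg _)
  set w : Fin n → ℝ := U *ᵥ s with hw
  have hwn : euclNorm w = euclNorm s := euclNorm_mulVec_of_orthonormal hU s
  have hwv : w ⬝ᵥ v = s ⬝ᵥ (Uᵀ *ᵥ v) := by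
    rw [hw, dotProduct_mulVec s, vecMul_transpose]
  have hτ : euclNorm w ^ 2 * euclNorm v ^ 2 + 2 * (w ⬝ᵥ v) ^ 2 = ‖t‖ ^ 2 := by
    have h1 : t.ofLp ⬝ᵥ ((R * (1 + (2 : ℝ) • vecMulVec (Uᵀ *ᵥ v) (Uᵀ *ᵥ v)) * Rᵀ) *ᵥ t.ofLp) =
        ‖t‖ ^ 2 := by
      rw [hR, one_mulVec, dotProduct_self_eq, htn]
    rw [← mulVec_mulVec, ← hs, ← mulVec_mulVec, dotProduct_mulVec, ← mulVec_transpose, ← hs,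
      add_mulVec, one_mulVec, dotProduct_add, dotProduct_self_eq, smul_mulVec, dotProduct_smul,
      vecMulVec_mulVec, dotProduct_smul] at h1
    rw [hwv, hwn, hv, ← h1, dotProduct_comm (Uᵀ *ᵥ v) s]
    simp only [smul_eq_mul, MulOpposite.smul_eq_mul_unop, MulOpposite.unop_op]
    ring
  have hlin : ∀ S : Matrix (Fin (padSize n)) (Fin n) ℝ,
      t.ofLp ⬝ᵥ (c • (R *ᵥ crossErr S U v)) = c * (w ⬝ᵥ (gramErr S *ᵥ v)) := by
    intro S
    rw [dotProduct_smul, dotProduct_mulVec, ← mulVec_transpose, ← hs, crossErr, dotProduct_mulVec,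
      vecMul_transpose, smul_eq_mul]
  -- Where the expansion is unavailable, `errSq` exceeds `δ ^ 2` and the trivial bound 2 is at most
  -- `2 errSq / δ²`. This is Chebyshev's inequality applied inside the integral.
  have hpt : ∀ S : Matrix (Fin (padSize n)) (Fin n) ℝ,
      ‖Complex.exp ((inner ℝ (T S) t : ℝ) * Complex.I) -
        Complex.exp ((c * (w ⬝ᵥ (gramErr S *ᵥ v)) : ℝ) * Complex.I)‖ ≤
        (‖t‖ * C * c + 2 / δ ^ 2) * errSq S U v := by
    intro S
    have he := errSq_nonneg S U v
    by_cases hsm : errSq S U v ≤ δ ^ 2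
    · refine (norm_exp_mul_I_sub_exp_mul_I_le _ _).trans ?_
      have e1 : (inner ℝ (T S) t : ℝ) = t.ofLp ⬝ᵥ (T S).ofLp := by
        rw [EuclideanSpace.inner_eq_star_dotProduct, star_trivial]
      rw [← hlin, e1, ← dotProduct_sub]
      calc _ ≤ ‖t‖ * (C * c * errSq S U v) := (abs_dotProduct_le _ _).trans
            (mul_le_mul_of_nonneg_left (hT S hsm) (norm_nonneg t))
        _ ≤ ‖t‖ * C * c * errSq S U v + 2 / δ ^ 2 * errSq S U v := by
            have : 0 ≤ 2 / δ ^ 2 * errSq S U v := by positivity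
            linarith
        _ = _ := by ring
    · refine (norm_exp_mul_I_sub_exp_mul_I_le_two _ _).trans ?_
      have h2 : 2 ≤ 2 / δ ^ 2 * errSq S U v := by
        rw [div_mul_eq_mul_div, le_div_iff₀ (by positivity)]
        linarith [not_le.1 hsm]
      have h3 : 0 ≤ ‖t‖ * C * c * errSq S U v := by positivity
      linarith
  have hclt := norm_integral_exp_sketchErr_sub_le (isWalsh_hadSigns n) hγ0 hγ
    (w := padMatrix n *ᵥ w) (v := padMatrix n *ᵥ v) (K := K) (ρ := ρ * K) (by linarith)
    (by positivity)
    (by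
      rw [sum_padMatrix_mulVec_sq, hwn]
      exact pow_le_pow_left₀ (euclNorm_nonneg _) (by linarith) 2)
    (by
      rw [sum_padMatrix_mulVec_sq, hv]
      exact pow_le_pow_left₀ zero_le_one hK1 2)
    (by
      -- Each coordinate of `w` is the inner product of a row of `U` with `s`, so small leverage
      -- scores delocalize `w`; the alternative hypothesis delocalizes `v`.
      refine hmax.imp (fun h => ?_) fun h => ?_
      · refine abs_padMatrix_mulVec_le (by positivity) fun i => ?_
        refine (abs_dotProduct_le (U i) s).trans ?_
        exact mul_le_mul (h i) (by linarith) (euclNorm_nonneg _) hρ.le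
      · refine abs_padMatrix_mulVec_le (by positivity) fun i => (h i).trans ?_
        nlinarith)
    hc0 (by
      rw [hc, Real.sq_sqrt (div_nonneg hm'.le (by linarith)), Fintype.card_fin, hγN])
  have hdot := padMatrix_dotProduct w v
  rw [dotProduct] at hdot
  rw [sum_padMatrix_mulVec_sq, sum_padMatrix_mulVec_sq, hdot, hτ, Fintype.card_fin, hγN] at hclt
  simp_rw [← dotProduct_gramErr_srhtOf hm] at hclt
  have hchar : charFun (P.map fun ω => T (S ω)) t =
      ∫ x, ∫ b, Complex.exp ((inner ℝ (T (srhtOf m n b x)) t : ℝ) * Complex.I)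
        ∂coins (Fin (padSize n)) (samplingFraction m n) ∂coins (Fin (padSize n)) 2⁻¹ := by
    rw [charFun_apply, integral_map (hS.aemeasurable T)
      (by fun_prop)]
    exact hS.integral_eq fun S => Complex.exp ((inner ℝ (T S) t : ℝ) * Complex.I)
  have hexp : Complex.exp (-‖t‖ ^ 2 / 2) = ((Real.exp (-(‖t‖ ^ 2 / 2)) : ℝ) : ℂ) := by
    push_cast
    congr 1
    ring
  rw [hchar, hexp]
  refine (norm_sub_le_norm_sub_add_norm_sub _
    (∫ x, ∫ b, Complex.exp ((c * (w ⬝ᵥ (gramErr (srhtOf m n b x) *ᵥ v)) : ℝ) * Complex.I)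
        ∂coins (Fin (padSize n)) (samplingFraction m n) ∂coins (Fin (padSize n)) 2⁻¹) _).trans
    (add_le_add ?_ hclt)
  rw [← integral_sub Integrable.of_finite Integrable.of_finite]
  have hprob := isProbabilityMeasure_coins (ι := Fin (padSize n)) hγ0.le hγ.le
  calc _ ≤ ∫ x, ∫ b, (‖t‖ * C * c + 2 / δ ^ 2) * errSq (srhtOf m n b x) U v
        ∂coins (Fin (padSize n)) (samplingFraction m n) ∂coins (Fin (padSize n)) 2⁻¹ := by
        refine (norm_integral_le_integral_norm _).trans
          (integral_mono Integrable.of_finite Integrable.of_finite fun x => ?_)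
        simp only
        rw [← integral_sub Integrable.of_finite Integrable.of_finite]
        exact (norm_integral_le_integral_norm _).trans
          (integral_mono Integrable.of_finite Integrable.of_finite fun b => hpt _)
    _ = (‖t‖ * C * c + 2 / δ ^ 2) * ∫ x, ∫ b, errSq (srhtOf m n b x) U v
        ∂coins (Fin (padSize n)) (samplingFraction m n) ∂coins (Fin (padSize n)) 2⁻¹ := by
        simp_rw [integral_const_mul]
    _ ≤ _ := mul_le_mul_of_nonneg_left (integral_errSq_le hm hγ.le hU hv) (by positivity)

end CharFun

section Limit

open scoped Matrix.Norms.Frobenius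

variable {p : ℕ}

/-- These are the rates of the quadratic remainder and of the third-moment error. Both are of order
`m^(-1/2)` as long as the sampling fraction stays away from one. -/
theorem div_le_sqrt_of_samplingFraction_le {m γ r : ℝ} (hm : 0 < m) (hγ : γ ≤ r) (hr : r < 1) :
    √(m / (1 - γ)) / m ≤ √(1 / m * (1 / (1 - r))) ∧
      √(m / (1 - γ)) ^ 3 / m ^ 2 ≤ √(1 / m * (1 / (1 - r))) * (1 / (1 - r)) := by
  have h1 : 0 < 1 - r := by linarith
  have h2 : 0 < 1 - γ := by linarith
  have hinv : 1 / (1 - γ) ≤ 1 / (1 - r) := one_div_le_one_div_of_le h1 (by linarith)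
  have e1 : √(m / (1 - γ)) / m = √(1 / m * (1 / (1 - γ))) := by
    rw [div_eq_iff hm.ne', eq_comm]
    conv_lhs => rw [← Real.sqrt_sq hm.le, Real.sqrt_sq hm.le]
    rw [← Real.sqrt_sq hm.le, ← Real.sqrt_mul (by positivity), Real.sqrt_sq hm.le]
    congr 1
    field_simp
  have h3 : √(m / (1 - γ)) / m ≤ √(1 / m * (1 / (1 - r))) := by
    rw [e1]
    exact Real.sqrt_le_sqrt (mul_le_mul_of_nonneg_left hinv (by positivity))
  refine ⟨h3, ?_⟩
  have e2 : √(m / (1 - γ)) ^ 3 / m ^ 2 = √(m / (1 - γ)) / m * (1 / (1 - γ)) := by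
    have : √(m / (1 - γ)) ^ 2 = m / (1 - γ) := Real.sq_sqrt (by positivity)
    rw [pow_succ, this]
    field_simp
  rw [e2]
  exact mul_le_mul h3 hinv (by positivity) (Real.sqrt_nonneg _)

/-- Statistics which are linear in the sketching error, up to a quadratic remainder, and whose
linear part is standardized, are asymptotically standard normal. -/
theorem tendstoInDistribution_of_expansion {n m : ℕ → ℕ} (hm : Tendsto m atTop atTop)
    {r : ℝ} (hr : r < 1) (hγ : ∀ᶠ k in atTop, samplingFraction (m k) (n k) ≤ r)
    {Ω : ℕ → Type*} [∀ k, MeasurableSpace (Ω k)] {P : ∀ k, Measure (Ω k)}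
    [∀ k, IsProbabilityMeasure (P k)]
    {S : ∀ k, Ω k → Matrix (Fin (padSize (n k))) (Fin (n k)) ℝ}
    (hS : ∀ k, IsSRHT (P k) (m k) (n k) (S k))
    {U : ∀ k, Matrix (Fin (n k)) (Fin p) ℝ} (hU : ∀ k, (U k)ᵀ * U k = 1)
    {v : ∀ k, Fin (n k) → ℝ} (hv : ∀ k, euclNorm (v k) = 1)
    {ρ : ℕ → ℝ} (hρ : ∀ k, 0 < ρ k) (hρ0 : Tendsto ρ atTop (𝓝 0))
    (hmax : ∀ k, (∀ i, euclNorm (U k i) ≤ ρ k) ∨ ∀ i, |v k i| ≤ ρ k)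
    {C δ : ℝ} (hC : 0 ≤ C) (hδ : 0 < δ)
    {T : ∀ k, Matrix (Fin (padSize (n k))) (Fin (n k)) ℝ → EuclideanSpace ℝ (Fin p)}
    (hT : ∀ᶠ k in atTop, ∃ R : Matrix (Fin p) (Fin p) ℝ, ‖R‖ ≤ √p ∧
      R * (1 + (2 : ℝ) • vecMulVec ((U k)ᵀ *ᵥ v k) ((U k)ᵀ *ᵥ v k)) * Rᵀ = 1 ∧
      ∀ S, errSq S (U k) (v k) ≤ δ ^ 2 →
        euclNorm ((T k S).ofLp -
          √(m k / (1 - samplingFraction (m k) (n k))) • (R *ᵥ crossErr S (U k) (v k))) ≤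
        C * √(m k / (1 - samplingFraction (m k) (n k))) * errSq S (U k) (v k)) :
    TendstoInDistribution (fun k ω => T k (S k ω)) atTop
      (id : EuclideanSpace ℝ (Fin p) → EuclideanSpace ℝ (Fin p)) P
      (stdGaussian (EuclideanSpace ℝ (Fin p))) := by
  refine ⟨fun k => (hS k).aemeasurable (T k), aemeasurable_id, ?_⟩
  -- By Lévy's continuity theorem, a bound tending to zero for each fixed `t` is enough. It depends
  -- on `R` only through `‖R‖ ≤ √p`, so `R` may vary with `k`.
  refine ProbabilityMeasure.tendsto_iff_tendsto_charFun.2 fun t => ?_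
  change Tendsto (fun k => charFun ((P k).map fun ω => T k (S k ω)) t) atTop
    (𝓝 (charFun ((stdGaussian (EuclideanSpace ℝ (Fin p))).map id) t))
  rw [Measure.map_id, charFun_stdGaussian]
  rw [tendsto_iff_norm_sub_tendsto_zero]
  set K := 1 + √p * ‖t‖ with hK
  have hK0 : 0 ≤ K := by positivity
  set Q : ℝ := 3 * (p * p + p + 1) with hQ
  have hQ0 : 0 ≤ Q := by positivity
  have hi : Tendsto (fun k => 1 / (m k : ℝ)) atTop (𝓝 0) :=
    tendsto_const_nhds.div_atTop (tendsto_natCast_atTop_atTop.comp hm)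
  have he : Tendsto (fun k => √(1 / (m k : ℝ) * (1 / (1 - r)))) atTop (𝓝 0) := by
    have := (hi.mul_const (1 / (1 - r))).sqrt
    simpa using this
  have hbound : Tendsto (fun k => ‖t‖ * C * Q * √(1 / (m k : ℝ) * (1 / (1 - r))) +
      2 / δ ^ 2 * Q * (1 / (m k : ℝ)) +
      (75 * K ^ 6 * (1 / (1 - r)) * √(1 / (m k : ℝ) * (1 / (1 - r))) +
        (8 * K ^ 4 * ρ k + 2 * K ^ 4 * ρ k ^ 2))) atTop (𝓝 0) := by
    have := ((he.const_mul (‖t‖ * C * Q)).add (hi.const_mul (2 / δ ^ 2 * Q))).add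
      ((he.const_mul (75 * K ^ 6 * (1 / (1 - r)))).add
        ((hρ0.const_mul (8 * K ^ 4)).add ((hρ0.pow 2).const_mul (2 * K ^ 4))))
    simpa using this
  refine squeeze_zero' (.of_forall fun k => norm_nonneg _) ?_ hbound
  filter_upwards [hγ, hT, hm.eventually_ge_atTop 1] with k hγk hTk hmk
  obtain ⟨R, hRn, hR, hTR⟩ := hTk
  have hmk' : (0 : ℝ) < m k := by exact_mod_cast hmk
  obtain ⟨h1, h2⟩ := div_le_sqrt_of_samplingFraction_le hmk' hγk hr
  refine (norm_charFun_sub_le (hS k) hmk (hγk.trans_lt hr) (hU k) (hv k) hRn hR (hρ k) (hmax k) rfl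
    hC hδ hTR t).trans ?_
  rw [← hK, ← hQ]
  set c := √((m k : ℝ) / (1 - samplingFraction (m k) (n k)))
  calc _ = ‖t‖ * C * Q * (c / m k) + 2 / δ ^ 2 * Q * (1 / (m k : ℝ)) +
      (75 * K ^ 6 * (c ^ 3 / (m k : ℝ) ^ 2) + (8 * K ^ 4 * ρ k + 2 * K ^ 4 * ρ k ^ 2)) := by ring
    _ ≤ ‖t‖ * C * Q * √(1 / (m k : ℝ) * (1 / (1 - r))) + 2 / δ ^ 2 * Q * (1 / (m k : ℝ)) +
      (75 * K ^ 6 * (√(1 / (m k : ℝ) * (1 / (1 - r))) * (1 / (1 - r))) +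
        (8 * K ^ 4 * ρ k + 2 * K ^ 4 * ρ k ^ 2)) := by gcongr
    _ = _ := by ring

end Limit

/-! ### The polar form of the data and the conditions of the theorem -/

section Polar

open scoped Matrix.Norms.Frobenius

variable {p n : ℕ} {X U : Matrix (Fin n) (Fin p) ℝ} {ℓ : Fin p → ℝ}
  {V : Matrix (Fin p) (Fin p) ℝ}

theorem norm_diagonal_le {d : Fin p → ℝ} {M : ℝ} (hM : 0 ≤ M) (hd : ∀ i, |d i| ≤ M) :
    ‖Matrix.diagonal d‖ ≤ √p * M := by
  rw [frobenius_norm_diagonal, ← euclNorm]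
  refine (sq_le_sq₀ (euclNorm_nonneg _) (by positivity)).1 ?_
  rw [euclNorm_sq, mul_pow, Real.sq_sqrt (by positivity)]
  calc _ ≤ ∑ _i : Fin p, M ^ 2 := Finset.sum_le_sum fun i _ =>
        sq_le_sq' (neg_le_of_abs_le (hd i)) (le_of_abs_le (hd i))
    _ = _ := by simp

theorem norm_of_transpose_mul_self {V : Matrix (Fin p) (Fin p) ℝ} (hV : Vᵀ * V = 1) : ‖V‖ = √p := by
  rw [← Real.sqrt_sq (norm_nonneg V), ← trace_transpose_mul_self, hV]
  simp

theorem norm_conj_diagonal_le (hV : Vᵀ * V = 1) {d : Fin p → ℝ} {M : ℝ} (hM : 0 ≤ M)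
    (hd : ∀ i, |d i| ≤ M) : ‖V * Matrix.diagonal d * Vᵀ‖ ≤ p * √p * M := by
  have h1 := norm_diagonal_le hM hd
  calc _ ≤ ‖V‖ * ‖Matrix.diagonal d‖ * ‖Vᵀ‖ :=
        (norm_mul_le _ _).trans (mul_le_mul_of_nonneg_right (norm_mul_le _ _) (norm_nonneg _))
    _ ≤ √p * (√p * M) * √p := by
        rw [frobenius_norm_transpose, norm_of_transpose_mul_self hV]
        gcongr
    _ = (√p * √p) * √p * M := by ring
    _ = _ := by rw [Real.mul_self_sqrt (by positivity)]

namespace IsThinSVD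

/-- The polar form of the design matrix. -/
theorem eq_polar (h : IsThinSVD X U ℓ V) : X = U * Vᵀ * (V * Matrix.diagonal ℓ * Vᵀ) := by
  rw [h.eq_mul]
  calc _ = U * (1 * (Matrix.diagonal ℓ * Vᵀ)) := by rw [Matrix.one_mul, Matrix.mul_assoc]
    _ = _ := by rw [← h.orthV]; simp only [Matrix.mul_assoc]

theorem orth_polar (h : IsThinSVD X U ℓ V) : (U * Vᵀ)ᵀ * (U * Vᵀ) = 1 := by
  rw [transpose_mul, transpose_transpose]
  calc _ = V * (Uᵀ * U) * Vᵀ := by simp only [Matrix.mul_assoc]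
    _ = 1 := by rw [h.orthU, Matrix.mul_one]; exact mul_eq_one_comm.1 h.orthV

theorem euclNorm_row_polar (h : IsThinSVD X U ℓ V) (i : Fin n) :
    euclNorm ((U * Vᵀ) i) = euclNorm (U i) := by
  have : (U * Vᵀ) i = V *ᵥ U i := by
    funext a
    simp [mul_apply, mulVec, dotProduct, mul_comm]
  rw [this]
  exact euclNorm_mulVec_of_orthonormal h.orthV _

/-- The factor `p √p` is the price of Frobenius norms: one `√p` each for `V`, for `Vᵀ` and for the
diagonal factor. -/
theorem wellCond (h : IsThinSVD X U ℓ V) (hp : 0 < p) {κ : ℝ}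
    (hκ : ℓ ⟨0, hp⟩ / ℓ ⟨p - 1, Nat.sub_lt hp Nat.one_pos⟩ ≤ κ) :
    WellCond (V * Matrix.diagonal ℓ * Vᵀ) (ℓ ⟨p - 1, Nat.sub_lt hp Nat.one_pos⟩) (p * √p * κ) := by
  set a := ℓ ⟨p - 1, Nat.sub_lt hp Nat.one_pos⟩ with ha
  have ha0 : 0 < a := h.pos _
  have hmin : ∀ i, a ≤ ℓ i := fun i => h.anti (by
    rw [Fin.le_def]; have := i.2; simp only; omega)
  have hmax : ∀ i, ℓ i ≤ κ * a := fun i => by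
    rw [div_le_iff₀ ha0] at hκ
    exact (h.anti (by rw [Fin.le_def]; simp)).trans hκ
  have hκ1 : 1 ≤ κ := by
    have := (hmin ⟨0, hp⟩).trans (hmax ⟨0, hp⟩)
    nlinarith
  have hp' : (0 : ℝ) < p := by exact_mod_cast hp
  have hVV : V * Vᵀ = 1 := mul_eq_one_comm.1 h.orthV
  have hinv : (V * Matrix.diagonal ℓ * Vᵀ)⁻¹ = V * Matrix.diagonal (fun i => (ℓ i)⁻¹) * Vᵀ := by
    refine inv_eq_left_inv ?_
    calc _ = V * Matrix.diagonal (fun i => (ℓ i)⁻¹) * (Vᵀ * V) * Matrix.diagonal ℓ * Vᵀ := by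
          simp only [Matrix.mul_assoc]
      _ = V * (Matrix.diagonal (fun i => (ℓ i)⁻¹) * Matrix.diagonal ℓ) * Vᵀ := by
          rw [h.orthV, Matrix.mul_one]; simp only [Matrix.mul_assoc]
      _ = 1 := by
          rw [diagonal_mul_diagonal]
          have : (fun i => (ℓ i)⁻¹ * ℓ i) = fun _ => (1 : ℝ) :=
            funext fun i => inv_mul_cancel₀ (h.pos i).ne'
          rw [this, diagonal_one, Matrix.mul_one, hVV]
  refine ⟨ha0, by positivity, ?_, ?_, ?_, ?_⟩
  · simp only [transpose_mul, transpose_transpose, diagonal_transpose, Matrix.mul_assoc]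
  · have e : V * Matrix.diagonal ℓ * Vᵀ - a • (1 : Matrix (Fin p) (Fin p) ℝ) =
        V * Matrix.diagonal (fun i => ℓ i - a) * Vᵀ := by
      have : Matrix.diagonal (fun i => ℓ i - a) =
          Matrix.diagonal ℓ - a • (1 : Matrix (Fin p) (Fin p) ℝ) := by
        ext i j
        by_cases hij : i = j
        · subst hij; simp
        · simp [hij]
      rw [this, Matrix.mul_sub, Matrix.sub_mul, Matrix.mul_smul, Matrix.smul_mul, Matrix.mul_one,
        hVV]
    rw [e]
    have hd : (Matrix.diagonal fun i => ℓ i - a).PosSemidef :=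
      PosSemidef.diagonal fun i => sub_nonneg.2 (hmin i)
    have := hd.mul_mul_conjTranspose_same V
    rwa [conjTranspose_eq_transpose_of_trivial] at this
  · refine (norm_conj_diagonal_le h.orthV (M := κ * a) (by positivity) fun i => ?_).trans
      (le_of_eq (by ring))
    rw [abs_of_pos (h.pos i)]
    exact hmax i
  · rw [hinv]
    refine (norm_conj_diagonal_le h.orthV (M := κ / a) (by positivity) fun i => ?_).trans
      (le_of_eq (by ring))
    rw [abs_of_pos (inv_pos.2 (h.pos i)), inv_le_comm₀ (h.pos i) (by positivity), inv_div]
    exact (div_le_self ha0.le hκ1).trans (hmin i)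

end IsThinSVD

theorem eventually_le_of_boundedCondNumber {hp : 0 < p} {ℓ : ℕ → Fin p → ℝ}
    (h : BoundedCondNumber hp ℓ) :
    ∃ κ : ℝ, 0 < κ ∧
      ∀ᶠ k in atTop, ℓ k ⟨0, hp⟩ / ℓ k ⟨p - 1, Nat.sub_lt hp Nat.one_pos⟩ ≤ κ := by
  obtain ⟨κ, h1, -⟩ := EReal.lt_iff_exists_real_btwn.1 h
  refine ⟨max κ 1, by positivity, ?_⟩
  filter_upwards [eventually_lt_of_limsup_lt h1] with k hk
  exact (EReal.coe_lt_coe_iff.1 hk).le.trans (le_max_left _ _)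

theorem exists_delocalization_rate {n : ℕ → ℕ} {U : ∀ k, Matrix (Fin (n k)) (Fin p) ℝ}
    {e : ∀ k, Fin (n k) → ℝ} (h : VanishingLeverage U ∨ Delocalized e) :
    ∃ ρ : ℕ → ℝ, (∀ k, 0 < ρ k) ∧ Tendsto ρ atTop (𝓝 0) ∧
      ∀ k, (∀ i, euclNorm (U k i) ≤ ρ k) ∨ ∀ i, |e k i| / euclNorm (e k) ≤ ρ k := by
  have key : ∀ f : ∀ k, Fin (n k) → ℝ, (∀ k i, 0 ≤ f k i) →
      Tendsto (fun k => ⨆ i, f k i) atTop (𝓝 0) →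
      ∃ ρ : ℕ → ℝ, (∀ k, 0 < ρ k) ∧ Tendsto ρ atTop (𝓝 0) ∧ ∀ k i, f k i ≤ ρ k := by
    intro f hf hlim
    -- The supremum may vanish, for instance over an empty index set, while the estimates divide by
    -- `ρ`; the added null sequence keeps the rate positive.
    refine ⟨fun k => (⨆ i, f k i) + 1 / ((k : ℝ) + 1), fun k => ?_, ?_, fun k i => ?_⟩
    · have : 0 ≤ ⨆ i, f k i := Real.iSup_nonneg (hf k)
      positivity
    · simpa using hlim.add tendsto_one_div_add_atTop_nhds_zero_nat
    · have h1 : f k i ≤ ⨆ i, f k i := le_ciSup (Set.finite_range _).bddAbove i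
      have h2 : (0 : ℝ) < 1 / ((k : ℝ) + 1) := by positivity
      linarith
  rcases h with h | h
  · obtain ⟨ρ, h1, h2, h3⟩ := key _ (fun k i => euclNorm_nonneg (U k i)) h
    exact ⟨ρ, h1, h2, fun k => Or.inl (h3 k)⟩
  · obtain ⟨ρ, h1, h2, h3⟩ := key _
      (fun k i => div_nonneg (abs_nonneg (e k i)) (euclNorm_nonneg (e k))) h
    exact ⟨ρ, h1, h2, fun k => Or.inr (h3 k)⟩

end Polar

/-! ### The two limit theorems -/

section Main

variable {p : ℕ} {n m : ℕ → ℕ} {X : ∀ k, Matrix (Fin (n k)) (Fin p) ℝ}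
  {y : ∀ k, Fin (n k) → ℝ} {U : ∀ k, Matrix (Fin (n k)) (Fin p) ℝ} {ℓ : ℕ → Fin p → ℝ}
  {V : ℕ → Matrix (Fin p) (Fin p) ℝ} {Ω : ℕ → Type*} [∀ k, MeasurableSpace (Ω k)]
  {P : ∀ k, Measure (Ω k)} [∀ k, IsProbabilityMeasure (P k)]
  {S : ∀ k, Ω k → Matrix (Fin (padSize (n k))) (Fin (n k)) ℝ}

theorem eventually_samplingFraction_le
    (hγ : limsup (fun k => (samplingFraction (m k) (n k) : EReal)) atTop < 1) :
    ∃ r : ℝ, r < 1 ∧ ∀ᶠ k in atTop, samplingFraction (m k) (n k) ≤ r := by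
  obtain ⟨r, h1, h2⟩ := EReal.lt_iff_exists_real_btwn.1 hγ
  refine ⟨r, by exact_mod_cast h2, ?_⟩
  filter_upwards [eventually_lt_of_limsup_lt h1] with k hk
  exact (EReal.coe_lt_coe_iff.1 hk).le

open scoped Matrix.Norms.Frobenius in
-- Here `v` is the normalized residual. It is orthogonal to the columns of the polar factor, so the
-- rank-one part of the covariance vanishes and `R = 1` standardizes the linear term.
theorem tendstoInDistribution_studentizedSketchSolve (hp : 0 < p)
    (hSVD : ∀ k, IsThinSVD (X k) (U k) (ℓ k) (V k)) (hcond : BoundedCondNumber hp ℓ)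
    (hm : Tendsto m atTop atTop)
    (hγ : limsup (fun k => (samplingFraction (m k) (n k) : EReal)) atTop < 1)
    (hS : ∀ k, IsSRHT (P k) (m k) (n k) (S k))
    (hres : ∀ k, lsResidual (X k) (y k) ≠ 0)
    (hdeloc : VanishingLeverage U ∨ Delocalized (fun k => lsResidual (X k) (y k))) :
    TendstoInDistribution
      (fun k ω => studentizedSketchSolve √(m k / (1 - samplingFraction (m k) (n k)))
        (S k ω) (X k) (y k))
      atTop (id : EuclideanSpace ℝ (Fin p) → EuclideanSpace ℝ (Fin p)) P
      (stdGaussian (EuclideanSpace ℝ (Fin p))) := by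
  obtain ⟨r, hr, hγr⟩ := eventually_samplingFraction_le hγ
  obtain ⟨κ, hκ0, hκ⟩ := eventually_le_of_boundedCondNumber hcond
  obtain ⟨ρ, hρ, hρ0, hmax⟩ := exists_delocalization_rate hdeloc
  have hp' : (0 : ℝ) < p := by exact_mod_cast hp
  obtain ⟨C, δ, hC, hδ, hexp⟩ :=
    exists_sketchSolve_expansion p (κ := p * √p * κ) (by positivity)
  have he0 : ∀ k, 0 < euclNorm (lsResidual (X k) (y k)) := fun k => euclNorm_pos (hres k)
  refine tendstoInDistribution_of_expansion hm hr hγr hS (U := fun k => U k * (V k)ᵀ)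
    (fun k => (hSVD k).orth_polar)
    (v := fun k => (euclNorm (lsResidual (X k) (y k)))⁻¹ • lsResidual (X k) (y k))
    (fun k => by rw [euclNorm_smul, abs_of_pos (inv_pos.2 (he0 k)), inv_mul_cancel₀ (he0 k).ne'])
    hρ hρ0 (fun k => (hmax k).imp (fun h i => ?_) fun h i => ?_) hC hδ
    (T := fun k S => studentizedSketchSolve √(m k / (1 - samplingFraction (m k) (n k)))
      S (X k) (y k)) ?_
  · rw [(hSVD k).euclNorm_row_polar]; exact h i
  · rw [Pi.smul_apply, smul_eq_mul, abs_mul, abs_of_pos (inv_pos.2 (he0 k)), inv_mul_eq_div]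
    exact h i
  · filter_upwards [hκ] with k hk
    have hA := (hSVD k).wellCond hp hk
    have hX := (hSVD k).eq_polar
    have hU := (hSVD k).orth_polar
    have hres0 := transpose_mulVec_lsResidual hU hA (y k)
    have hresk := hres k
    rw [← hX] at hres0
    refine ⟨1, frobenius_one.le, ?_, fun S hS => ?_⟩
    · rw [mulVec_smul, hres0]
      simp
    · rw [one_mulVec]
      have h := hexp (c := √(m k / (1 - samplingFraction (m k) (n k)))) S (y k) ((euclNorm (lsResidual (X k) (y k)))⁻¹ • lsResidual (X k) (y k))
        hU hA (by rwa [← hX]) (by rw [← hX]) (Real.sqrt_nonneg _) hS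
      rwa [← hX] at h

open scoped Matrix.Norms.Frobenius in
-- Here `v` is the normalized fit and lies in the column space, so the rank-one term `2 θ θᵀ` is
-- present in full and has to be whitened.
theorem tendstoInDistribution_studentizedPartialSketch (hp : 0 < p)
    (hSVD : ∀ k, IsThinSVD (X k) (U k) (ℓ k) (V k)) (hcond : BoundedCondNumber hp ℓ)
    (hm : Tendsto m atTop atTop)
    (hγ : limsup (fun k => (samplingFraction (m k) (n k) : EReal)) atTop < 1)
    (hS : ∀ k, IsSRHT (P k) (m k) (n k) (S k))
    (hfit : ∀ k, lsFitted (X k) (y k) ≠ 0)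
    (hdeloc : VanishingLeverage U ∨ Delocalized (fun k => lsFitted (X k) (y k))) :
    TendstoInDistribution
      (fun k ω => studentizedPartialSketch √(m k / (1 - samplingFraction (m k) (n k)))
        (S k ω) (X k) (y k))
      atTop (id : EuclideanSpace ℝ (Fin p) → EuclideanSpace ℝ (Fin p)) P
      (stdGaussian (EuclideanSpace ℝ (Fin p))) := by
  obtain ⟨r, hr, hγr⟩ := eventually_samplingFraction_le hγ
  obtain ⟨κ, hκ0, hκ⟩ := eventually_le_of_boundedCondNumber hcond
  obtain ⟨ρ, hρ, hρ0, hmax⟩ := exists_delocalization_rate hdeloc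
  have hp' : (0 : ℝ) < p := by exact_mod_cast hp
  obtain ⟨C, δ, hC, hδ, hexp⟩ :=
    exists_partialSketch_expansion p (κ := p * √p * κ) (by positivity)
  have he0 : ∀ k, 0 < euclNorm (lsFitted (X k) (y k)) := fun k => euclNorm_pos (hfit k)
  refine tendstoInDistribution_of_expansion hm hr hγr hS (U := fun k => U k * (V k)ᵀ)
    (fun k => (hSVD k).orth_polar)
    (v := fun k => (euclNorm (lsFitted (X k) (y k)))⁻¹ • lsFitted (X k) (y k))
    (fun k => by rw [euclNorm_smul, abs_of_pos (inv_pos.2 (he0 k)), inv_mul_cancel₀ (he0 k).ne'])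
    hρ hρ0 (fun k => (hmax k).imp (fun h i => ?_) fun h i => ?_) hC hδ
    (T := fun k S => studentizedPartialSketch √(m k / (1 - samplingFraction (m k) (n k)))
      S (X k) (y k)) ?_
  · rw [(hSVD k).euclNorm_row_polar]; exact h i
  · rw [Pi.smul_apply, smul_eq_mul, abs_mul, abs_of_pos (inv_pos.2 (he0 k)), inv_mul_eq_div]
    exact h i
  · filter_upwards [hκ] with k hk
    have hA := (hSVD k).wellCond hp hk
    have hX := (hSVD k).eq_polar
    have hU := (hSVD k).orth_polar
    have hfitk := lsFitted_eq hU hA (y k)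
    rw [← hX] at hfitk
    have ht := he0 k
    set t := euclNorm (lsFitted (X k) (y k)) with htdef
    set W := U k * (V k)ᵀ with hW
    set A := V k * Matrix.diagonal (ℓ k) * (V k)ᵀ
    set θ : Fin p → ℝ := t⁻¹ • (Wᵀ *ᵥ y k) with hθ
    have hv : t⁻¹ • lsFitted (X k) (y k) = W *ᵥ θ := by rw [hfitk, hθ, mulVec_smul]
    have hθn : euclNorm θ = 1 := by
      rw [← euclNorm_mulVec_of_orthonormal hU, ← hv, euclNorm_smul, abs_of_pos (inv_pos.2 ht),
        ← htdef, inv_mul_cancel₀ ht.ne']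
    have hWv : Wᵀ *ᵥ (W *ᵥ θ) = θ := by rw [mulVec_mulVec, hU, one_mulVec]
    have hA' := hA.smul (inv_pos.2 ht)
    have hG := one_add_vecMulVec_sub_one_posSemidef θ
    simp only [hv]
    -- The sign comes from the expansion of the estimator and drops out of `R G Rᵀ`.
    refine ⟨-whitener (t⁻¹ • A) (1 + (2 : ℝ) • vecMulVec θ θ), ?_, ?_, fun S hS => ?_⟩
    · rw [norm_neg]
      exact hA'.norm_whitener_le hG
    · rw [hWv, transpose_neg, Matrix.neg_mul, Matrix.neg_mul, Matrix.mul_neg, neg_neg]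
      exact hA'.whitener_mul_mul hG
    · rw [neg_mulVec]
      have h := hexp (c := √(m k / (1 - samplingFraction (m k) (n k)))) S (y k) θ hU hA ht (by rw [hθ, smul_smul, mul_inv_cancel₀ ht.ne', one_smul])
        hθn (Real.sqrt_nonneg _) hS
      rwa [← hX] at h

end Main

end SketchedLS

open SketchedLS

/-- Inference in least squares with subsampled randomized Hadamard sketching. The index `k` runs
through an arbitrary sequence of data sets, of sample sizes `n k → ∞`, and sketch sizes `m k`. -/
theorem mainTheorem8 {p : ℕ} (hp : 0 < p) (n m : ℕ → ℕ)
    (X : ∀ k, Matrix (Fin (n k)) (Fin p) ℝ) (y : ∀ k, Fin (n k) → ℝ)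
    (U : ∀ k, Matrix (Fin (n k)) (Fin p) ℝ) (ℓ : ℕ → Fin p → ℝ)
    (V : ℕ → Matrix (Fin p) (Fin p) ℝ)
    (hSVD : ∀ k, IsThinSVD (X k) (U k) (ℓ k) (V k))
    (hcond : BoundedCondNumber hp ℓ)
    (hn : Tendsto n atTop atTop) (hm : Tendsto m atTop atTop)
    (hmn : Tendsto (fun k => (m k : ℝ) / Real.log (n k) ^ 2) atTop atTop)
    (hγ : limsup (fun k => (samplingFraction (m k) (n k) : EReal)) atTop < 1)
    {Ω : ℕ → Type*} [∀ k, MeasurableSpace (Ω k)] (P : ∀ k, Measure (Ω k))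
    [∀ k, IsProbabilityMeasure (P k)]
    (S : ∀ k, Ω k → Matrix (Fin (padSize (n k))) (Fin (n k)) ℝ)
    (hS : ∀ k, IsSRHT (P k) (m k) (n k) (S k)) :
    ((∀ k, lsResidual (X k) (y k) ≠ 0) →
      VanishingLeverage U ∨ Delocalized (fun k => lsResidual (X k) (y k)) →
      TendstoInDistribution
        (fun k ω => studentizedSketchSolve √(m k / (1 - samplingFraction (m k) (n k)))
          (S k ω) (X k) (y k))
        atTop (id : EuclideanSpace ℝ (Fin p) → EuclideanSpace ℝ (Fin p)) P
        (stdGaussian (EuclideanSpace ℝ (Fin p)))) ∧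
    ((∀ k, lsFitted (X k) (y k) ≠ 0) →
      VanishingLeverage U ∨ Delocalized (fun k => lsFitted (X k) (y k)) →
      TendstoInDistribution
        (fun k ω => studentizedPartialSketch √(m k / (1 - samplingFraction (m k) (n k)))
          (S k ω) (X k) (y k))
        atTop (id : EuclideanSpace ℝ (Fin p) → EuclideanSpace ℝ (Fin p)) P
        (stdGaussian (EuclideanSpace ℝ (Fin p)))) := by
  exact ⟨tendstoInDistribution_studentizedSketchSolve hp hSVD hcond hm hγ hS,
    tendstoInDistribution_studentizedPartialSketch hp hSVD hcond hm hγ hS⟩
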